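/- Let $T>0$, let $X\subset H\subset X'$ be a normal triple of real Hilbert spaces ($X$ is densely and continuously embedded in $H$, and $X'$ is the dual of $X$, with the dual norm, relative to the inner product of $H$; $\langle\cdot,\cdot\rangle$ is the duality between $X'$ and $X$), and let $(\Omega,\mathcal F,\mathbb P)$ be a probability space. Assume: (A1) $\mathcal A:X\to X'$ is bounded linear and there are $\delta_A>0$ and $C_A\ge 0$ with $$2\langle \mathcal A v,v\rangle+\delta_A\|v\|_X^2\le C_A\|v\|_H^2,\qquad v\in X.$$ (A2) For $\ell\ge1$, $\mathfrak X_\ell=\{\mathfrak X_\ell(f): f\in L_2((0,T))\}$ is a colored noise on $L_2((0,T))$: a family of zero-mean Gaussian random variables with $\mathbb E(\mathfrak X_\ell(f)\mathfrak X_\ell(g))=\int_0^T(\mathcal R_\ell f)(s)g(s)\,ds$, where $\mathcal R_\ell=\mathcal K_\ell\mathcal K_\ell^*$ and $\mathcal K_\ell$ is a bounded linear operator on $L_2((0,T))$ with operator norm $\mathfrak K_\ell$. Moreover $\mathfrak X_\ell(f)=\int_0^T(\mathcal K_\ell^*f)(s)\,dW_\ell(s)$ with a standard Brownian motion $W_\ell$.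 (A3) $u_0,F,G_\ell$ are non-random, and the noises $\mathfrak X_\ell$, as well as the Brownian motions $W_\ell$, are jointly independent. (A4) Each $\mathcal B_\ell$ is a bounded linear operator on $H$ with operator norm $C_\ell$. (A5) $u_0\in H$, $F\in L_2((0,T);X')$, $G_\ell\in L_2((0,T);H)$, $\sum_{\ell}\mathfrak K_\ell^2\int_0^T\|G_\ell(t)\|_H^2dt<\infty$, and $C_B=\sum_\ell \mathfrak K_\ell^2C_\ell^2<\infty$. Let $\{h_k\}_{k\ge1}$ be an orthonormal basis of $L_2((0,T))$, $\xi_{k\ell}=\int_0^Th_k\,dW_\ell$, and, for a multi-index $\alpha=\{\alpha_{k\ell}\}$ of non-negative integers with $|\alpha|=\sum_{k,\ell}\alpha_{k\ell}<\infty$, let $\xi_\alpha=\prod_{k,\ell}H_{\alpha_{k\ell}}(\xi_{k\ell})/\sqrt{\alpha_{k\ell}!}$, where $H_n$ is the $n$-th (probabilists') Hermite polynomial. Let $\epsilon_{k\ell}$ be the multi-index with the single nonzero entry $1$ at $(k,\ell)$, and write $u_{0,\alpha}=\mathbb E(u_0\xi_\alpha)$, $F_\alpha(t)=\mathbb E(F(t)\xi_\alpha)$,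 $G_{\ell,\alpha}(t)=\mathbb E(G_\ell(t)\xi_\alpha)$. Let $\{u_\alpha\}$ be the chaos solution of $$u(t)=u_0+\int_0^t(\mathcal Au+F)\,ds+\sum_{\ell\ge1}\mathfrak X_\ell(\chi_t\mathcal B_\ell u+\chi_tG_\ell),$$ where $\chi_t$ is the indicator function of $[0,t]$; that is, every $u_\alpha$ is an element of $L_2((0,T);X)$ and, in $X'$ for all $t\in[0,T]$, $$u_\alpha(t)=u_{0,\alpha}+\int_0^t(\mathcal Au_\alpha+F_\alpha)\,ds+\sum_{k,\ell}\sqrt{\alpha_{k\ell}}\int_0^t(\mathcal B_\ell u_{\alpha-\epsilon_{k\ell}}(s)+G_{\ell,\alpha-\epsilon_{k\ell}}(s))(\mathcal K_\ell h_k)(s)\,ds .$$ Then there is a number $C_o$ with $1\le C_o\le3$, and $C_o=1$ if $F=0$ and $G_\ell=0$ for all $\ell$, such that for every $0\le t\le T$ and $k\ge1$ one has $u_\alpha(t)\in H$ for all $|\alpha|=k$ and $$\sum_{|\alpha|=k}\|u_\alpha(t)\|_H^2\le C_oe^{C_AT}\Bigg(\frac{(C_BT)^k}{k!}\Big(\|u_0\|_H^2+\frac2{\delta_A}\int_0^T\|F(s)\|_{X'}^2ds\Big)+\frac{(C_BT)^{k-1}}{(k-1)!}\sum_{\ell\ge1}\mathfrak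 K_\ell^2\int_0^T\|G_\ell(s)\|_H^2ds\Bigg).$$ -/

import Mathlib

open MeasureTheory ProbabilityTheory Set
open scoped NNReal ENNReal

namespace ChaosEq

/-! ### Normal triples -/

section Triple

variable {X H : Type*} [NormedAddCommGroup X] [InnerProductSpace ℝ X]
  [NormedAddCommGroup H] [InnerProductSpace ℝ H]

/-- `X ⊂ H ⊂ X'` is a normal triple of Hilbert spaces: `ι : X → H` is a continuous dense embedding.
The space `X'` is the dual `StrongDual ℝ X` of `X` with its dual norm. -/
structure IsNormalTriple (ι : X →L[ℝ] H) : Prop where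
  injective : Function.Injective ι
  denseRange : DenseRange ι

/-- The embedding `H ⊂ X'` given by duality relative to the inner product of `H`:
`⟨h, v⟩ = (h, v)_H`. -/
noncomputable def toDual (ι : X →L[ℝ] H) : H →L[ℝ] StrongDual ℝ X :=
  LinearMap.mkContinuous
    { toFun := fun h => (innerSL ℝ h).comp ι
      map_add' := fun a b => by ext v; simp
      map_smul' := fun c a => by ext v; simp }
    ‖ι‖ (fun h => by
      have := ContinuousLinearMap.opNorm_comp_le (innerSL ℝ h) ι
      rw [innerSL_apply_norm] at this
      simpa [mul_comm] using this)

theorem toDual_apply (ι : X →L[ℝ] H) (h : H) (v : X) : toDual ι h v = inner ℝ h (ι v) := rfl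

/-- Strong parabolicity of `A : X → X'` with constants `δ` and `C`:
`2 ⟨A v, v⟩ + δ ‖v‖_X² ≤ C ‖v‖_H²`. -/
def StronglyParabolic (ι : X →L[ℝ] H) (A : X →L[ℝ] StrongDual ℝ X) (δ C : ℝ) : Prop :=
  ∀ v : X, 2 * A v v + δ * ‖v‖ ^ 2 ≤ C * ‖ι v‖ ^ 2

end Triple

/-! ### Colored noise and its representation -/

/-- Lebesgue measure on `(0, T)`. -/
noncomputable abbrev leb (T : ℝ) : Measure ℝ := volume.restrict (Ioo 0 T)

/-- The Hilbert space `L₂((0,T))`. -/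
noncomputable abbrev L2 (T : ℝ) := Lp ℝ 2 (leb T)

section Noise

variable {Ω : Type*} [MeasurableSpace Ω]

/-- `N` is a colored noise on `L₂((0,T))` with covariance operator `R`. -/
structure IsColoredNoise (P : Measure Ω) (T : ℝ) (R : L2 T →L[ℝ] L2 T) (N : L2 T → Ω → ℝ) :
    Prop where
  gaussian : ∀ f, HasGaussianLaw (N f) P
  mean_zero : ∀ f, ∫ ω, N f ω ∂P = 0
  covariance : ∀ f g, ∫ ω, N f ω * N g ω ∂P = inner ℝ (R f) g

/-- `K` is a representation operator of a noise with covariance operator `R`: `K K* = R`. -/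
def IsRepresentationOperator {T : ℝ} (R K : L2 T →L[ℝ] L2 T) : Prop :=
  K ∘L ContinuousLinearMap.adjoint K = R

/-- The step function `∑ c_τ χ_τ`, where `χ_τ` is the characteristic function of `[0, τ]`. -/
noncomputable def stepFun (c : ℝ≥0 →₀ ℝ) (s : ℝ) : ℝ :=
  c.sum fun τ a => a * (Icc (0 : ℝ) τ).indicator (fun _ => (1 : ℝ)) s

/-- The integral `∑ c_τ W(τ)` of the step function `∑ c_τ χ_τ` with respect to `W`. -/
noncomputable def stepIntegral (W : ℝ≥0 → Ω → ℝ) (c : ℝ≥0 →₀ ℝ) (ω : Ω) : ℝ :=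
  c.sum fun τ a => a * W τ ω

/-- `Y` is (a version of) the stochastic integral `∫₀ᵀ f(s) dW(s)` of the deterministic function
`f ∈ L₂((0,T))`: the mean-square limit of the integrals of step functions that converge to `f` in
`L₂((0,T))`. -/
def IsWienerIntegral (P : Measure Ω) (T : ℝ) (W : ℝ≥0 → Ω → ℝ) (f : L2 T) (Y : Ω → ℝ) : Prop :=
  AEStronglyMeasurable Y P ∧
  ∀ ε : ℝ≥0∞, 0 < ε → ∃ c : ℝ≥0 →₀ ℝ, (∀ τ ∈ c.support, (τ : ℝ) ≤ T) ∧
    eLpNorm (fun s => f s - stepFun c s) 2 (leb T) < ε ∧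
    eLpNorm (fun ω => Y ω - stepIntegral W c ω) 2 P < ε

/-- `(K, W)` is a representation of the noise `N`: `W` is a standard Brownian motion and
`N(f) = ∫₀ᵀ (K* f)(s) dW(s)` for all `f ∈ L₂((0,T))`. -/
structure IsRepresentation (P : Measure Ω) (T : ℝ) (K : L2 T →L[ℝ] L2 T) (W : ℝ≥0 → Ω → ℝ)
    (N : L2 T → Ω → ℝ) : Prop where
  brownian : IsBrownianReal W P
  integral : ∀ f, IsWienerIntegral P T W (ContinuousLinearMap.adjoint K f) (N f)

end Noise

/-! ### Chaos solutions -/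

/-- Multi-indices `α = (α_{kℓ})` with finitely many nonzero entries; the entry at `(k, ℓ)` is
`α (k, ℓ)`. Both `k` and `ℓ` are counted from `0`. The length `|α|` is `α.degree`. -/
abbrev MultiIndex := ℕ × ℕ →₀ ℕ

/-- `ξ_α = ∏_{k,ℓ} H_{α_{kℓ}}(ξ_{kℓ}) / √(α_{kℓ}!)` with `H_n` the (probabilists') Hermite
polynomials. -/
noncomputable def xi {Ω : Type*} (ξ : ℕ → ℕ → Ω → ℝ) (α : MultiIndex) (ω : Ω) : ℝ :=
  ∏ p ∈ α.support,
    Polynomial.aeval (ξ p.1 p.2 ω) (Polynomial.hermite (α p)) / √((α p).factorial : ℝ)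

/-- The chaos coefficient `E (η ξ_α)` of a random element `η`. -/
noncomputable def coeff {Ω : Type*} [MeasurableSpace Ω] (P : Measure Ω) (ξ : ℕ → ℕ → Ω → ℝ)
    {E : Type*} [NormedAddCommGroup E] [NormedSpace ℝ E] (η : Ω → E) (α : MultiIndex) : E :=
  ∫ ω, xi ξ α ω • η ω ∂P

/-- `u = (u_α)` is a chaos solution on `[0,T]` of the equation
`u(t) = u₀ + ∫₀ᵗ (A u + F) ds + ∑_ℓ N_ℓ(χ_t B_ℓ u + χ_t G_ℓ)`,
where `K_ℓ` is the representation operator of the noise `N_ℓ`, `h` is an orthonormal basis of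
`L₂((0,T))` and `ξ_{kℓ} = ∫₀ᵀ h_k dW_ℓ`. Each `u_α` is an `X'`-valued function that coincides for
almost every time with an element `v_α` of `L₂((0,T); X)`, and the system of equations
`u_α(t) = u_{0,α} + ∫₀ᵗ (A u_α + F_α) ds
  + ∑_{k,ℓ} √α_{kℓ} ∫₀ᵗ (B_ℓ u_{α-ε_{kℓ}} + G_{ℓ,α-ε_{kℓ}}) (K_ℓ h_k) ds`
holds in `X'` for all `t ∈ [0,T]`. -/
def IsChaosSolution {Ω : Type*} [MeasurableSpace Ω] (P : Measure Ω)
    {X H : Type*} [NormedAddCommGroup X] [InnerProductSpace ℝ X]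
    [NormedAddCommGroup H] [InnerProductSpace ℝ H] (ι : X →L[ℝ] H) (T : ℝ)
    (K : ℕ → L2 T →L[ℝ] L2 T) (h : HilbertBasis ℕ ℝ (L2 T)) (ξ : ℕ → ℕ → Ω → ℝ)
    (A : X →L[ℝ] StrongDual ℝ X) (B : ℕ → X →L[ℝ] StrongDual ℝ X)
    (u₀ : Ω → StrongDual ℝ X) (F : Ω → ℝ → StrongDual ℝ X) (G : ℕ → Ω → ℝ → StrongDual ℝ X)
    (u : MultiIndex → ℝ → StrongDual ℝ X) : Prop :=
  ∃ v : MultiIndex → ℝ → X,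
    (∀ α, MemLp (v α) 2 (leb T)) ∧
    (∀ α, ∀ᵐ t ∂leb T, u α t = toDual ι (ι (v α t))) ∧
    ∀ α, ∀ t ∈ Icc 0 T,
      u α t = coeff P ξ u₀ α
        + (∫ s in (0)..t, (A (v α s) + coeff P ξ (fun ω => F ω s) α))
        + ∑ p ∈ α.support, √(α p : ℝ) •
            ∫ s in (0)..t, (K p.2 (h p.1) : ℝ → ℝ) s •
              (B p.2 (v (α - Finsupp.single p 1) s)
                + coeff P ξ (fun ω => G p.2 ω s) (α - Finsupp.single p 1))

end ChaosEq

/-! The initial condition and the free terms are non-random, so their chaos coefficients vanish for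
α ≠ 0 (`coeff_const`). The system is then a deterministic cascade: order zero is driven by `u₀` and
`F`, order one also by `G`, and each later order only by the previous one. Rescaling to `U_α = √α!
u_α` turns the factors `√α_{kℓ}` into the integers `α_{kℓ}`, so the cascade becomes `U' = A U +
creation(m Z)`. Here `m_{kℓ} = K_ℓ h_k / ‖K_ℓ‖`, and the norms `‖K_ℓ‖` are absorbed into the
operators and free terms that make up `Z`.

The multi-indices of length `k` are treated as coordinates of symmetric `k`-tensors. Two quadratic
forms act on them: `pairForm`, for which the square of `U` is `k! ∑ ‖u_α‖²`, and `noiseForm` at time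
`t`, the `k`-th tensor power of the Gram matrix of the functions `m_{kℓ}` on `(0,t)`. The heart of
the proof is the inequality `2 pairForm D U(t) ≤ k! · bound(t) + noiseForm_t D D` for all test
tensors `D`, by induction on `k` (`two_mul_pairForm_le_chaosBound`). Pairing with the creation
operator lowers the order and produces a factor `k + 1` (`tensorForm_creation`). The time derivative
of `noiseForm` has the same factor and the same structure (`tensorForm_gramAt_succ`), so the
quadratic terms match exactly and only the scalar bound has to be integrated. Since `K_ℓ / ‖K_ℓ‖` is
a contraction and the `h_k` are orthonormal, the Gram matrix is at most the identity. Hence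
`noiseForm ≤ pairForm`, and the choice `D = U(t)` gives the estimate.

The operator `A` is handled by duality. Backward Euler steps for the adjoint equation give linear
maps `R(r)`, piecewise constant in `r`, which express `(U_α(t), c)` through the data up to a small
error, with `‖R(r) c‖_H² ≤ e^{C(t-r)+ε} ‖c‖_H²` (`StronglyParabolic.exists_dual_steps`). This works
for every `C > C_A`; at the end `C` tends to `C_A`. The bounds are uniform over finite index sets
and hold off a null set of times. Their weak form extends to every `t` by continuity in `X'`, and
the Riesz theorem then yields the vectors in `H`. -/

namespace ChaosEq

/-! ### Hermite polynomials under the standard Gaussian law. -/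

section Hermite

open Polynomial

theorem integrable_aeval_gaussianReal (q : ℤ[X]) :
    Integrable (fun x : ℝ => aeval x q) (gaussianReal 0 1) := by
  induction q using Polynomial.induction_on' with
  | add p q hp hq => simp only [map_add]; exact hp.add hq
  | monomial n a =>
    simp only [aeval_monomial]
    refine Integrable.const_mul ?_ _
    have := (memLp_id_gaussianReal (μ := 0) (v := 1) n).integrable_norm_pow'
    refine (integrable_norm_iff (by fun_prop)).1 ?_
    simpa using this

/-- `H_{n+1} e^{-x²/2}` is minus the derivative of `H_n e^{-x²/2}`, and both functions are
integrable on the line. -/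
theorem integral_hermite_gaussianReal {n : ℕ} (hn : n ≠ 0) :
    ∫ x : ℝ, aeval x (hermite n) ∂(gaussianReal 0 1) = 0 := by
  obtain ⟨n, rfl⟩ := Nat.exists_eq_succ_of_ne_zero hn
  have hint : ∀ q : ℤ[X], Integrable fun x : ℝ => aeval x q * Real.exp (-(x ^ 2 / 2)) := by
    intro q
    have h := integrable_aeval_gaussianReal q
    rw [gaussianReal_of_var_ne_zero 0 one_ne_zero,
      integrable_withDensity_iff_integrable_smul₀' (by fun_prop)
        (ae_of_all _ fun _ => gaussianPDF_lt_top)] at h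
    have h2 := h.const_mul (√(2 * Real.pi))
    refine h2.congr (ae_of_all _ fun x => ?_)
    have : √(2 * Real.pi) ≠ 0 := by positivity
    simp only [toReal_gaussianPDF, gaussianPDFReal, smul_eq_mul]
    push_cast
    field_simp
    simp
    ring_nf
  have hder : ∀ x : ℝ, HasDerivAt (fun x : ℝ => aeval x (hermite n) * Real.exp (-(x ^ 2 / 2)))
      (-(aeval x (hermite (n + 1)) * Real.exp (-(x ^ 2 / 2)))) x := by
    intro x
    have h1 : HasDerivAt (fun x : ℝ => Real.exp (-(x ^ 2 / 2)))
        (Real.exp (-(x ^ 2 / 2)) * (-x)) x := by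
      have : HasDerivAt (fun x : ℝ => -(x ^ 2 / 2)) (-x) x := by
        refine ((hasDerivAt_pow 2 x).div_const 2).neg.congr_deriv ?_
        norm_num
      exact this.exp
    have h2 := (Polynomial.hasDerivAt_aeval (hermite n) x).mul h1
    refine h2.congr_deriv ?_
    rw [hermite_succ]
    simp
    ring
  have key := integral_eq_zero_of_hasDerivAt_of_integrable hder (hint _).neg (hint _)
  rw [integral_gaussianReal_eq_integral_smul one_ne_zero]
  rw [integral_neg, neg_eq_zero] at key
  have : ∀ x : ℝ, gaussianPDFReal 0 1 x • aeval x (hermite (n + 1)) =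
      (√(2 * Real.pi))⁻¹ * (aeval x (hermite (n + 1)) * Real.exp (-(x ^ 2 / 2))) := by
    intro x
    simp only [gaussianPDFReal, smul_eq_mul, NNReal.coe_one, mul_one, sub_zero]
    ring_nf
  simp_rw [Nat.succ_eq_add_one, this, integral_const_mul, key, mul_zero]

end Hermite

/-! ### Wiener integrals of step functions. -/

section Step

variable {Ω : Type*} [MeasurableSpace Ω] {P : Measure Ω}

theorem stepFun_eq_linearCombination (c : ℝ≥0 →₀ ℝ) (s : ℝ) :
    stepFun c s = Finsupp.linearCombination ℝ
      (fun τ : ℝ≥0 => (Icc (0 : ℝ) τ).indicator (fun _ => (1 : ℝ)) s) c := rfl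

theorem stepIntegral_eq_linearCombination {Ω : Type*} (W : ℝ≥0 → Ω → ℝ) (c : ℝ≥0 →₀ ℝ) (ω : Ω) :
    stepIntegral W c ω = Finsupp.linearCombination ℝ (fun τ : ℝ≥0 => W τ ω) c := rfl

theorem measurable_stepFun (c : ℝ≥0 →₀ ℝ) : Measurable (stepFun c) := by
  unfold stepFun Finsupp.sum
  refine Finset.measurable_sum _ fun τ _ => ?_
  exact ((measurable_const.indicator measurableSet_Icc)).const_mul _

theorem memLp_stepFun (T : ℝ) (c : ℝ≥0 →₀ ℝ) : MemLp (stepFun c) 2 (leb T) := by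
  have h1 : ∀ τ : ℝ≥0, MemLp ((Icc (0 : ℝ) τ).indicator (fun _ => (1 : ℝ))) 2 (leb T) :=
    fun τ => (memLp_const 1).indicator measurableSet_Icc
  exact memLp_finsetSum c.support (f := fun τ s =>
    c τ * (Icc (0 : ℝ) τ).indicator (fun _ => (1 : ℝ)) s) fun τ _ => (h1 τ).const_mul (c τ)

theorem integral_indicator_mul_indicator {T : ℝ} {s t : ℝ≥0} (hs : (s : ℝ) ≤ T) :
    ∫ r, (Icc (0 : ℝ) s).indicator (fun _ => (1 : ℝ)) r *
      (Icc (0 : ℝ) t).indicator (fun _ => (1 : ℝ)) r ∂leb T = min s t := by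
  have h1 : ∀ r, (Icc (0 : ℝ) s).indicator (fun _ => (1 : ℝ)) r *
      (Icc (0 : ℝ) t).indicator (fun _ => (1 : ℝ)) r =
      (Icc (0 : ℝ) (min s t : ℝ≥0)).indicator (fun _ => (1 : ℝ)) r := by
    intro r
    rw [← inter_indicator_mul, Icc_inter_Icc]
    simp
  have h2 : ((min s t : ℝ≥0) : ℝ) ≤ T := le_trans (by simp) hs
  simp_rw [h1]
  rw [integral_indicator measurableSet_Icc, setIntegral_const, smul_eq_mul, mul_one]
  rw [leb, measureReal_restrict_apply measurableSet_Icc]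
  have : (Icc (0 : ℝ) (min s t : ℝ≥0) ∩ Ioo 0 T : Set ℝ) =ᵐ[volume]
      Icc (0 : ℝ) (min s t : ℝ≥0) := by
    have h3 : (Ioo (0 : ℝ) T : Set ℝ) =ᵐ[volume] Icc 0 T := Ioo_ae_eq_Icc
    refine ((ae_eq_refl _).inter h3).trans ?_
    rw [inter_eq_left.2 (Icc_subset_Icc_right h2)]
    exact Filter.EventuallyEq.rfl
  rw [measureReal_congr this, Real.volume_real_Icc]
  simp

theorem integral_stepFun_sq {T : ℝ} {c : ℝ≥0 →₀ ℝ} (hc : ∀ τ ∈ c.support, (τ : ℝ) ≤ T) :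
    ∫ r, stepFun c r ^ 2 ∂leb T =
      ∑ s ∈ c.support, ∑ t ∈ c.support, c s * c t * (min s t : ℝ≥0) := by
  have h1 : ∀ r, stepFun c r ^ 2 = ∑ s ∈ c.support, ∑ t ∈ c.support,
      c s * c t * ((Icc (0 : ℝ) s).indicator (fun _ => (1 : ℝ)) r *
      (Icc (0 : ℝ) t).indicator (fun _ => (1 : ℝ)) r) := by
    intro r
    rw [sq, stepFun, Finsupp.sum, Finset.sum_mul_sum]
    refine Finset.sum_congr rfl fun s _ => Finset.sum_congr rfl fun t _ => by ring
  have hi : ∀ s t : ℝ≥0, Integrable (fun r => (Icc (0 : ℝ) s).indicator (fun _ => (1 : ℝ)) r *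
      (Icc (0 : ℝ) t).indicator (fun _ => (1 : ℝ)) r) (leb T) := by
    intro s t
    have a : ∀ s : ℝ≥0, MemLp ((Icc (0 : ℝ) s).indicator (fun _ => (1 : ℝ))) 2 (leb T) :=
      fun s => (memLp_const 1).indicator measurableSet_Icc
    exact (a s).integrable_mul (a t)
  simp_rw [h1]
  rw [integral_finsetSum _ fun s _ => integrable_finsetSum _ fun t _ => (hi s t).const_mul _]
  refine Finset.sum_congr rfl fun s hs => ?_
  rw [integral_finsetSum _ fun t _ => (hi s t).const_mul _]
  refine Finset.sum_congr rfl fun t _ => ?_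
  rw [integral_const_mul, integral_indicator_mul_indicator (hc s hs)]

theorem aemeasurable_stepIntegral {W : ℝ≥0 → Ω → ℝ} (hW : IsPreBrownianReal W P)
    (c : ℝ≥0 →₀ ℝ) : AEMeasurable (stepIntegral W c) P := by
  unfold stepIntegral Finsupp.sum
  exact Finset.aemeasurable_fun_sum _ fun τ _ => (hW.aemeasurable τ).const_mul _

/-- The integral is a centred Gaussian variable. Its variance, computed from the covariance `min s
t`, is the square of the `L₂`-norm of the step function. -/
theorem integral_exp_stepIntegral {W : ℝ≥0 → Ω → ℝ} (hW : IsPreBrownianReal W P) {T : ℝ}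
    {c : ℝ≥0 →₀ ℝ} (hc : ∀ τ ∈ c.support, (τ : ℝ) ≤ T) :
    ∫ ω, Complex.exp (stepIntegral W c ω * Complex.I) ∂P =
      Complex.exp (-(∫ r, stepFun c r ^ 2 ∂leb T : ℝ) / 2) := by
  have hG := hW.isGaussianProcess
  have := hG.isProbabilityMeasure
  have hg : HasGaussianLaw (stepIntegral W c) P :=
    (hG.smul (fun τ => c τ)).hasGaussianLaw_fun_sum (I := c.support)
  have hmean : ∫ ω, stepIntegral W c ω ∂P = 0 := by
    unfold stepIntegral Finsupp.sum
    rw [integral_finsetSum _ fun τ _ => (hW.integrable_eval τ).const_mul _]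
    refine Finset.sum_eq_zero fun τ _ => ?_
    rw [integral_const_mul, hW.integral_eval, mul_zero]
  have hL : ∀ τ, MemLp (W τ) 2 P := fun τ => (hG.hasGaussianLaw_eval τ).memLp_two
  have hvar : Var[stepIntegral W c; P] = ∫ r, stepFun c r ^ 2 ∂leb T := by
    rw [integral_stepFun_sq hc]
    unfold stepIntegral Finsupp.sum
    rw [variance_fun_sum' fun τ _ => (hL τ).const_mul _]
    refine Finset.sum_congr rfl fun s _ => Finset.sum_congr rfl fun t _ => ?_
    rw [covariance_const_mul_left, covariance_const_mul_right, hW.covariance_eval]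
    ring
  have h1 := hg.charFun_map_eq (1 : ℝ)
  rw [charFun_apply_real, integral_map hg.aemeasurable (by fun_prop)] at h1
  simp only [Complex.ofReal_one, one_mul, RCLike.inner_apply, conj_trivial, mul_one] at h1
  rw [h1, hmean, show (fun ω => stepIntegral W c ω) = stepIntegral W c from rfl, hvar]
  simp
  ring_nf

end Step

/-! ### Joint characteristic function of the variables `ξ_{kℓ}`. -/

section Joint

open Filter Topology

variable {Ω : Type*} [MeasurableSpace Ω] {P : Measure Ω}

/-- `|e^{ix} - e^{iy}| ≤ |x - y|`, and on a probability space the `L₁`-norm is at most the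
`L₂`-norm. -/
theorem tendsto_integral_exp_of_tendsto_eLpNorm [IsProbabilityMeasure P] {Y : Ω → ℝ}
    {Z : ℕ → Ω → ℝ} (hY : AEStronglyMeasurable Y P) (hZ : ∀ n, AEStronglyMeasurable (Z n) P)
    (h : Tendsto (fun n => eLpNorm (fun ω => Y ω - Z n ω) 2 P) atTop (𝓝 0)) :
    Tendsto (fun n => ∫ ω, Complex.exp (Z n ω * Complex.I) ∂P) atTop
      (𝓝 (∫ ω, Complex.exp (Y ω * Complex.I) ∂P)) := by
  have hm : ∀ {X : Ω → ℝ}, AEStronglyMeasurable X P →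
      AEStronglyMeasurable (fun ω => Complex.exp (X ω * Complex.I)) P := by
    intro X hX
    have : Continuous fun x : ℝ => Complex.exp (x * Complex.I) := by fun_prop
    exact this.comp_aestronglyMeasurable hX
  refine tendsto_integral_of_L1' _ (hm hY) ?_ ?_
  · refine Eventually.of_forall fun n => ?_
    refine Integrable.of_bound (hm (hZ n)) 1 (ae_of_all _ fun ω => ?_)
    rw [Complex.norm_exp_ofReal_mul_I]
  · refine tendsto_of_tendsto_of_tendsto_of_le_of_le tendsto_const_nhds h (fun n => zero_le)
      fun n => ?_
    calc eLpNorm _ 1 P ≤ eLpNorm (fun ω => Y ω - Z n ω) 1 P := by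
          refine eLpNorm_mono fun ω => ?_
          simp only [Pi.sub_apply]
          have h1 : Complex.exp (Z n ω * Complex.I) - Complex.exp (Y ω * Complex.I) =
              Complex.exp (Y ω * Complex.I) *
                (Complex.exp (Complex.I * ((Z n ω - Y ω : ℝ) : ℂ)) - 1) := by
            rw [mul_sub, ← Complex.exp_add]
            push_cast
            ring_nf
          rw [h1, norm_mul, Complex.norm_exp_ofReal_mul_I, one_mul, norm_sub_rev (Y ω)]
          exact Real.norm_exp_I_mul_ofReal_sub_one_le
      _ ≤ _ := eLpNorm_le_eLpNorm_of_exponent_le (by norm_num) (hY.sub (hZ n))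

theorem tendsto_eLpNorm_sum_sub {α ι : Type*} [MeasurableSpace α] {μ : Measure α} (I : Finset ι)
    (a : ι → ℝ) {f : ι → α → ℝ} {g : ι → ℕ → α → ℝ}
    (hm : ∀ i n, AEStronglyMeasurable (fun x => f i x - g i n x) μ)
    (h : ∀ i, Tendsto (fun n => eLpNorm (fun x => f i x - g i n x) 2 μ) atTop (𝓝 0)) :
    Tendsto (fun n => eLpNorm (fun x => ∑ i ∈ I, a i * f i x - ∑ i ∈ I, a i * g i n x) 2 μ)
      atTop (𝓝 0) := by
  have h1 : Tendsto (fun n => ∑ i ∈ I, ‖a i‖ₑ * eLpNorm (fun x => f i x - g i n x) 2 μ) atTop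
      (𝓝 (∑ i ∈ I, ‖a i‖ₑ * 0)) :=
    tendsto_finsetSum _ fun i _ => ENNReal.Tendsto.const_mul (h i) (Or.inr (by simp))
  simp only [mul_zero, Finset.sum_const_zero] at h1
  refine tendsto_of_tendsto_of_tendsto_of_le_of_le tendsto_const_nhds h1 (fun n => zero_le)
      fun n => ?_
  have h2 : (fun x => ∑ i ∈ I, a i * f i x - ∑ i ∈ I, a i * g i n x) =
      ∑ i ∈ I, a i • fun x => f i x - g i n x := by
    ext x
    simp [← Finset.sum_sub_distrib, mul_sub]
  dsimp only
  rw [h2]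
  refine (eLpNorm_sum_le (fun i _ => (hm i n).const_smul _) (by norm_num)).trans ?_
  exact Finset.sum_le_sum fun i _ => (eLpNorm_const_smul _ _ _ _).le

theorem tendsto_integral_sq_of_tendsto_eLpNorm {α : Type*} [MeasurableSpace α] {μ : Measure α}
    {f : α → ℝ} {g : ℕ → α → ℝ} (hf : MemLp f 2 μ) (hg : ∀ n, MemLp (g n) 2 μ)
    (h : Tendsto (fun n => eLpNorm (fun x => f x - g n x) 2 μ) atTop (𝓝 0)) :
    Tendsto (fun n => ∫ x, g n x ^ 2 ∂μ) atTop (𝓝 (∫ x, f x ^ 2 ∂μ)) := by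
  have h1 : Tendsto (fun n => (hg n).toLp (g n)) atTop (𝓝 (hf.toLp f)) := by
    rw [Lp.tendsto_Lp_iff_tendsto_eLpNorm'']
    refine h.congr fun n => ?_
    rw [← eLpNorm_neg]
    congr 1
    ext x
    simp
  have h2 : ∀ {k : α → ℝ} (hk : MemLp k 2 μ), ‖hk.toLp k‖ ^ 2 = ∫ x, k x ^ 2 ∂μ := by
    intro k hk
    rw [← real_inner_self_eq_norm_sq, L2.inner_def]
    refine integral_congr_ae ?_
    filter_upwards [hk.coeFn_toLp] with x hx
    rw [hx]
    simp [sq]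
  have h3 := (h1.norm).pow 2
  rw [h2] at h3
  exact h3.congr fun n => h2 _

theorem IsWienerIntegral.exists_seq {T : ℝ} {W : ℝ≥0 → Ω → ℝ} {f : L2 T} {Y : Ω → ℝ}
    (h : IsWienerIntegral P T W f Y) : ∃ c : ℕ → ℝ≥0 →₀ ℝ,
      (∀ n, ∀ τ ∈ (c n).support, (τ : ℝ) ≤ T) ∧
      Tendsto (fun n => eLpNorm (fun s => f s - stepFun (c n) s) 2 (leb T)) atTop (𝓝 0) ∧
      Tendsto (fun n => eLpNorm (fun ω => Y ω - stepIntegral W (c n) ω) 2 P) atTop (𝓝 0) := by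
  have hpos : ∀ n : ℕ, (0 : ℝ≥0∞) < ((n : ℝ≥0∞) + 1)⁻¹ := fun n => by simp
  choose c h1 h2 h3 using fun n => h.2 _ (hpos n)
  have ht : Tendsto (fun n : ℕ => ((n : ℝ≥0∞) + 1)⁻¹) atTop (𝓝 0) := by
    have := (tendsto_add_atTop_iff_nat 1).2 ENNReal.tendsto_inv_nat_nhds_zero
    simpa using this
  exact ⟨c, h1,
    tendsto_of_tendsto_of_tendsto_of_le_of_le tendsto_const_nhds ht (fun n => zero_le)
      fun n => (h2 n).le,
    tendsto_of_tendsto_of_tendsto_of_le_of_le tendsto_const_nhds ht (fun n => zero_le)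
      fun n => (h3 n).le⟩

theorem integral_sum_orthonormal_sq {T : ℝ} (h : HilbertBasis ℕ ℝ (L2 T)) {ι : Type*}
    (I : Finset ι) {k : ι → ℕ} (hk : Set.InjOn k I) (a : ι → ℝ) :
    ∫ s, (∑ i ∈ I, a i * h (k i) s) ^ 2 ∂leb T = ∑ i ∈ I, a i ^ 2 := by
  classical
  have h1 : (fun s => ∑ i ∈ I, a i * h (k i) s) =ᵐ[leb T] (∑ i ∈ I, a i • h (k i) : L2 T) := by
    have : ∀ᵐ s ∂leb T, ∀ i ∈ I, (a i • h (k i) : L2 T) s = a i * h (k i) s :=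
      (ae_ball_iff I.countable_toSet).2 fun i _ => by
        filter_upwards [Lp.coeFn_smul (a i) (h (k i))] with s hs using by rw [hs]; rfl
    filter_upwards [Lp.coeFn_finsetSum I fun i => a i • h (k i), this] with s hs hs2
    rw [hs]
    rw [Finset.sum_apply]
    exact Finset.sum_congr rfl fun i hi => (hs2 i hi).symm
  have h2 : ∫ s, (∑ i ∈ I, a i * h (k i) s) ^ 2 ∂leb T =
      inner ℝ (∑ i ∈ I, a i • h (k i) : L2 T) (∑ i ∈ I, a i • h (k i)) := by
    rw [L2.inner_def]
    refine integral_congr_ae ?_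
    filter_upwards [h1] with s hs
    rw [hs]
    simp [sq]
  rw [h2, sum_inner]
  refine Finset.sum_congr rfl fun i hi => ?_
  rw [inner_sum, Finset.sum_eq_single i]
  · have := h.orthonormal.1 (k i)
    rw [real_inner_smul_left, real_inner_smul_right, real_inner_self_eq_norm_sq, this]
    ring
  · intro j hj hji
    have := h.orthonormal.2 (fun e => hji (hk hj hi e.symm) : k i ≠ k j)
    simp [real_inner_smul_left, real_inner_smul_right, this]
  · exact fun hi' => absurd hi hi'

/-- Approximating step integrals with the same `ℓ` merge into one step integral, while different `ℓ`
are independent. The Gaussian formula for each block passes to the mean-square limit, where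
orthonormality of `h` leaves `∑ a_p²`. -/
theorem integral_exp_sum_wiener [IsProbabilityMeasure P] {T : ℝ} {W : ℕ → ℝ≥0 → Ω → ℝ}
    (hW : ∀ ℓ, IsPreBrownianReal (W ℓ) P) (hind : iIndepFun (fun ℓ ω t => W ℓ t ω) P)
    (h : HilbertBasis ℕ ℝ (L2 T)) {ξ : ℕ → ℕ → Ω → ℝ}
    (hξ : ∀ k ℓ, IsWienerIntegral P T (W ℓ) (h k) (ξ k ℓ))
    (I : Finset (ℕ × ℕ)) (a : ℕ × ℕ → ℝ) :
    ∫ ω, Complex.exp ((∑ p ∈ I, a p * ξ p.1 p.2 ω : ℝ) * Complex.I) ∂P =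
      Complex.exp (-(∑ p ∈ I, a p ^ 2 : ℝ) / 2) := by
  classical
  choose c hc hch hcξ using fun p : ℕ × ℕ => (hξ p.1 p.2).exists_seq
  set L := I.image Prod.snd with hL
  set d : ℕ → ℕ → ℝ≥0 →₀ ℝ := fun n ℓ => ∑ p ∈ I with p.2 = ℓ, a p • c p n with hd
  have hdsupp : ∀ n ℓ, ∀ τ ∈ (d n ℓ).support, (τ : ℝ) ≤ T := by
    intro n ℓ τ hτ
    obtain ⟨p, _, hp⟩ := Finset.mem_biUnion.1 (Finsupp.support_finsetSum hτ)
    exact hc p n τ (Finsupp.support_smul hp)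
  have hdI : ∀ n ℓ ω, stepIntegral (W ℓ) (d n ℓ) ω =
      ∑ p ∈ I with p.2 = ℓ, a p * stepIntegral (W p.2) (c p n) ω := by
    intro n ℓ ω
    rw [stepIntegral_eq_linearCombination, hd, map_sum]
    refine Finset.sum_congr rfl fun p hp => ?_
    rw [map_smul, smul_eq_mul, (Finset.mem_filter.1 hp).2, stepIntegral_eq_linearCombination]
  have hdF : ∀ n ℓ s, stepFun (d n ℓ) s =
      ∑ p ∈ I with p.2 = ℓ, a p * stepFun (c p n) s := by
    intro n ℓ s
    rw [stepFun_eq_linearCombination, hd, map_sum]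
    refine Finset.sum_congr rfl fun p hp => ?_
    rw [map_smul, smul_eq_mul, stepFun_eq_linearCombination]
  set Z : ℕ → Ω → ℝ := fun n ω => ∑ p ∈ I, a p * stepIntegral (W p.2) (c p n) ω with hZdef
  have hZ : ∀ n ω, Z n ω = ∑ ℓ ∈ L, stepIntegral (W ℓ) (d n ℓ) ω := by
    intro n ω
    simp_rw [hdI]
    rw [Finset.sum_fiberwise_of_maps_to fun p hp => Finset.mem_image_of_mem _ hp]
  have hmeas : ∀ p n, AEStronglyMeasurable (stepIntegral (W p) n) P := fun p n =>
    (aemeasurable_stepIntegral (hW p) n).aestronglyMeasurable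
  have hZm : ∀ n, AEStronglyMeasurable (Z n) P := fun n =>
    Finset.aestronglyMeasurable_fun_sum _ fun p _ => (hmeas _ _).const_mul _
  have hYm : AEStronglyMeasurable (fun ω => ∑ p ∈ I, a p * ξ p.1 p.2 ω) P :=
    Finset.aestronglyMeasurable_fun_sum _ fun p _ => (hξ _ _).1.const_mul _
  have lim1 := tendsto_integral_exp_of_tendsto_eLpNorm hYm hZm
    (tendsto_eLpNorm_sum_sub I a (fun p n => (hξ p.1 p.2).1.sub (hmeas _ _)) hcξ)
  have hprod : ∀ n, ∫ ω, Complex.exp (Z n ω * Complex.I) ∂P =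
      ∏ ℓ : L, Complex.exp (-(∫ r, stepFun (d n ℓ) r ^ 2 ∂leb T : ℝ) / 2) := by
    intro n
    have hi : iIndepFun (fun (ℓ : L) ω => stepIntegral (W ℓ) (d n ℓ) ω) P := by
      have h1 := hind.precomp (g := fun ℓ : L => (ℓ : ℕ)) Subtype.val_injective
      refine h1.comp (fun (ℓ : L) (x : ℝ≥0 → ℝ) => (d n ℓ).sum fun τ b => b * x τ) fun ℓ => ?_
      unfold Finsupp.sum
      fun_prop
    have h2 := hi.integral_fun_prod_comp (𝕜 := ℂ)
      (f := fun _ (x : ℝ) => Complex.exp (x * Complex.I))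
      (fun ℓ : L => aemeasurable_stepIntegral (hW ℓ) _) (fun ℓ => by fun_prop)
    simp_rw [integral_exp_stepIntegral (hW _) (hdsupp n _)] at h2
    rw [← h2]
    refine integral_congr_ae (ae_of_all _ fun ω => ?_)
    dsimp only
    rw [hZ, ← Finset.sum_coe_sort L, ← Complex.exp_sum, ← Finset.sum_mul]
    push_cast
    rfl
  have lim2 : Tendsto (fun n => ∏ ℓ : L,
      Complex.exp (-(∫ r, stepFun (d n ℓ) r ^ 2 ∂leb T : ℝ) / 2)) atTop
      (𝓝 (∏ ℓ : L, Complex.exp (-((∑ p ∈ I with p.2 = (ℓ : ℕ), a p ^ 2 : ℝ)) / 2))) := by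
    refine tendsto_finsetProd _ fun ℓ _ => ?_
    have h1 : Tendsto (fun n => ∫ r, stepFun (d n ℓ) r ^ 2 ∂leb T) atTop
        (𝓝 (∑ p ∈ I with p.2 = (ℓ : ℕ), a p ^ 2 : ℝ)) := by
      -- Within one block the index `ℓ` is fixed, so distinct pairs have distinct `k`.
      have hinj : Set.InjOn (Prod.fst : ℕ × ℕ → ℕ) (I.filter fun p => p.2 = (ℓ : ℕ)) := by
        intro p hp q hq hpq
        simp only [Finset.coe_filter, mem_ofPred_eq] at hp hq
        exact Prod.ext hpq (hp.2.trans hq.2.symm)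
      rw [← integral_sum_orthonormal_sq h _ hinj a]
      refine tendsto_integral_sq_of_tendsto_eLpNorm
        (memLp_finsetSum _ fun p _ => (Lp.memLp _).const_mul _) (fun n => memLp_stepFun T _) ?_
      simp_rw [hdF]
      exact tendsto_eLpNorm_sum_sub _ a (fun p n => (Lp.aestronglyMeasurable _).sub
        (measurable_stepFun _).aestronglyMeasurable) hch
    have h2 : Continuous fun x : ℝ => Complex.exp (-(x : ℂ) / 2) := by fun_prop
    exact (h2.tendsto _).comp h1
  simp_rw [hprod] at lim1
  rw [tendsto_nhds_unique lim1 lim2, ← Complex.exp_sum, Finset.sum_coe_sort L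
    (fun ℓ => -((∑ p ∈ I with p.2 = ℓ, a p ^ 2 : ℝ) : ℂ) / 2), ← Finset.sum_div]
  congr 2
  rw [Finset.sum_neg_distrib, ← Complex.ofReal_sum,
    Finset.sum_fiberwise_of_maps_to fun p hp => Finset.mem_image_of_mem _ hp]

end Joint

/-! ### Chaos coefficients of non-random elements. -/

section Coefficients

variable {Ω : Type*} [MeasurableSpace Ω] {P : Measure Ω} [IsProbabilityMeasure P] {T : ℝ}
  {W : ℕ → ℝ≥0 → Ω → ℝ} {h : HilbertBasis ℕ ℝ (L2 T)} {ξ : ℕ → ℕ → Ω → ℝ}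

theorem map_wiener_eq_gaussianReal (hW : ∀ ℓ, IsPreBrownianReal (W ℓ) P)
    (hind : iIndepFun (fun ℓ ω t => W ℓ t ω) P)
    (hξ : ∀ k ℓ, IsWienerIntegral P T (W ℓ) (h k) (ξ k ℓ)) (k ℓ : ℕ) :
    P.map (ξ k ℓ) = gaussianReal 0 1 := by
  have hm : AEMeasurable (ξ k ℓ) P := (hξ k ℓ).1.aemeasurable
  have := P.isProbabilityMeasure_map hm
  refine Measure.ext_of_charFun (funext fun t => ?_)
  rw [charFun_gaussianReal, charFun_apply_real, integral_map hm (by fun_prop)]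
  have := integral_exp_sum_wiener hW hind h hξ {(k, ℓ)} (fun _ => t)
  simp only [Finset.sum_singleton, Complex.ofReal_mul] at this
  rw [this]
  congr 1
  simp
  ring

/-- The joint characteristic function factors into those of standard Gaussians. -/
theorem iIndepFun_wiener (hW : ∀ ℓ, IsPreBrownianReal (W ℓ) P)
    (hind : iIndepFun (fun ℓ ω t => W ℓ t ω) P)
    (hξ : ∀ k ℓ, IsWienerIntegral P T (W ℓ) (h k) (ξ k ℓ)) (I : Finset (ℕ × ℕ)) :
    iIndepFun (fun (p : I) ω => ξ p.1.1 p.1.2 ω) P := by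
  have hm : ∀ p : I, AEMeasurable (fun ω => ξ p.1.1 p.1.2 ω) P :=
    fun p => (hξ _ _).1.aemeasurable
  refine (iIndepFun_iff_charFun_pi hm).2 fun t => ?_
  have h1 : ∀ p : I, charFun (P.map (fun ω => ξ p.1.1 p.1.2 ω)) (t p) =
      Complex.exp (-((t p ^ 2 : ℝ) : ℂ) / 2) := by
    intro p
    have := map_wiener_eq_gaussianReal hW hind hξ p.1.1 p.1.2
    rw [this, charFun_gaussianReal]
    congr 1
    simp
    ring
  simp_rw [h1]
  rw [charFun_apply, integral_map (by fun_prop) (by fun_prop)]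
  -- The vector `t` is indexed by the subtype, so it is extended by zero to all pairs.
  have h2 := integral_exp_sum_wiener hW hind h hξ I
    (fun p => if hp : p ∈ I then t ⟨p, hp⟩ else 0)
  rw [← Finset.sum_coe_sort I, Complex.ofReal_sum, ← Finset.sum_neg_distrib, Finset.sum_div,
    Complex.exp_sum] at h2
  simp only [Finset.coe_mem, dite_true] at h2
  rw [← h2]
  refine integral_congr_ae (ae_of_all _ fun ω => ?_)
  dsimp only
  rw [← Finset.sum_coe_sort I, PiLp.inner_apply]
  simp [mul_comm]

/-- By independence the expectation is a product, and any nonzero entry of `α` contributes a Hermite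
polynomial of positive degree, whose mean is zero. -/
theorem integral_xi (hW : ∀ ℓ, IsPreBrownianReal (W ℓ) P)
    (hind : iIndepFun (fun ℓ ω t => W ℓ t ω) P)
    (hξ : ∀ k ℓ, IsWienerIntegral P T (W ℓ) (h k) (ξ k ℓ)) (α : MultiIndex) :
    ∫ ω, xi ξ α ω ∂P = if α = 0 then 1 else 0 := by
  split_ifs with hα
  · simp [hα, xi]
  · have h1 := (iIndepFun_wiener hW hind hξ α.support).integral_fun_prod_comp (𝕜 := ℝ)
      (f := fun (p : α.support) x =>
        Polynomial.aeval x (Polynomial.hermite (α p)) / √((α p).factorial : ℝ))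
      (fun p => (hξ _ _).1.aemeasurable)
      (fun p => (by fun_prop : Continuous fun x : ℝ => Polynomial.aeval x
        (Polynomial.hermite (α p)) / √((α p).factorial : ℝ)).aestronglyMeasurable)
    have h2 : ∀ ω, xi ξ α ω = ∏ p : α.support, Polynomial.aeval (ξ p.1.1 p.1.2 ω)
        (Polynomial.hermite (α p)) / √((α p).factorial : ℝ) := by
      intro ω
      rw [xi, ← Finset.prod_coe_sort]
    simp_rw [h2]
    rw [h1]
    obtain ⟨p, hp⟩ := Finsupp.support_nonempty_iff.2 hα
    refine Finset.prod_eq_zero (Finset.mem_univ ⟨p, hp⟩) ?_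
    have hm : AEMeasurable (ξ p.1 p.2) P := (hξ _ _).1.aemeasurable
    rw [integral_div]
    have h3 := integral_map (f := fun x : ℝ => Polynomial.aeval x (Polynomial.hermite (α p))) hm
      (by fun_prop)
    rw [← h3, map_wiener_eq_gaussianReal hW hind hξ,
      integral_hermite_gaussianReal (Finsupp.mem_support_iff.1 hp), zero_div]

theorem coeff_const {E : Type*} [NormedAddCommGroup E] [NormedSpace ℝ E] [CompleteSpace E]
    (hW : ∀ ℓ, IsPreBrownianReal (W ℓ) P)
    (hind : iIndepFun (fun ℓ ω t => W ℓ t ω) P)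
    (hξ : ∀ k ℓ, IsWienerIntegral P T (W ℓ) (h k) (ξ k ℓ)) (x : E) (α : MultiIndex) :
    coeff P ξ (fun _ => x) α = if α = 0 then x else 0 := by
  rw [coeff, integral_smul_const, integral_xi hW hind hξ]
  split_ifs <;> simp

end Coefficients

/-! ### Tensor powers of forms, shifts and the creation operator. -/

section Forms

variable {I V : Type*} [AddCommGroup V] [Module ℝ V]

/-- `γ` restricted to `S × S` is a positive semidefinite matrix. -/
def PSDOn (S : Finset I) (γ : I → I → ℝ) : Prop :=
  (∀ p q, γ p q = γ q p) ∧ ∀ c : I → ℝ, 0 ≤ ∑ p ∈ S, ∑ q ∈ S, γ p q * (c p * c q)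

/-- A positive semidefinite matrix is a sum of rank-one matrices, each of which turns the double sum
into `β y y` for a single combination `y` of the `x p`. -/
theorem PSDOn.sum_nonneg {S : Finset I} {γ : I → I → ℝ} (hγ : PSDOn S γ)
    {β : LinearMap.BilinForm ℝ V} (hβ : ∀ x, 0 ≤ β x x) (x : I → V) :
    0 ≤ ∑ p ∈ S, ∑ q ∈ S, γ p q * β (x p) (x q) := by
  classical
  have hM : (Matrix.of fun p q : S => γ p q).PosSemidef := by
    refine Matrix.PosSemidef.of_dotProduct_mulVec_nonneg ?_ fun c => ?_
    · ext p q
      simp [hγ.1 q p]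
    · have := hγ.2 fun p => if hp : p ∈ S then c ⟨p, hp⟩ else 0
      rw [← Finset.sum_coe_sort S] at this
      simp_rw [← Finset.sum_coe_sort S] at this
      simp only [Finset.coe_mem, dite_true] at this
      refine this.trans_eq ?_
      simp only [dotProduct, Matrix.mulVec, Matrix.of_apply, Finset.mul_sum, Pi.star_apply,
        star_trivial]
      exact Finset.sum_congr rfl fun p _ => Finset.sum_congr rfl fun q _ => by ring
  obtain ⟨m, A, hA⟩ := Matrix.posSemidef_iff_eq_sum_vecMulVec.1 hM
  have hA' : ∀ p q : S, γ p q = ∑ r, A r p * A r q := by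
    intro p q
    have := congrFun (congrFun hA p) q
    simpa [Matrix.sum_apply, Matrix.vecMulVec_apply] using this
  have key : ∑ p ∈ S, ∑ q ∈ S, γ p q * β (x p) (x q) =
      ∑ r, β (∑ p : S, A r p • x p) (∑ p : S, A r p • x p) := by
    rw [← Finset.sum_coe_sort S]
    simp_rw [← Finset.sum_coe_sort S, hA', map_sum, LinearMap.sum_apply, map_smul,
      LinearMap.smul_apply, smul_eq_mul, Finset.sum_mul]
    rw [Finset.sum_comm' (t' := Finset.univ) (s' := fun _ => Finset.univ) (by simp)]
    rw [Finset.sum_congr rfl fun q _ => Finset.sum_comm]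
    rw [Finset.sum_comm]
    exact Finset.sum_congr rfl fun r _ => Finset.sum_congr rfl fun p _ =>
      Finset.sum_congr rfl fun q _ => by ring
  rw [key]
  exact Finset.sum_nonneg fun r _ => hβ _

/-- The shift of a family indexed by multi-indices by the unit multi-index at `q`. -/
noncomputable def shift (H : Type*) [AddCommGroup H] [Module ℝ H] (q : I) :
    ((I →₀ ℕ) → H) →ₗ[ℝ] ((I →₀ ℕ) → H) :=
  LinearMap.funLeft ℝ H fun α => α + Finsupp.single q 1

variable {H : Type*} [AddCommGroup H] [Module ℝ H]

theorem shift_apply (q : I) (C : (I →₀ ℕ) → H) (α : I →₀ ℕ) :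
    shift H q C α = C (α + Finsupp.single q 1) := rfl

theorem shift_comm (p q : I) (C : (I →₀ ℕ) → H) :
    shift H p (shift H q C) = shift H q (shift H p C) := by
  ext α
  simp only [shift_apply]
  congr 1
  abel

/-- The form induced by the `k`-th tensor power of `γ` and by `b` on the symmetric `H`-valued
tensors with coordinates `C α`, `|α| = k`. -/
noncomputable def tensorForm (S : Finset I) (γ : I → I → ℝ) (b : LinearMap.BilinForm ℝ H) :
    ℕ → LinearMap.BilinForm ℝ ((I →₀ ℕ) → H)
  | 0 => b.compl₁₂ (LinearMap.proj 0) (LinearMap.proj 0)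
  | k + 1 => ∑ p ∈ S, ∑ q ∈ S, γ p q • (tensorForm S γ b k).compl₁₂ (shift H p) (shift H q)

theorem tensorForm_zero (S : Finset I) (γ : I → I → ℝ) (b : LinearMap.BilinForm ℝ H)
    (C D : (I →₀ ℕ) → H) : tensorForm S γ b 0 C D = b (C 0) (D 0) := rfl

theorem tensorForm_succ (S : Finset I) (γ : I → I → ℝ) (b : LinearMap.BilinForm ℝ H) (k : ℕ)
    (C D : (I →₀ ℕ) → H) : tensorForm S γ b (k + 1) C D =
      ∑ p ∈ S, ∑ q ∈ S, γ p q * tensorForm S γ b k (shift H p C) (shift H q D) := by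
  simp [tensorForm, LinearMap.sum_apply]

theorem tensorForm_nonneg {S : Finset I} {γ : I → I → ℝ} (hγ : PSDOn S γ)
    {b : LinearMap.BilinForm ℝ H} (hb : ∀ x, 0 ≤ b x x) (k : ℕ) (C : (I →₀ ℕ) → H) :
    0 ≤ tensorForm S γ b k C C := by
  induction k generalizing C with
  | zero => exact hb _
  | succ k ih =>
    rw [tensorForm_succ]
    exact hγ.sum_nonneg ih fun p => shift H p C

/-- One factor at a time: `γ' ⊗ b' - γ ⊗ b = γ' ⊗ (b' - b) + (γ' - γ) ⊗ b`, and both terms on the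
right are nonnegative. -/
theorem tensorForm_mono {S : Finset I} {γ γ' : I → I → ℝ} (hγ : PSDOn S γ)
    (hγ' : PSDOn S γ') (hle : PSDOn S (γ' - γ)) {b b' : LinearMap.BilinForm ℝ H}
    (hb : ∀ x, 0 ≤ b x x) (hbb : ∀ x, b x x ≤ b' x x) (k : ℕ) (C : (I →₀ ℕ) → H) :
    tensorForm S γ b k C C ≤ tensorForm S γ' b' k C C := by
  induction k generalizing C with
  | zero => exact hbb _
  | succ k ih =>
    have h1 := hγ'.sum_nonneg (β := tensorForm S γ' b' k - tensorForm S γ b k)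
      (fun x => by simpa using ih x) fun p => shift H p C
    have h2 := hle.sum_nonneg (tensorForm_nonneg hγ hb k) fun p => shift H p C
    rw [tensorForm_succ, tensorForm_succ, ← sub_nonneg]
    refine (add_nonneg h1 h2).trans_eq ?_
    simp_rw [← Finset.sum_add_distrib, ← Finset.sum_sub_distrib]
    refine Finset.sum_congr rfl fun p _ => Finset.sum_congr rfl fun q _ => ?_
    simp only [LinearMap.sub_apply, Pi.sub_apply]
    ring

theorem tensorForm_smul_right (S : Finset I) (γ : I → I → ℝ) (b : LinearMap.BilinForm ℝ H)
    (r : ℝ) (k : ℕ) (C D : (I →₀ ℕ) → H) :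
    tensorForm S γ (r • b) k C D = r * tensorForm S γ b k C D := by
  induction k generalizing C D with
  | zero => rfl
  | succ k ih =>
    simp_rw [tensorForm_succ, ih, Finset.mul_sum]
    exact Finset.sum_congr rfl fun p _ => Finset.sum_congr rfl fun q _ => by ring

theorem tensorForm_comp (S : Finset I) (γ : I → I → ℝ) (b : LinearMap.BilinForm ℝ H)
    {H' : Type*} [AddCommGroup H'] [Module ℝ H'] (f g : H' →ₗ[ℝ] H)
    (k : ℕ) (C D : (I →₀ ℕ) → H') :
    tensorForm S γ b k (fun α => f (C α)) (fun α => g (D α)) =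
      tensorForm S γ (b.compl₁₂ f g) k C D := by
  induction k generalizing C D with
  | zero => rfl
  | succ k ih =>
    simp_rw [tensorForm_succ, ← ih]
    rfl

/-- The matrix of the identity. -/
def idMatrix (I : Type*) [DecidableEq I] (p q : I) : ℝ := if p = q then 1 else 0

variable [DecidableEq I]

theorem psdOn_idMatrix (S : Finset I) : PSDOn S (idMatrix I) := by
  refine ⟨fun p q => by simp [idMatrix, eq_comm], fun c => ?_⟩
  refine Finset.sum_nonneg fun p hp => ?_
  simp only [idMatrix, ite_mul, one_mul, zero_mul, Finset.sum_ite_eq, hp, if_true]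
  exact mul_self_nonneg _

theorem tensorForm_idMatrix_succ (S : Finset I) (b : LinearMap.BilinForm ℝ H) (k : ℕ)
    (C D : (I →₀ ℕ) → H) : tensorForm S (idMatrix I) b (k + 1) C D =
      ∑ q ∈ S, tensorForm S (idMatrix I) b k (shift H q C) (shift H q D) := by
  rw [tensorForm_succ]
  refine Finset.sum_congr rfl fun p hp => ?_
  simp [idMatrix, hp]

/-- The creation operator: `(M φ)_α = ∑_q α_q φ_{q, α - ε_q}`. -/
noncomputable def creation (S : Finset I) (φ : I → (I →₀ ℕ) → H) (α : I →₀ ℕ) : H :=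
  ∑ q ∈ S, (α q : ℝ) • φ q (α - Finsupp.single q 1)

/-- The canonical commutation relation: an annihilation operator commutes with creation up to the
term that removes the created index. -/
theorem shift_creation (S : Finset I) (φ : I → (I →₀ ℕ) → H) {q : I} (hq : q ∈ S) :
    shift H q (creation S φ) = φ q + creation S fun p => shift H q (φ p) := by
  ext α
  rw [shift_apply, creation, Pi.add_apply, creation]
  have h1 : ∀ p ∈ S, (((α + Finsupp.single q 1 : I →₀ ℕ) p : ℕ) : ℝ) •
      φ p (α + Finsupp.single q 1 - Finsupp.single p 1) =
      (if p = q then φ q α else 0) + (α p : ℝ) • shift H q (φ p) (α - Finsupp.single p 1) := by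
    intro p _
    -- The truncated subtraction is harmless: if `α p = 0`, the coefficient kills the term.
    have h2 : (α p : ℝ) • φ p (α + Finsupp.single q 1 - Finsupp.single p 1) =
        (α p : ℝ) • shift H q (φ p) (α - Finsupp.single p 1) := by
      rcases Nat.eq_zero_or_pos (α p) with h0 | h0
      · simp [h0]
      · rw [shift_apply]
        congr 2
        ext r
        by_cases hr : p = r
        · subst hr
          simp
          omega
        · simp [Finsupp.single_apply, hr]
    by_cases hpq : p = q
    · subst hpq
      rw [← h2]
      simp [add_smul]
      abel
    · rw [← h2]
      simp [hpq]
  rw [Finset.sum_congr rfl h1, Finset.sum_add_distrib]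
  simp [hq]

/-- Creation is adjoint to the shifts up to the factor `k + 1`. In the induction the commutator
contributes one copy of the sum and the remaining term `k + 1` further copies. -/
theorem tensorForm_creation (S : Finset I) (b : LinearMap.BilinForm ℝ H) (k : ℕ)
    (C : (I →₀ ℕ) → H) (φ : I → (I →₀ ℕ) → H) :
    tensorForm S (idMatrix I) b (k + 1) C (creation S φ) =
      (k + 1) * ∑ q ∈ S, tensorForm S (idMatrix I) b k (shift H q C) (φ q) := by
  induction k generalizing C φ with
  | zero =>
    rw [tensorForm_idMatrix_succ]
    simp only [CharP.cast_eq_zero, zero_add, one_mul]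
    refine Finset.sum_congr rfl fun q hq => ?_
    rw [shift_creation S φ hq, map_add, tensorForm_zero (D := creation _ _)]
    simp [creation]
  | succ k ih =>
    rw [tensorForm_idMatrix_succ]
    have h1 : ∀ q ∈ S, tensorForm S (idMatrix I) b (k + 1) (shift H q C)
        (shift H q (creation S φ)) = tensorForm S (idMatrix I) b (k + 1) (shift H q C) (φ q) +
        (k + 1) * ∑ p ∈ S, tensorForm S (idMatrix I) b k (shift H q (shift H p C))
          (shift H q (φ p)) := by
      intro q hq
      rw [shift_creation S φ hq, map_add, ih]
      simp_rw [shift_comm _ q]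
    rw [Finset.sum_congr rfl h1, Finset.sum_add_distrib, ← Finset.mul_sum, Finset.sum_comm]
    simp_rw [← tensorForm_idMatrix_succ]
    push_cast
    ring

/-- The weights are multinomial coefficients. The recursion is the multinomial Pascal rule, that is,
`∑_q β_q = k + 1`. -/
theorem tensorForm_idMatrix_eq_sum (S : Finset I) (b : LinearMap.BilinForm ℝ H) (k : ℕ)
    (C D : (I →₀ ℕ) → H) : tensorForm S (idMatrix I) b k C D =
      ∑ α ∈ S.finsuppAntidiag k,
        (k.factorial : ℝ) / (∏ p ∈ S, ((α p).factorial : ℝ)) * b (C α) (D α) := by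
  induction k generalizing C D with
  | zero => simp [tensorForm_zero]
  | succ k ih =>
    rw [tensorForm_idMatrix_succ]
    have h1 : ∀ q ∈ S, tensorForm S (idMatrix I) b k (shift H q C) (shift H q D) =
        ∑ β ∈ S.finsuppAntidiag (k + 1),
          (β q : ℝ) * ((k.factorial : ℝ) / (∏ p ∈ S, ((β p).factorial : ℝ)) *
            b (C β) (D β)) := by
      intro q hq
      rw [ih]
      have h2 : ∀ α : I →₀ ℕ, ∏ p ∈ S, (((α + Finsupp.single q 1 : I →₀ ℕ) p).factorial : ℝ) =
          (α q + 1) * ∏ p ∈ S, ((α p).factorial : ℝ) := by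
        intro α
        rw [← Finset.mul_prod_erase S _ hq, ← Finset.mul_prod_erase S
          (fun p => ((α p).factorial : ℝ)) hq]
        have : ∏ p ∈ S.erase q, (((α + Finsupp.single q 1 : I →₀ ℕ) p).factorial : ℝ) =
            ∏ p ∈ S.erase q, ((α p).factorial : ℝ) := by
          refine Finset.prod_congr rfl fun p hp => ?_
          simp [(Finset.ne_of_mem_erase hp).symm]
        rw [this]
        simp [Nat.factorial_succ]
        ring
      -- Multi-indices with `β q = 0` carry weight zero; the others are exactly the `α + ε_q`.
      rw [← Finset.sum_filter_add_sum_filter_not (S.finsuppAntidiag (k + 1)) (fun β : I →₀ ℕ => β q ≠ 0)]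
      rw [Finset.sum_eq_zero (s := Finset.filter (fun β : I →₀ ℕ => ¬ (β q ≠ 0)) _), add_zero]
      · refine Finset.sum_bij' (fun α _ => α + Finsupp.single q 1)
          (fun β _ => β - Finsupp.single q 1) ?_ ?_ ?_ ?_ ?_
        · intro α hα
          rw [Finset.mem_filter]
          rw [Finset.mem_finsuppAntidiag] at hα ⊢
          refine ⟨⟨?_, ?_⟩, by simp⟩
          · simp [Finset.sum_add_distrib, hα.1, Finsupp.single_apply, hq]
          · refine Finsupp.support_add.trans (Finset.union_subset hα.2 ?_)
            exact Finsupp.support_single_subset.trans (by simpa using hq)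
        · intro β hβ
          rw [Finset.mem_filter] at hβ
          rw [Finset.mem_finsuppAntidiag] at hβ ⊢
          refine ⟨?_, Finsupp.support_tsub.trans hβ.1.2⟩
          have h3 := hβ.1.1
          rw [← Finset.add_sum_erase S _ hq] at h3 ⊢
          have : ∑ p ∈ S.erase q, (β - Finsupp.single q 1 : I →₀ ℕ) p = ∑ p ∈ S.erase q, β p := by
            refine Finset.sum_congr rfl fun p hp => ?_
            simp [(Finset.ne_of_mem_erase hp).symm]
          rw [this]
          have := hβ.2
          simp
          omega
        · intro α _
          simp
        · intro β hβ
          have h3 := (Finset.mem_filter.1 hβ).2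
          refine tsub_add_cancel_of_le (Finsupp.single_le_iff.2 (by omega))
        · intro α _
          rw [h2, shift_apply, shift_apply]
          simp only [Finsupp.coe_add, Pi.add_apply, Finsupp.single_eq_same, Nat.cast_add,
            Nat.cast_one]
          have : ((α q : ℝ) + 1) ≠ 0 := by positivity
          have : ∏ p ∈ S, ((α p).factorial : ℝ) ≠ 0 :=
            Finset.prod_ne_zero_iff.2 fun p _ => by positivity
          field_simp
      · intro β hβ
        have h3 := (Finset.mem_filter.1 hβ).2
        simp [not_not.1 h3]
    rw [Finset.sum_congr rfl h1, Finset.sum_comm]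
    refine Finset.sum_congr rfl fun β hβ => ?_
    rw [← Finset.sum_mul, ← Nat.cast_sum, (Finset.mem_finsuppAntidiag.1 hβ).1, Nat.factorial_succ]
    push_cast
    ring

end Forms

/-! ### Time derivative of tensor powers of a Gram matrix. -/

section FormDerivative

open intervalIntegral

/-- The product rule for absolutely continuous functions, integrated. The integrands are only
integrable, so the derivatives exist only almost everywhere. -/
theorem intervalIntegral_primitive_mul {f g : ℝ → ℝ} {t : ℝ}
    (hf : IntervalIntegrable f volume 0 t) (hg : IntervalIntegrable g volume 0 t) :
    (∫ s in (0)..t, f s) * (∫ s in (0)..t, g s) =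
      ∫ s in (0)..t, (f s * (∫ r in (0)..s, g r) + (∫ r in (0)..s, f r) * g s) := by
  have h1 := AbsolutelyContinuousOnInterval.integral_deriv_mul_eq_sub
    (hf.absolutelyContinuousOnInterval_intervalIntegral (c := 0) (by simp))
    (hg.absolutelyContinuousOnInterval_intervalIntegral (c := 0) (by simp))
  simp only [integral_same, mul_zero, sub_zero] at h1
  rw [← h1]
  refine integral_congr_ae ?_
  filter_upwards [hf.ae_hasDerivAt_integral, hg.ae_hasDerivAt_integral] with s hfs hgs hs
  have hs' := uIoc_subset_uIcc hs
  rw [(hfs hs' 0 (by simp)).deriv, (hgs hs' 0 (by simp)).deriv]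

theorem intervalIntegrable_finset_sum {ι E : Type*} [NormedAddCommGroup E] (S : Finset ι)
    {f : ι → ℝ → E} {a b : ℝ}
    (h : ∀ i ∈ S, IntervalIntegrable (f i) volume a b) :
    IntervalIntegrable (fun s => ∑ i ∈ S, f i s) volume a b := by
  have := IntervalIntegrable.sum S h
  rwa [show ∑ i ∈ S, f i = fun s => ∑ i ∈ S, f i s from by ext; simp] at this

theorem intervalIntegral_sum_sum {ι κ : Type*} (S : Finset ι) (S' : Finset κ)
    {f : ι → κ → ℝ → ℝ} {a b : ℝ} (h : ∀ p q, IntervalIntegrable (f p q) volume a b) :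
    ∫ s in a..b, ∑ p ∈ S, ∑ q ∈ S', f p q s = ∑ p ∈ S, ∑ q ∈ S', ∫ s in a..b, f p q s := by
  rw [integral_finsetSum fun p _ => intervalIntegrable_finset_sum _ fun q _ => h p q]
  exact Finset.sum_congr rfl fun p _ => integral_finsetSum fun q _ => h p q

variable {I H : Type*} [AddCommGroup H] [Module ℝ H] {S : Finset I} {T : ℝ}
  {γ' : I → I → ℝ → ℝ}

/-- The matrix `∫₀ᵗ γ'`. -/
noncomputable def gramAt (γ' : I → I → ℝ → ℝ) (t : ℝ) (p q : I) : ℝ := ∫ s in (0)..t, γ' p q s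

theorem intervalIntegrable_sub (hγ : ∀ p q, IntervalIntegrable (γ' p q) volume 0 T)
    {t : ℝ} (ht : t ∈ Icc 0 T) (p q : I) : IntervalIntegrable (γ' p q) volume 0 t :=
  (hγ p q).mono_set (by
    rw [uIcc_of_le ht.1, uIcc_of_le (ht.1.trans ht.2)]
    exact Icc_subset_Icc_right ht.2)

theorem continuousOn_gramAt (hγ : ∀ p q, IntervalIntegrable (γ' p q) volume 0 T) (hT : 0 ≤ T)
    (p q : I) : ContinuousOn (fun t => gramAt γ' t p q) (Icc 0 T) := by
  have h := continuousOn_primitive_interval' (hγ p q) (left_mem_uIcc)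
  rwa [uIcc_of_le hT] at h

theorem continuousOn_tensorForm_gramAt (hγ : ∀ p q, IntervalIntegrable (γ' p q) volume 0 T)
    (hT : 0 ≤ T) (b : LinearMap.BilinForm ℝ H) (k : ℕ) (C D : (I →₀ ℕ) → H) :
    ContinuousOn (fun t => tensorForm S (gramAt γ' t) b k C D) (Icc 0 T) := by
  induction k generalizing C D with
  | zero => simp only [tensorForm_zero]; exact continuousOn_const
  | succ k ih =>
    simp only [tensorForm_succ]
    exact continuousOn_finsetSum _ fun p _ => continuousOn_finsetSum _ fun q _ =>
      (continuousOn_gramAt hγ hT p q).mul (ih _ _)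

theorem intervalIntegrable_mul_tensorForm (hγ : ∀ p q, IntervalIntegrable (γ' p q) volume 0 T)
    {t : ℝ} (ht : t ∈ Icc 0 T) (b : LinearMap.BilinForm ℝ H) (k : ℕ) (C D : (I →₀ ℕ) → H)
    (p q : I) :
    IntervalIntegrable (fun s => γ' p q s * tensorForm S (gramAt γ' s) b k C D) volume 0 t := by
  refine (intervalIntegrable_sub hγ ht p q).mul_continuousOn ?_
  rw [uIcc_of_le ht.1]
  exact (continuousOn_tensorForm_gramAt hγ (ht.1.trans ht.2) b k C D).mono
    (Icc_subset_Icc_right ht.2)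

/-- The rule `(γ^{⊗(k+1)})' = (k+1) γ' ⊗ γ^{⊗k}`. The product rule differentiates each factor in
turn, and all factors play the same role because the shifts commute. -/
theorem tensorForm_gramAt_succ (hγ : ∀ p q, IntervalIntegrable (γ' p q) volume 0 T)
    (b : LinearMap.BilinForm ℝ H) (k : ℕ) (C D : (I →₀ ℕ) → H) {t : ℝ} (ht : t ∈ Icc 0 T) :
    tensorForm S (gramAt γ' t) b (k + 1) C D = (k + 1) * ∫ s in (0)..t,
      ∑ p ∈ S, ∑ q ∈ S, γ' p q s *
        tensorForm S (gramAt γ' s) b k (shift H p C) (shift H q D) := by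
  induction k generalizing C D t with
  | zero =>
    rw [tensorForm_succ]
    simp only [tensorForm_zero, CharP.cast_eq_zero, zero_add, one_mul]
    rw [intervalIntegral_sum_sum _ _ fun p q => (intervalIntegrable_sub hγ ht p q).mul_const _]
    refine Finset.sum_congr rfl fun p _ => Finset.sum_congr rfl fun q _ => ?_
    rw [intervalIntegral.integral_mul_const, gramAt]
  | succ k ih =>
    set Φ : I → I → I → I → ℝ → ℝ := fun p q p' q' s => γ' p' q' s *
      tensorForm S (gramAt γ' s) b k (shift H p' (shift H p C)) (shift H q' (shift H q D)) with hΦ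
    have hΦi : ∀ p q p' q' {t : ℝ}, t ∈ Icc 0 T →
        IntervalIntegrable (Φ p q p' q') volume 0 t := fun p q p' q' t ht =>
      intervalIntegrable_mul_tensorForm hγ ht b k _ _ p' q'
    set Ψ : I → I → ℝ → ℝ := fun p q s => ∑ p' ∈ S, ∑ q' ∈ S, Φ p q p' q' s with hΨ
    have hΨi : ∀ p q {t : ℝ}, t ∈ Icc 0 T → IntervalIntegrable (Ψ p q) volume 0 t :=
      fun p q t ht => intervalIntegrable_finset_sum _ fun p' _ =>
        intervalIntegrable_finset_sum _ fun q' _ => hΦi p q p' q' ht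
    have hih : ∀ p q {s : ℝ}, s ∈ Icc 0 T →
        tensorForm S (gramAt γ' s) b (k + 1) (shift H p C) (shift H q D) =
          (k + 1) * ∫ r in (0)..s, Ψ p q r := fun p q s hs => ih _ _ hs
    have hsub : ∀ {s : ℝ}, s ∈ uIcc 0 t → s ∈ Icc 0 T := by
      intro s hs
      rw [uIcc_of_le ht.1] at hs
      exact ⟨hs.1, hs.2.trans ht.2⟩
    have hA : ∀ p q, IntervalIntegrable (fun s => γ' p q s *
        tensorForm S (gramAt γ' s) b (k + 1) (shift H p C) (shift H q D)) volume 0 t := fun p q =>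
      intervalIntegrable_mul_tensorForm hγ ht b (k + 1) _ _ p q
    have hB : ∀ p q, IntervalIntegrable (fun s => gramAt γ' s p q * Ψ p q s) volume 0 t := by
      intro p q
      refine (hΨi p q ht).continuousOn_mul ?_
      rw [uIcc_of_le ht.1]
      exact (continuousOn_gramAt hγ (ht.1.trans ht.2) p q).mono (Icc_subset_Icc_right ht.2)
    have step : ∀ p q, gramAt γ' t p q *
        tensorForm S (gramAt γ' t) b (k + 1) (shift H p C) (shift H q D) =
        (∫ s in (0)..t, γ' p q s *
          tensorForm S (gramAt γ' s) b (k + 1) (shift H p C) (shift H q D)) +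
        (k + 1) * ∫ s in (0)..t, gramAt γ' s p q * Ψ p q s := by
      intro p q
      rw [hih p q ht, gramAt, mul_left_comm,
        intervalIntegral_primitive_mul (intervalIntegrable_sub hγ ht p q) (hΨi p q ht),
        ← intervalIntegral.integral_const_mul, ← intervalIntegral.integral_const_mul,
        ← intervalIntegral.integral_add (hA p q) ((hB p q).const_mul _)]
      refine integral_congr fun s hs => ?_
      simp only [hih p q (hsub hs), gramAt]
      ring
    -- The differentiated factor sits in the second slot; exchanging the two pairs of indices moves
    -- it to the first.
    have hswap : ∀ s, ∑ p ∈ S, ∑ q ∈ S, gramAt γ' s p q * Ψ p q s =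
        ∑ p ∈ S, ∑ q ∈ S, γ' p q s *
          tensorForm S (gramAt γ' s) b (k + 1) (shift H p C) (shift H q D) := by
      intro s
      simp only [hΨ, hΦ, tensorForm_succ, Finset.mul_sum]
      calc _ = ∑ p ∈ S, ∑ p' ∈ S, ∑ q ∈ S, ∑ q' ∈ S, gramAt γ' s p q * (γ' p' q' s *
            tensorForm S (gramAt γ' s) b k (shift H p' (shift H p C))
              (shift H q' (shift H q D))) :=
            Finset.sum_congr rfl fun p _ => Finset.sum_comm
        _ = ∑ p' ∈ S, ∑ p ∈ S, ∑ q ∈ S, ∑ q' ∈ S, gramAt γ' s p q * (γ' p' q' s *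
            tensorForm S (gramAt γ' s) b k (shift H p' (shift H p C))
              (shift H q' (shift H q D))) := Finset.sum_comm
        _ = ∑ p' ∈ S, ∑ p ∈ S, ∑ q' ∈ S, ∑ q ∈ S, gramAt γ' s p q * (γ' p' q' s *
            tensorForm S (gramAt γ' s) b k (shift H p' (shift H p C))
              (shift H q' (shift H q D))) :=
            Finset.sum_congr rfl fun p _ => Finset.sum_congr rfl fun q _ => Finset.sum_comm
        _ = ∑ p' ∈ S, ∑ q' ∈ S, ∑ p ∈ S, ∑ q ∈ S, gramAt γ' s p q * (γ' p' q' s *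
            tensorForm S (gramAt γ' s) b k (shift H p' (shift H p C))
              (shift H q' (shift H q D))) :=
            Finset.sum_congr rfl fun p _ => Finset.sum_comm
        _ = _ := by
          refine Finset.sum_congr rfl fun p' _ => Finset.sum_congr rfl fun q' _ =>
            Finset.sum_congr rfl fun p _ => Finset.sum_congr rfl fun q _ => ?_
          rw [shift_comm p' p, shift_comm q' q]
          ring
    rw [tensorForm_succ]
    simp_rw [step, Finset.sum_add_distrib, ← Finset.mul_sum]
    have e1 : ∑ p ∈ S, ∑ q ∈ S, ∫ s in (0)..t, gramAt γ' s p q * Ψ p q s =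
        ∫ s in (0)..t, ∑ p ∈ S, ∑ q ∈ S, γ' p q s *
          tensorForm S (gramAt γ' s) b (k + 1) (shift H p C) (shift H q D) := by
      simp_rw [← hswap]
      rw [intervalIntegral_sum_sum _ _ hB]
    have e2 : ∑ p ∈ S, ∑ q ∈ S, (∫ s in (0)..t, γ' p q s *
          tensorForm S (gramAt γ' s) b (k + 1) (shift H p C) (shift H q D)) =
        ∫ s in (0)..t, ∑ p ∈ S, ∑ q ∈ S, γ' p q s *
          tensorForm S (gramAt γ' s) b (k + 1) (shift H p C) (shift H q D) := by
      rw [intervalIntegral_sum_sum _ _ hA]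
    rw [e1, e2]
    push_cast
    ring

end FormDerivative

/-! ### One implicit Euler step for the adjoint equation. -/

section Resolvent

variable {X H : Type*} [NormedAddCommGroup X] [InnerProductSpace ℝ X] [CompleteSpace X]
  [NormedAddCommGroup H] [InnerProductSpace ℝ H] [CompleteSpace H]
  {ι : X →L[ℝ] H} {A : X →L[ℝ] StrongDual ℝ X} {δ CA : ℝ}

/-- Lax–Milgram: for `τ C_A ≤ 1`, parabolicity makes the form `(ι w, ι φ) - τ ⟨A φ, w⟩` coercive on
`X` with constant `τ δ / 2`. Testing with the solution itself gives the norm bound. -/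
theorem StronglyParabolic.exists_resolvent (hA : StronglyParabolic ι A δ CA) (hδ : 0 < δ)
    {τ : ℝ} (hτ : 0 < τ) (hτC : τ * CA ≤ 1) :
    ∃ J : H →L[ℝ] X,
      (∀ c φ, inner ℝ (ι (J c)) (ι φ) - τ * A φ (J c) = inner ℝ c (ι φ)) ∧
      ∀ c, (1 - τ * CA) * ‖ι (J c)‖ ^ 2 + τ * δ * ‖J c‖ ^ 2 ≤ ‖c‖ ^ 2 := by
  set b : X →L[ℝ] X →L[ℝ] ℝ := toDual ι ∘L ι - τ • A.flip with hb
  have hb' : ∀ w φ, b w φ = inner ℝ (ι w) (ι φ) - τ * A φ w := fun w φ => by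
    simp [hb, toDual_apply]
  have hcoer : IsCoercive b := by
    refine ⟨τ * δ / 2, by positivity, fun w => ?_⟩
    have h1 := mul_le_mul_of_nonneg_left (hA w) hτ.le
    have h2 : τ * CA * ‖ι w‖ ^ 2 ≤ 1 * ‖ι w‖ ^ 2 :=
      mul_le_mul_of_nonneg_right hτC (sq_nonneg _)
    rw [hb', real_inner_self_eq_norm_sq]
    nlinarith [sq_nonneg ‖ι w‖]
  set E := hcoer.continuousLinearEquivOfBilin
  refine ⟨E.symm.toContinuousLinearMap ∘L ContinuousLinearMap.adjoint ι, ?_, ?_⟩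
  · intro c φ
    rw [← hb', ← hcoer.continuousLinearEquivOfBilin_apply]
    simp [E, ContinuousLinearMap.adjoint_inner_left]
  · intro c
    set w := (E.symm.toContinuousLinearMap ∘L ContinuousLinearMap.adjoint ι) c with hw
    have h0 : b w w = inner ℝ c (ι w) := by
      rw [← hcoer.continuousLinearEquivOfBilin_apply]
      simp [E, hw, ContinuousLinearMap.adjoint_inner_left]
    rw [hb', real_inner_self_eq_norm_sq] at h0
    have h1 := mul_le_mul_of_nonneg_left (hA w) hτ.le
    have h2 := real_inner_le_norm c (ι w)
    nlinarith [sq_nonneg (‖c‖ - ‖ι w‖)]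

end Resolvent

/-! ### Partitions adapted to a square integrable function. -/

section Partition

open Filter Topology

variable {V : Type*} [NormedAddCommGroup V]

theorem norm_sub_sq_le_three (a b c d : V) :
    ‖a - d‖ ^ 2 ≤ 3 * (‖a - b‖ ^ 2 + ‖b - c‖ ^ 2 + ‖d - c‖ ^ 2) := by
  have h1 : ‖a - d‖ ≤ ‖a - b‖ + ‖b - c‖ + ‖d - c‖ := by
    rw [norm_sub_rev d c]
    calc ‖a - d‖ = ‖(a - b) + (b - c) + (c - d)‖ := by congr 1; abel
      _ ≤ _ := norm_add₃_le
  have h2 := pow_le_pow_left₀ (norm_nonneg _) h1 2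
  nlinarith [sq_nonneg (‖a - b‖ - ‖b - c‖), sq_nonneg (‖a - b‖ - ‖d - c‖),
    sq_nonneg (‖b - c‖ - ‖d - c‖)]

theorem MemLp.intervalIntegrable_norm_sq {t : ℝ} (ht : 0 ≤ t) {v : ℝ → V}
    (hv : MemLp v 2 (leb t)) : IntervalIntegrable (fun r => ‖v r‖ ^ 2) volume 0 t := by
  rw [intervalIntegrable_iff_integrableOn_Ioo_of_le ht]
  exact (memLp_two_iff_integrable_sq_norm hv.1).1 hv

/-- Comparison with a uniformly continuous `g` reduces the error to `e = ‖v - g‖²`. In each cell of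
a uniform grid there is a point outside `N` at which `e` does not exceed its mean, so the sampled
values of `e` are controlled by its integral. -/
theorem exists_partition [NormedSpace ℝ V] {t : ℝ} (ht : 0 < t) {v : ℝ → V} (hv : MemLp v 2 (leb t)) {N : Set ℝ}
    (hN : volume N = 0) (htN : t ∉ N) {ε : ℝ} (hε : 0 < ε) :
    ∃ (n : ℕ) (s : ℕ → ℝ), s 0 = 0 ∧ s n = t ∧ (∀ i < n, s i < s (i + 1)) ∧
      (∀ i < n, s (i + 1) - s i < ε) ∧ (∀ i < n, s (i + 1) ∉ N) ∧
      ∑ i ∈ Finset.range n, ∫ r in (s i)..(s (i + 1)), ‖v r - v (s (i + 1))‖ ^ 2 < ε := by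
  -- The final error is at most `9 ∫ e + 3ε/20 + 6 τ e(t)`. With `∫ e ≤ ε/40` and `60 τ e(t) < ε`
  -- this is below `ε/2`.
  obtain ⟨g, hgc, hge, hgcont, hgL⟩ := hv.exists_hasCompactSupport_eLpNorm_sub_le (by norm_num)
    (ε := ENNReal.ofReal (√(ε / 40))) (by positivity)
  set e : ℝ → ℝ := fun r => ‖v r - g r‖ ^ 2 with he
  have heint : IntervalIntegrable e volume 0 t :=
    MemLp.intervalIntegrable_norm_sq ht.le (hv.sub hgL)
  have he0 : ∀ r, 0 ≤ e r := fun r => sq_nonneg _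
  have hE : ∫ r in (0)..t, e r ≤ ε / 40 := by
    have h1 := (hv.sub hgL).eLpNorm_eq_integral_rpow_norm (by norm_num) (by norm_num)
    rw [h1] at hge
    have h2 := (ENNReal.ofReal_le_ofReal_iff (by positivity)).1 hge
    rw [intervalIntegral.integral_of_le ht.le, integral_Ioc_eq_integral_Ioo]
    have h3 : ∫ r in Ioo 0 t, e r = ∫ a, ‖(v - g) a‖ ^ (2 : ℝ≥0∞).toReal ∂leb t := by
      simp [he]
    have h4 : 0 ≤ ∫ r in Ioo 0 t, e r := integral_nonneg fun r => he0 r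
    rw [← h3] at h2
    simp only [ENNReal.toReal_ofNat] at h2
    rw [← one_div, ← Real.sqrt_eq_rpow] at h2
    exact (Real.sqrt_le_sqrt_iff (by positivity)).1 h2
  obtain ⟨η, hη, hgη⟩ := Metric.uniformContinuous_iff.1
    (hgc.uniformContinuous_of_continuous hgcont) (√(ε / (20 * t)))
    (by positivity)
  have hg2 : ∀ r r', |r - r'| < η → ‖g r - g r'‖ ^ 2 ≤ ε / (20 * t) := by
    intro r r' h
    have h1 := (hgη (a := r) (b := r') (by rwa [Real.dist_eq])).le
    rw [dist_eq_norm] at h1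
    calc _ ≤ √(ε / (20 * t)) ^ 2 := pow_le_pow_left₀ (norm_nonneg _) h1 2
      _ = _ := Real.sq_sqrt (by positivity)
  obtain ⟨n, hn⟩ := exists_nat_gt (max 1 (t * max (max (2 / ε) (2 / η)) (60 * e t / ε)))
  have hn1 : (1 : ℝ) < n := (le_max_left _ _).trans_lt hn
  have hn0 : (0 : ℝ) < n := by linarith
  have hn2 : t * max (max (2 / ε) (2 / η)) (60 * e t / ε) < n := (le_max_right _ _).trans_lt hn
  set τ := t / n with hτ
  have hτ0 : 0 < τ := by positivity
  have hnτ : n * τ = t := by rw [hτ]; field_simp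
  have hmax : max (max (2 / ε) (2 / η)) (60 * e t / ε) * τ < 1 := by
    rw [hτ, ← mul_div_assoc, div_lt_one hn0, mul_comm]
    exact hn2
  have hτε : 2 * τ < ε := by
    have h1 : 2 / ε * τ < 1 := (mul_le_mul_of_nonneg_right
      ((le_max_left _ _).trans (le_max_left _ _)) hτ0.le).trans_lt hmax
    rw [div_mul_eq_mul_div, div_lt_one hε] at h1
    exact h1
  have hτη : 2 * τ < η := by
    have h1 : 2 / η * τ < 1 := (mul_le_mul_of_nonneg_right
      ((le_max_right _ _).trans (le_max_left _ _)) hτ0.le).trans_lt hmax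
    rw [div_mul_eq_mul_div, div_lt_one hη] at h1
    exact h1
  have hτe : 60 * (τ * e t) < ε := by
    have h1 : 60 * e t / ε * τ < 1 := (mul_le_mul_of_nonneg_right
      (le_max_right _ _) hτ0.le).trans_lt hmax
    rw [div_mul_eq_mul_div, div_lt_one hε] at h1
    linarith
  have hcell : ∀ j < n, IntervalIntegrable e volume (j * τ) ((j + 1 : ℕ) * τ) := by
    intro j hj
    refine heint.mono_set ?_
    have h1 : ((j + 1 : ℕ) : ℝ) * τ ≤ t := by
      rw [← hnτ]
      exact mul_le_mul_of_nonneg_right (by exact_mod_cast hj) hτ0.le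
    have h2 : (j : ℝ) * τ ≤ (j + 1 : ℕ) * τ :=
      mul_le_mul_of_nonneg_right (by simp) hτ0.le
    rw [uIcc_of_le h2, uIcc_of_le ht.le]
    exact Icc_subset_Icc (by positivity) h1
  have hx : ∀ j : ℕ, ∃ x : ℝ, j < n → j * τ < x ∧ x < (j + 1 : ℕ) * τ ∧ x ∉ N ∧
      τ * e x ≤ ∫ r in (j * τ)..((j + 1 : ℕ) * τ), e r := by
    intro j
    by_cases hj : j < n
    swap
    · exact ⟨0, fun h => absurd h hj⟩
    have h2 : (j : ℝ) * τ < (j + 1 : ℕ) * τ := by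
      push_cast
      nlinarith
    set μ : Measure ℝ := volume.restrict (Ioo (j * τ) ((j + 1 : ℕ) * τ)) with hμ
    have hvol : μ.real univ = τ := by
      rw [hμ, measureReal_restrict_apply MeasurableSet.univ, univ_inter, Real.volume_real_Ioo_of_le
        h2.le]
      push_cast
      ring
    have hμ0 : μ ≠ 0 := by
      intro h
      rw [h] at hvol
      simp at hvol
      exact hτ0.ne hvol
    have hint : Integrable e μ :=
      (intervalIntegrable_iff_integrableOn_Ioo_of_le h2.le).1 (hcell j hj)
    have hN' : μ (N ∪ (Ioo (j * τ) ((j + 1 : ℕ) * τ))ᶜ) = 0 := by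
      refine measure_union_null ?_ ?_
      · exact Measure.restrict_le_self.absolutelyContinuous hN
      · rw [hμ, Measure.restrict_apply measurableSet_Ioo.compl, compl_inter_self, measure_empty]
    obtain ⟨x, hxN, hxle⟩ := exists_notMem_null_le_average hμ0 hint hN'
    simp only [mem_union, mem_compl_iff, not_or, not_not] at hxN
    refine ⟨x, fun _ => ⟨hxN.2.1, hxN.2.2, hxN.1, ?_⟩⟩
    rw [average_eq, hvol, smul_eq_mul, inv_mul_eq_div, le_div_iff₀ hτ0] at hxle
    rw [intervalIntegral.integral_of_le h2.le, integral_Ioc_eq_integral_Ioo, mul_comm]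
    exact hxle
  choose x hx using hx
  -- The node `s (i+1)` is taken from the `i`-th cell, so the steps are at most `2τ`. In the last
  -- cell the chosen point is replaced by `t`, which costs the extra term `τ e(t)`.
  set s : ℕ → ℝ := fun i => if i = 0 then 0 else if i = n then t else x (i - 1) with hs
  have hn0' : n ≠ 0 := by rintro rfl; simp at hn0
  have hs0 : s 0 = 0 := by simp [hs]
  have hsn : s n = t := by simp [hs, hn0']
  have hsx : ∀ i, i + 1 < n → s (i + 1) = x i := by
    intro i hi
    simp [hs, hi.ne]
  have hup : ∀ i < n, i * τ < s (i + 1) ∧ s (i + 1) ≤ (i + 1 : ℕ) * τ ∧ s (i + 1) ∉ N ∧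
      τ * e (s (i + 1)) ≤ (∫ r in (i * τ)..((i + 1 : ℕ) * τ), e r) +
        if i = n - 1 then τ * e t else 0 := by
    intro i hi
    rcases Nat.lt_or_ge (i + 1) n with h | h
    · rw [hsx i h]
      obtain ⟨h1, h2, h3, h4⟩ := hx i hi
      refine ⟨h1, h2.le, h3, ?_⟩
      rw [if_neg (by omega), add_zero]
      exact h4
    · have h1 : i + 1 = n := by omega
      have h2 : (i : ℝ) * τ < (i + 1 : ℕ) * τ := by
        push_cast
        nlinarith
      rw [if_pos (by omega), h1, hsn, hnτ]
      refine ⟨?_, le_rfl, htN, ?_⟩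
      · rw [h1, hnτ] at h2; exact h2
      · rw [h1, hnτ] at h2
        have := intervalIntegral.integral_nonneg (μ := volume) h2.le fun u _ => he0 u
        linarith
  have hlow : ∀ i < n, s i ≤ i * τ ∧ (i : ℝ) * τ - τ ≤ s i ∧ 0 ≤ s i := by
    intro i hi
    rcases i with _ | i
    · simp [hs0, hτ0.le]
    · obtain ⟨h1, h2, -⟩ := hup i (by omega)
      have : 0 ≤ (i : ℝ) * τ := by positivity
      refine ⟨h2, ?_, by linarith⟩
      push_cast
      linarith
  have hlt : ∀ i < n, s i < s (i + 1) := fun i hi => (hlow i hi).1.trans_lt (hup i hi).1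
  have hle : ∀ i < n, s (i + 1) ≤ t := by
    intro i hi
    refine (hup i hi).2.1.trans ?_
    rw [← hnτ]
    exact mul_le_mul_of_nonneg_right (by exact_mod_cast hi) hτ0.le
  have hmesh : ∀ i < n, s (i + 1) - s i ≤ 2 * τ := by
    intro i hi
    have h1 := (hup i hi).2.1
    have h2 := (hlow i hi).2.1
    push_cast at h1
    linarith
  have hsub : ∀ {f : ℝ → ℝ}, IntervalIntegrable f volume 0 t → ∀ i < n,
      IntervalIntegrable f volume (s i) (s (i + 1)) := by
    intro f hf i hi
    refine hf.mono_set ?_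
    rw [uIcc_of_le (hlt i hi).le, uIcc_of_le ht.le]
    exact Icc_subset_Icc (hlow i hi).2.2 (hle i hi)
  refine ⟨n, s, hs0, hsn, hlt, fun i hi => (hmesh i hi).trans_lt hτε,
    fun i hi => (hup i hi).2.2.1, ?_⟩
  have hpiece : ∀ i ∈ Finset.range n, ∫ r in (s i)..(s (i + 1)), ‖v r - v (s (i + 1))‖ ^ 2 ≤
      3 * (∫ r in (s i)..(s (i + 1)), e r) + 3 * (ε / (20 * t)) * (s (i + 1) - s i) +
      6 * ((∫ r in (i * τ)..((i + 1 : ℕ) * τ), e r) + if i = n - 1 then τ * e t else 0) := by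
    intro i hi
    have hi := Finset.mem_range.1 hi
    have h1 : ∫ r in (s i)..(s (i + 1)), ‖v r - v (s (i + 1))‖ ^ 2 ≤
        ∫ r in (s i)..(s (i + 1)), (3 * e r + (3 * (ε / (20 * t)) + 3 * e (s (i + 1)))) := by
      refine intervalIntegral.integral_mono_on (hlt i hi).le ?_ ?_ ?_
      · exact hsub (MemLp.intervalIntegrable_norm_sq ht.le
          (hv.sub (memLp_const (v (s (i + 1)))))) i hi
      · exact ((hsub heint i hi).const_mul 3).add intervalIntegrable_const
      · intro r hr
        have h3 := norm_sub_sq_le_three (v r) (g r) (g (s (i + 1))) (v (s (i + 1)))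
        have h4 := hg2 r (s (i + 1)) (by
          have := hmesh i hi
          rw [abs_lt]
          constructor <;> linarith [hr.1, hr.2])
        simp only [he]
        linarith
    rw [intervalIntegral.integral_add ((hsub heint i hi).const_mul 3) intervalIntegrable_const,
      intervalIntegral.integral_const_mul, intervalIntegral.integral_const, smul_eq_mul] at h1
    have h2 := (hup i hi).2.2.2
    have h3 : (s (i + 1) - s i) * e (s (i + 1)) ≤ 2 * (τ * e (s (i + 1))) := by
      have := mul_le_mul_of_nonneg_right (hmesh i hi) (he0 (s (i + 1)))
      linarith
    nlinarith
  have hsum := Finset.sum_le_sum hpiece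
  rw [Finset.sum_add_distrib, Finset.sum_add_distrib, ← Finset.mul_sum, ← Finset.mul_sum,
    ← Finset.mul_sum, Finset.sum_add_distrib,
    intervalIntegral.sum_integral_adjacent_intervals (fun i hi => hsub heint i hi),
    intervalIntegral.sum_integral_adjacent_intervals (a := fun i : ℕ => (i : ℝ) * τ)
      (fun i hi => hcell i hi), Finset.sum_range_sub, hs0, hsn, hnτ] at hsum
  have hlast : ∑ i ∈ Finset.range n, (if i = n - 1 then τ * e t else 0) ≤ τ * e t := by
    rw [Finset.sum_ite_eq' (Finset.range n)]
    split_ifs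
    · exact le_rfl
    · exact mul_nonneg hτ0.le (he0 t)
  have h5 : 3 * (ε / (20 * t)) * (t - 0) = 3 * ε / 20 := by
    field_simp
    ring
  rw [h5] at hsum
  simp only [CharP.cast_eq_zero, zero_mul] at hsum
  linarith

end Partition

/-! ### Discrete duality for the parabolic equation. -/

section Euler

variable {X H : Type*} [NormedAddCommGroup X] [InnerProductSpace ℝ X] [CompleteSpace X]
  [NormedAddCommGroup H] [InnerProductSpace ℝ H]
  {ι : X →L[ℝ] H} {A : X →L[ℝ] StrongDual ℝ X} {δ CA : ℝ}

theorem simpleFunc_apply_integrable {Y : Type*} [NormedAddCommGroup Y] [NormedSpace ℝ Y]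
    (R : SimpleFunc ℝ (H →L[ℝ] Y)) (c : H) (a b : ℝ) :
    IntervalIntegrable (fun r => ‖R r c‖ ^ 2) volume a b := by
  have h1 : StronglyMeasurable fun r => ‖R r c‖ ^ 2 :=
    (((ContinuousLinearMap.apply ℝ Y c).continuous.comp_stronglyMeasurable
      R.stronglyMeasurable).norm).pow 2
  obtain ⟨K, hK⟩ := R.exists_forall_norm_le
  rw [intervalIntegrable_iff]
  refine Measure.integrableOn_of_bounded (M := (K * ‖c‖) ^ 2) (by simp) h1.aestronglyMeasurable
    (ae_of_all _ fun r => ?_)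
  rw [norm_pow, norm_norm]
  exact pow_le_pow_left₀ (norm_nonneg _) (((R r).le_opNorm c).trans
    (mul_le_mul_of_nonneg_right (hK r) (norm_nonneg _))) 2

theorem intervalIntegrable_apply_simpleFunc {Y : Type*} [NormedAddCommGroup Y] [NormedSpace ℝ Y]
    {g : ℝ → StrongDual ℝ Y} {a b : ℝ}
    (hg : IntervalIntegrable g volume a b) (R : SimpleFunc ℝ (H →L[ℝ] Y)) (c : H) :
    IntervalIntegrable (fun r => g r (R r c)) volume a b := by
  have h1 : StronglyMeasurable fun r => R r c :=
    (ContinuousLinearMap.apply ℝ Y c).continuous.comp_stronglyMeasurable R.stronglyMeasurable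
  obtain ⟨K, hK⟩ := R.exists_forall_norm_le
  rw [intervalIntegrable_iff] at hg ⊢
  refine Integrable.mono' (hg.norm.mul_const (K * ‖c‖)) ?_ (ae_of_all _ fun r => ?_)
  · exact (isBoundedBilinearMap_apply (𝕜 := ℝ)).continuous.comp_aestronglyMeasurable
      (hg.aestronglyMeasurable.prodMk h1.aestronglyMeasurable)
  · exact ((g r).le_opNorm _).trans (mul_le_mul_of_nonneg_left (((R r).le_opNorm c).trans
      (mul_le_mul_of_nonneg_right (hK r) (norm_nonneg _))) (norm_nonneg _))

/-- `R` is the solution operator of the implicit Euler scheme for the adjoint equation, run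
backwards from `s n`. Because each step is tested against the value at the right node, the
representation is exact apart from the displayed defect `A (v r - v (s (i+1)))`. -/
theorem StronglyParabolic.exists_euler [CompleteSpace H] (hA : StronglyParabolic ι A δ CA) (hδ : 0 < δ)
    {C η : ℝ} (hC : 0 ≤ C) (s : ℕ → ℝ) (hs0 : s 0 = 0) (n : ℕ)
    (hs : ∀ i < n, s i < s (i + 1))
    (hsC : ∀ i < n, (s (i + 1) - s i) * CA ≤ 1 ∧
      1 ≤ (1 - (s (i + 1) - s i) * CA) * Real.exp (C * (s (i + 1) - s i)) ∧
      C * (s (i + 1) - s i) ≤ η) :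
    ∃ (R : SimpleFunc ℝ (H →L[ℝ] X)) (W : H →L[ℝ] H),
      (∀ r ∈ Ioc 0 (s n), ∀ c,
        ‖ι (R r c)‖ ^ 2 ≤ Real.exp (C * (s n - r) + η) * ‖c‖ ^ 2) ∧
      (∀ c, ‖W c‖ ^ 2 + δ * (∫ r in (0)..(s n), ‖R r c‖ ^ 2) ≤
        Real.exp (C * s n) * ‖c‖ ^ 2) ∧
      ∀ (y : ℕ → H) (v : ℝ → X) (f u : ℝ → StrongDual ℝ X),
        (∀ i < n, y (i + 1) = ι (v (s (i + 1)))) → (∀ i ≤ n, u (s i) = toDual ι (y i)) →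
        (∀ i < n, IntervalIntegrable (fun r => A (v r)) volume (s i) (s (i + 1))) →
        (∀ i < n, IntervalIntegrable f volume (s i) (s (i + 1))) →
        (∀ i < n, u (s (i + 1)) = u (s i) + ∫ r in (s i)..(s (i + 1)), (A (v r) + f r)) →
        ∀ c, inner ℝ (y n) c = inner ℝ (y 0) (W c) + (∫ r in (0)..(s n), f r (R r c)) +
          ∑ i ∈ Finset.range n, ∫ r in (s i)..(s (i + 1)), A (v r - v (s (i + 1))) (R r c) := by
  induction n with
  | zero =>
    refine ⟨0, ContinuousLinearMap.id ℝ H, ?_, ?_, ?_⟩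
    · intro r hr
      rw [hs0] at hr
      exact absurd (hr.1.trans_le hr.2) (lt_irrefl _)
    · intro c
      simp [hs0]
    · intro y v f u _ _ _ _ _ c
      simp [hs0]
  | succ n ih =>
    obtain ⟨R, W, hR, hW, hid⟩ := ih (fun i hi => hs i (by omega)) (fun i hi => hsC i (by omega))
    obtain ⟨hτ1, hτ2, hτ3⟩ := hsC n (by omega)
    have hlt := hs n (by omega)
    set τ := s (n + 1) - s n with hτ
    have hτ0 : 0 < τ := sub_pos.2 hlt
    have hle : ∀ i ≤ n, ∀ j ≤ i, s j ≤ s i := by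
      intro i hi j hj
      induction i with
      | zero => rw [Nat.le_zero.1 hj]
      | succ i ihi =>
        rcases Nat.lt_or_ge j (i + 1) with h | h
        · exact (ihi (by omega) (by omega)).trans (hs i (by omega)).le
        · rw [show j = i + 1 by omega]
    have hsn : 0 ≤ s n := hs0 ▸ hle n le_rfl 0 (Nat.zero_le n)
    obtain ⟨J, hJ, hJn⟩ := hA.exists_resolvent hδ hτ0 hτ1
    have hJ1 : ∀ c, ‖ι (J c)‖ ^ 2 ≤ Real.exp (C * τ) * ‖c‖ ^ 2 := by
      intro c
      have h1 := hJn c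
      have h2 := mul_le_mul_of_nonneg_left h1 (Real.exp_pos (C * τ)).le
      have h3 := mul_le_mul_of_nonneg_right hτ2 (sq_nonneg ‖ι (J c)‖)
      have h4 : 0 ≤ Real.exp (C * τ) * (τ * δ * ‖J c‖ ^ 2) := by positivity
      nlinarith
    -- A new last interval comes first in backward time: `J` acts on the datum, and the old scheme
    -- continues from `ι (J c)`.
    set R' : SimpleFunc ℝ (H →L[ℝ] X) := SimpleFunc.piecewise (Iic (s n)) measurableSet_Iic
      (R.map fun T => T ∘L ι ∘L J) (SimpleFunc.const ℝ J) with hR'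
    have hR1 : ∀ r ≤ s n, ∀ c, R' r c = R r (ι (J c)) := by
      intro r hr c
      rw [hR', SimpleFunc.piecewise_apply, if_pos (by exact hr)]
      rfl
    have hR2 : ∀ r, s n < r → ∀ c, R' r c = J c := by
      intro r hr c
      rw [hR', SimpleFunc.piecewise_apply, if_neg (by simpa using hr)]
      rfl
    have hcongr1 : ∀ (F : ℝ → X → ℝ) {a b : ℝ}, a ≤ b → b ≤ s n → ∀ c,
        ∫ r in a..b, F r (R' r c) = ∫ r in a..b, F r (R r (ι (J c))) := by
      intro F a b hab hb c
      refine intervalIntegral.integral_congr fun r hr => ?_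
      rw [uIcc_of_le hab] at hr
      simp only [hR1 r (hr.2.trans hb)]
    have hcongr2 : ∀ (F : ℝ → X → ℝ) c,
        ∫ r in (s n)..(s (n + 1)), F r (R' r c) = ∫ r in (s n)..(s (n + 1)), F r (J c) := by
      intro F c
      refine intervalIntegral.integral_congr_ae (ae_of_all _ fun r hr => ?_)
      rw [uIoc_of_le hlt.le] at hr
      simp only [hR2 r hr.1]
    refine ⟨R', W ∘L ι ∘L J, ?_, ?_, ?_⟩
    · intro r hr c
      rcases le_or_gt r (s n) with h | h
      · rw [hR1 r h]
        refine (hR r ⟨hr.1, h⟩ _).trans ?_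
        refine (mul_le_mul_of_nonneg_left (hJ1 c) (Real.exp_pos _).le).trans_eq ?_
        rw [← mul_assoc, ← Real.exp_add]
        congr 2
        rw [hτ]
        ring
      -- Inside the cell the available growth factor is `e^{Cτ}` rather than `e^{C(s_{n+1}-r)}`; the
      -- slack `η ≥ Cτ` pays for the difference.
      · rw [hR2 r h]
        refine (hJ1 c).trans (mul_le_mul_of_nonneg_right (Real.exp_le_exp.2 ?_) (sq_nonneg _))
        have : 0 ≤ C * (s (n + 1) - r) := mul_nonneg hC (sub_nonneg.2 hr.2)
        linarith
    · intro c
      have h1 := hW (ι (J c))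
      rw [← intervalIntegral.integral_add_adjacent_intervals (b := s n)
        (simpleFunc_apply_integrable R' c _ _) (simpleFunc_apply_integrable R' c _ _),
        hcongr1 (fun _ x => ‖x‖ ^ 2) hsn le_rfl c, hcongr2 (fun _ x => ‖x‖ ^ 2) c,
        intervalIntegral.integral_const, smul_eq_mul, ← hτ]
      have h2 : Real.exp (C * s (n + 1)) = Real.exp (C * s n) * Real.exp (C * τ) := by
        rw [← Real.exp_add, hτ]
        ring_nf
      have h3 : (1 : ℝ) ≤ Real.exp (C * s n) * Real.exp (C * τ) := by
        rw [← h2]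
        exact Real.one_le_exp (mul_nonneg hC (hsn.trans hlt.le))
      have h4 := mul_le_mul_of_nonneg_left (hJn c) (zero_le_one.trans h3)
      have h5 := mul_le_mul_of_nonneg_right hτ2
        (mul_nonneg (Real.exp_pos (C * s n)).le (sq_nonneg ‖ι (J c)‖))
      have h6 := mul_le_mul_of_nonneg_right h3 (by positivity : 0 ≤ τ * δ * ‖J c‖ ^ 2)
      rw [h2]
      simp only [ContinuousLinearMap.comp_apply] at h1 ⊢
      nlinarith
    · intro y v f u hyv huy hAv hf hu c
      have hprev := hid y v f u (fun i hi => hyv i (by omega)) (fun i hi => huy i (by omega))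
        (fun i hi => hAv i (by omega)) (fun i hi => hf i (by omega))
        (fun i hi => hu i (by omega)) (ι (J c))
      have hAv' := hAv n (by omega)
      have hf' := hf n (by omega)
      have hfall : IntervalIntegrable f volume 0 (s n) := by
        have := IntervalIntegrable.trans_iterate (a := s) (n := n) (μ := volume) (f := f)
          fun i hi => hf i (by omega)
        rwa [hs0] at this
      have hAi : ∀ w, IntervalIntegrable (fun r => A (v r) w) volume (s n) (s (n + 1)) := fun w => by
        have := hAv'.norm
        rw [intervalIntegrable_iff] at hAv' ⊢
        exact (ContinuousLinearMap.apply ℝ ℝ w).integrable_comp hAv'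
      have hfi : ∀ w, IntervalIntegrable (fun r => f r w) volume (s n) (s (n + 1)) := fun w => by
        rw [intervalIntegrable_iff] at hf' ⊢
        exact (ContinuousLinearMap.apply ℝ ℝ w).integrable_comp hf'
      have hstep : inner ℝ (y (n + 1)) c = inner ℝ (y n) (ι (J c)) +
          (∫ r in (s n)..(s (n + 1)), f r (J c)) +
          ∫ r in (s n)..(s (n + 1)), A (v r - v (s (n + 1))) (J c) := by
        -- The resolvent equation tested with the solution at the right node, where `y` and `v`
        -- agree.
        have h1 := hJ c (v (s (n + 1)))
        rw [← hyv n (by omega), real_inner_comm, real_inner_comm (y (n + 1)) c] at h1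
        have h2 : inner ℝ (y (n + 1)) (ι (J c)) = inner ℝ (y n) (ι (J c)) +
            ∫ r in (s n)..(s (n + 1)), (A (v r) (J c) + f r (J c)) := by
          rw [← toDual_apply, ← huy (n + 1) le_rfl, hu n (by omega), huy n (by omega),
            add_apply, toDual_apply]
          congr 1
          exact ((ContinuousLinearMap.apply ℝ ℝ (J c)).intervalIntegral_comp_comm
            (hAv'.add hf')).symm
        rw [intervalIntegral.integral_add (hAi _) (hfi _)] at h2
        have h3 : ∫ r in (s n)..(s (n + 1)), A (v r - v (s (n + 1))) (J c) =
            (∫ r in (s n)..(s (n + 1)), A (v r) (J c)) - τ * A (v (s (n + 1))) (J c) := by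
          simp only [map_sub, sub_apply]
          rw [intervalIntegral.integral_sub (hAi _) intervalIntegrable_const,
            intervalIntegral.integral_const, smul_eq_mul]
        linarith
      have hfull : IntervalIntegrable f volume 0 (s (n + 1)) := hfall.trans hf'
      rw [hstep, hprev, Finset.sum_range_succ,
        ← intervalIntegral.integral_add_adjacent_intervals (b := s n)
          (intervalIntegrable_apply_simpleFunc hfall R' c)
          (intervalIntegrable_apply_simpleFunc hf' R' c),
        hcongr1 (fun r x => f r x) hsn le_rfl c, hcongr2 (fun r x => f r x) c,
        hcongr2 (fun r x => A (v r - v (s (n + 1))) x) c]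
      have : ∑ i ∈ Finset.range n, ∫ r in (s i)..(s (i + 1)), A (v r - v (s (i + 1))) (R' r c) =
          ∑ i ∈ Finset.range n, ∫ r in (s i)..(s (i + 1)),
            A (v r - v (s (i + 1))) (R r (ι (J c))) := by
        refine Finset.sum_congr rfl fun i hi => ?_
        have hi := Finset.mem_range.1 hi
        refine hcongr1 (fun r x => A (v r - v (s (i + 1))) x) (hs i (by omega)).le ?_ c
        exact hle n le_rfl (i + 1) hi
      rw [this]
      simp only [ContinuousLinearMap.comp_apply]
      ring

/-- With `e^{Cτ} ≥ 1 + Cτ` it suffices that `τ² C_A C ≤ τ (C - C_A)`. For `C > C_A` this holds for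
all small `τ`. -/
theorem one_le_one_sub_mul_exp {C τ : ℝ} (hτ : 0 ≤ τ)
    (h : τ * (CA * C) ≤ C - CA) (h1 : τ * CA ≤ 1) :
    1 ≤ (1 - τ * CA) * Real.exp (C * τ) := by
  have h2 := Real.add_one_le_exp (C * τ)
  have h3 := mul_le_mul_of_nonneg_left h2 (sub_nonneg.2 h1)
  nlinarith [mul_le_mul_of_nonneg_right h hτ]

/-- Approximate duality with error `ε`. The same `R` and `W` serve a whole finite family of
equations and every `c`, so they can be applied coordinatewise to tensors. -/
theorem StronglyParabolic.exists_dual_steps [CompleteSpace H] (hA : StronglyParabolic ι A δ CA)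
    (hδ : 0 < δ) (hCA : 0 ≤ CA) {C : ℝ} (hC : CA < C) {κ : Type*} [Fintype κ] {t : ℝ} (ht : 0 < t)
    {N : Set ℝ} (hN : volume N = 0) (htN : t ∉ N) {v : κ → ℝ → X}
    (hv : ∀ a, MemLp (v a) 2 (leb t)) {f u : κ → ℝ → StrongDual ℝ X}
    (hf : ∀ a, IntervalIntegrable (f a) volume 0 t) {x : κ → H}
    (hu : ∀ a, ∀ r ∈ Icc 0 t, u a r = toDual ι (x a) + ∫ s in (0)..r, (A (v a s) + f a s))
    (huv : ∀ a, ∀ r ∈ Ioc 0 t, r ∉ N → u a r = toDual ι (ι (v a r))) {ε : ℝ} (hε : 0 < ε) :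
    ∃ (R : SimpleFunc ℝ (H →L[ℝ] X)) (W : H →L[ℝ] H),
      (∀ r ∈ Ioc 0 t, ∀ c, ‖ι (R r c)‖ ^ 2 ≤ Real.exp (C * (t - r) + ε) * ‖c‖ ^ 2) ∧
      (∀ c, ‖W c‖ ^ 2 + δ * (∫ r in (0)..t, ‖R r c‖ ^ 2) ≤ Real.exp (C * t) * ‖c‖ ^ 2) ∧
      ∀ a c, |inner ℝ (ι (v a t)) c - inner ℝ (x a) (W c) - ∫ r in (0)..t, f a r (R r c)| ≤
        ε * (1 + ‖c‖ ^ 2) := by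
  have hC0 : 0 < C := hCA.trans_lt hC
  -- The weight in Young's inequality for the defect: large enough that the part with `‖R r c‖²` is
  -- at most `ε ‖c‖²`. The mesh `ε₀` is chosen afterwards so that the other part is at most `ε`.
  set μ : ℝ := (1 + ‖A‖ * Real.exp (C * t) / δ) / (2 * ε) with hμ
  have hμ0 : 0 < μ := by positivity
  have hμ1 : ‖A‖ * (Real.exp (C * t) / δ) / (2 * μ) ≤ ε := by
    rw [div_le_iff₀ (by positivity), hμ]
    have : ε * (2 * ((1 + ‖A‖ * Real.exp (C * t) / δ) / (2 * ε))) =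
        1 + ‖A‖ * Real.exp (C * t) / δ := by
      field_simp
    rw [this, mul_div_assoc]
    linarith
  obtain ⟨ε₀, hε₀, hε1, hε2, hε3, hε4⟩ : ∃ ε₀ : ℝ, 0 < ε₀ ∧ ε₀ * CA ≤ 1 ∧
      ε₀ * (CA * C) ≤ C - CA ∧ C * ε₀ ≤ ε ∧ ‖A‖ * μ * ε₀ ≤ 2 * ε := by
    have key : ∀ a b : ℝ, 0 ≤ a → 0 < b → ∀ᶠ e in nhdsWithin (0 : ℝ) (Ioi 0), e * a ≤ b := by
      intro a b ha hb
      have : Filter.Tendsto (fun e : ℝ => e * a) (nhdsWithin 0 (Ioi 0)) (nhds 0) := by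
        have h : Continuous fun e : ℝ => e * a := by fun_prop
        simpa using (h.tendsto 0).mono_left nhdsWithin_le_nhds
      exact (this.eventually (gt_mem_nhds hb)).mono fun e he => le_of_lt he
    obtain ⟨e, h1, h2, h3, h4, h5⟩ := ((key CA 1 hCA one_pos).and ((key (CA * C) (C - CA)
      (by positivity) (sub_pos.2 hC)).and ((key C ε hC0.le hε).and
      ((key (‖A‖ * μ) (2 * ε) (by positivity) (by positivity)).and self_mem_nhdsWithin)))).exists
    exact ⟨e, h5, h1, h2, by rwa [mul_comm], by rwa [mul_comm]⟩
  -- Viewing the family as one function with values in a product gives a common partition.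
  have hvpi : MemLp (fun r a => v a r) 2 (leb t) := memLp_pi_iff.2 hv
  obtain ⟨n, s, hs0, hsn, hlt, hmesh, hsN, herr⟩ := exists_partition ht hvpi hN htN hε₀
  obtain ⟨R, W, hR, hW, hid⟩ := hA.exists_euler hδ (η := ε) hC0.le s hs0 n hlt fun i hi => by
    have h0 : 0 ≤ s (i + 1) - s i := (sub_pos.2 (hlt i hi)).le
    have h1 : (s (i + 1) - s i) * CA ≤ 1 :=
      (mul_le_mul_of_nonneg_right (hmesh i hi).le hCA).trans hε1
    refine ⟨h1, one_le_one_sub_mul_exp h0 ((mul_le_mul_of_nonneg_right (hmesh i hi).le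
      (by positivity)).trans hε2) h1, ?_⟩
    exact (mul_le_mul_of_nonneg_left (hmesh i hi).le hC0.le).trans hε3
  rw [hsn] at hR hW hid
  refine ⟨R, W, hR, hW, fun a c => ?_⟩
  have hle : ∀ i ≤ n, ∀ j ≤ i, s j ≤ s i := by
    intro i hi j hj
    induction i with
    | zero => rw [Nat.le_zero.1 hj]
    | succ i ihi =>
      rcases Nat.lt_or_ge j (i + 1) with h | h
      · exact (ihi (by omega) (by omega)).trans (hlt i (by omega)).le
      · rw [show j = i + 1 by omega]
  have hsI : ∀ i ≤ n, s i ∈ Icc 0 t := fun i hi =>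
    ⟨hs0 ▸ hle i hi 0 (Nat.zero_le _), hsn ▸ hle n le_rfl i hi⟩
  have hss : ∀ i < n, uIcc (s i) (s (i + 1)) ⊆ uIcc 0 t := by
    intro i hi
    rw [uIcc_of_le (hlt i hi).le, uIcc_of_le ht.le]
    exact Icc_subset_Icc (hsI i hi.le).1 (hsI (i + 1) hi).2
  have hvi : IntervalIntegrable (v a) volume 0 t := by
    rw [intervalIntegrable_iff_integrableOn_Ioo_of_le ht.le]
    exact (hv a).integrable (by norm_num)
  have hAv : IntervalIntegrable (fun r => A (v a r)) volume 0 t := by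
    rw [intervalIntegrable_iff] at hvi ⊢
    exact A.integrable_comp hvi
  have huN : ∀ i < n, u a (s (i + 1)) = toDual ι (ι (v a (s (i + 1)))) := fun i hi =>
    huv a _ ⟨(hsI i hi.le).1.trans_lt (hlt i hi), (hsI (i + 1) hi).2⟩ (hsN i hi)
  have hmain := hid (fun i => if i = 0 then x a else ι (v a (s i))) (v a) (f a) (u a)
    (fun i hi => by simp) (fun i hi => by
      rcases i with _ | i
      · rw [hs0, hu a 0 ⟨le_rfl, ht.le⟩]
        simp
      · simpa using huN i (by omega))
    (fun i hi => hAv.mono_set (hss i hi)) (fun i hi => (hf a).mono_set (hss i hi)) (fun i hi => by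
      rw [hu a _ (hsI (i + 1) hi), hu a _ (hsI i hi.le), add_assoc,
        intervalIntegral.integral_add_adjacent_intervals]
      · refine (hAv.add (hf a)).mono_set ?_
        rw [uIcc_of_le (hsI i hi.le).1, uIcc_of_le ht.le]
        exact Icc_subset_Icc_right (hsI i hi.le).2
      · exact (hAv.add (hf a)).mono_set (hss i hi)) c
  have hn0 : n ≠ 0 := by
    rintro rfl
    rw [hs0] at hsn
    exact ht.ne hsn
  simp only [hn0, if_false, if_true, hsn] at hmain
  rw [hmain, show ∀ p q r : ℝ, p + q + r - p - q = r from fun p q r => by ring]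
  set D : ℕ → ℝ → ℝ := fun i r => ‖(fun a => v a r) - fun a => v a (s (i + 1))‖ ^ 2 with hD
  have hDi : ∀ i < n, IntervalIntegrable (D i) volume (s i) (s (i + 1)) := fun i hi =>
    (MemLp.intervalIntegrable_norm_sq ht.le
      (hvpi.sub (memLp_const (fun a => v a (s (i + 1)))))).mono_set (hss i hi)
  have hpiece : ∀ i ∈ Finset.range n,
      |∫ r in (s i)..(s (i + 1)), A (v a r - v a (s (i + 1))) (R r c)| ≤
        ‖A‖ * μ / 2 * (∫ r in (s i)..(s (i + 1)), D i r) +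
          ‖A‖ / (2 * μ) * ∫ r in (s i)..(s (i + 1)), ‖R r c‖ ^ 2 := by
    intro i hi
    have hi := Finset.mem_range.1 hi
    rw [← intervalIntegral.integral_const_mul, ← intervalIntegral.integral_const_mul,
      ← intervalIntegral.integral_add ((hDi i hi).const_mul _)
        ((simpleFunc_apply_integrable R c _ _).const_mul _), ← Real.norm_eq_abs]
    refine intervalIntegral.norm_integral_le_of_norm_le (hlt i hi).le (ae_of_all _ fun r _ => ?_)
      (((hDi i hi).const_mul _).add ((simpleFunc_apply_integrable R c _ _).const_mul _))
    have h1 : ‖v a r - v a (s (i + 1))‖ ^ 2 ≤ D i r :=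
      pow_le_pow_left₀ (norm_nonneg _)
        (norm_le_pi_norm ((fun a => v a r) - fun a => v a (s (i + 1))) a) 2
    have h2 : ‖A (v a r - v a (s (i + 1))) (R r c)‖ ≤
        ‖A‖ * (‖v a r - v a (s (i + 1))‖ * ‖R r c‖) := by
      rw [← mul_assoc]
      exact A.le_opNorm₂ _ _
    have h3 : ‖v a r - v a (s (i + 1))‖ * ‖R r c‖ ≤ μ / 2 * D i r + 1 / (2 * μ) * ‖R r c‖ ^ 2 := by
      have h4 : 0 ≤ (μ * ‖v a r - v a (s (i + 1))‖ - ‖R r c‖) ^ 2 / (2 * μ) := by positivity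
      have h5 : (μ * ‖v a r - v a (s (i + 1))‖ - ‖R r c‖) ^ 2 / (2 * μ) =
          μ / 2 * ‖v a r - v a (s (i + 1))‖ ^ 2 + 1 / (2 * μ) * ‖R r c‖ ^ 2 -
            ‖v a r - v a (s (i + 1))‖ * ‖R r c‖ := by
        field_simp
        ring
      have h6 := mul_le_mul_of_nonneg_left h1 (by positivity : 0 ≤ μ / 2)
      linarith
    refine h2.trans ((mul_le_mul_of_nonneg_left h3 (norm_nonneg A)).trans_eq ?_)
    ring
  refine (Finset.abs_sum_le_sum_abs _ _).trans ((Finset.sum_le_sum hpiece).trans ?_)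
  rw [Finset.sum_add_distrib, ← Finset.mul_sum, ← Finset.mul_sum,
    intervalIntegral.sum_integral_adjacent_intervals
      (fun i _ => simpleFunc_apply_integrable R c _ _), hs0, hsn]
  have h1 : ‖A‖ * μ / 2 * (∑ i ∈ Finset.range n, ∫ r in (s i)..(s (i + 1)), D i r) ≤ ε := by
    have := mul_le_mul_of_nonneg_left herr.le (by positivity : 0 ≤ ‖A‖ * μ / 2)
    linarith
  have h2 : ∫ r in (0)..t, ‖R r c‖ ^ 2 ≤ Real.exp (C * t) / δ * ‖c‖ ^ 2 := by
    rw [div_mul_eq_mul_div, le_div_iff₀ hδ]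
    have := hW c
    nlinarith [sq_nonneg ‖W c‖]
  have h3 := mul_le_mul_of_nonneg_left h2 (by positivity : 0 ≤ ‖A‖ / (2 * μ))
  have h4 := mul_le_mul_of_nonneg_right hμ1 (sq_nonneg ‖c‖)
  have h5 : ‖A‖ / (2 * μ) * (Real.exp (C * t) / δ * ‖c‖ ^ 2) =
      ‖A‖ * (Real.exp (C * t) / δ) / (2 * μ) * ‖c‖ ^ 2 := by ring
  linarith

end Euler

/-! ### The block diagonal noise kernel. -/

section Kernel

variable {T : ℝ} {m : ℕ × ℕ → ℝ → ℝ}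

/-- The derivative of the block diagonal Gram matrix of the functions `m_{kℓ}`. -/
def noiseKernel (m : ℕ × ℕ → ℝ → ℝ) (p q : ℕ × ℕ) (s : ℝ) : ℝ :=
  if p.2 = q.2 then m p s * m q s else 0

/-- At a fixed time each block of fixed `ℓ` has rank one, so the form is a sum of squares over `ℓ`.
-/
theorem sum_noiseKernel {V : Type*} [AddCommGroup V] [Module ℝ V] (S : Finset (ℕ × ℕ)) (s : ℝ)
    (β : LinearMap.BilinForm ℝ V) (x : ℕ × ℕ → V) :
    ∑ p ∈ S, ∑ q ∈ S, noiseKernel m p q s * β (x p) (x q) =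
      ∑ ℓ ∈ S.image Prod.snd, β (∑ p ∈ S with p.2 = ℓ, m p s • x p)
        (∑ p ∈ S with p.2 = ℓ, m p s • x p) := by
  rw [← Finset.sum_fiberwise_of_maps_to (t := S.image Prod.snd) (g := Prod.snd)
    fun p hp => Finset.mem_image_of_mem _ hp]
  refine Finset.sum_congr rfl fun ℓ _ => ?_
  rw [LinearMap.map_sum₂]
  refine Finset.sum_congr rfl fun p hp => ?_
  rw [map_sum, Finset.sum_filter]
  refine Finset.sum_congr rfl fun q _ => ?_
  simp only [map_smul, LinearMap.smul_apply, smul_eq_mul]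
  have h1 := (Finset.mem_filter.1 hp).2
  by_cases h2 : q.2 = ℓ
  · rw [if_pos h2, noiseKernel, if_pos (h1.trans h2.symm)]
    ring
  · rw [if_neg h2, noiseKernel, if_neg (by rw [h1]; exact fun h => h2 h.symm), zero_mul]

theorem intervalIntegrable_noiseKernel (hT : 0 ≤ T) (hm : ∀ p, MemLp (m p) 2 (leb T))
    (p q : ℕ × ℕ) : IntervalIntegrable (noiseKernel m p q) volume 0 T := by
  by_cases h : p.2 = q.2
  · have : noiseKernel m p q = fun s => m p s * m q s := by
      ext s
      rw [noiseKernel, if_pos h]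
    rw [this, intervalIntegrable_iff_integrableOn_Ioo_of_le hT]
    exact (hm p).integrable_mul (hm q)
  · have : noiseKernel m p q = fun _ => 0 := by
      ext s
      rw [noiseKernel, if_neg h]
    rw [this]
    exact intervalIntegrable_const

theorem psdOn_gramAt_noiseKernel (hm : ∀ p, MemLp (m p) 2 (leb T)) {t : ℝ} (ht : t ∈ Icc 0 T)
    (S : Finset (ℕ × ℕ)) : PSDOn S (gramAt (noiseKernel m) t) := by
  refine ⟨fun p q => ?_, fun c => ?_⟩
  · refine intervalIntegral.integral_congr fun s _ => ?_
    simp only [noiseKernel, eq_comm (a := p.2), mul_comm (m p s)]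
  · have hi : ∀ p q, IntervalIntegrable (fun s => noiseKernel m p q s * (c p * c q)) volume 0 t :=
      fun p q => (intervalIntegrable_sub (fun p q =>
        intervalIntegrable_noiseKernel (ht.1.trans ht.2) hm p q) ht p q).mul_const _
    simp only [gramAt, ← intervalIntegral.integral_mul_const]
    rw [← intervalIntegral_sum_sum S S hi]
    refine intervalIntegral.integral_nonneg ht.1 fun s _ => ?_
    have h := sum_noiseKernel (m := m) S s (LinearMap.mul ℝ ℝ) c
    simp only [LinearMap.mul_apply'] at h
    rw [h]
    exact Finset.sum_nonneg fun ℓ _ => mul_self_nonneg _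

end Kernel

/-! ### The induction step from order `k` to order `k + 1`. -/

section Step

variable {X H : Type*} [NormedAddCommGroup X] [InnerProductSpace ℝ X]
  [NormedAddCommGroup H] [InnerProductSpace ℝ H]
  {ι : X →L[ℝ] H} {A : X →L[ℝ] StrongDual ℝ X} {δ CA T : ℝ} {m : ℕ × ℕ → ℝ → ℝ}
  {N : Set ℝ}

/-- The pairing of families indexed by multi-indices of length `k` supported in `S`. -/
noncomputable abbrev pairForm (H : Type*) [NormedAddCommGroup H] [InnerProductSpace ℝ H]
    (S : Finset (ℕ × ℕ)) (k : ℕ) : LinearMap.BilinForm ℝ (MultiIndex → H) :=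
  tensorForm S (idMatrix (ℕ × ℕ)) (innerₗ H) k

/-- The form induced by the Gram matrix on `(0, t)` of the functions `m_{kℓ}`. -/
noncomputable abbrev noiseForm (H : Type*) [NormedAddCommGroup H] [InnerProductSpace ℝ H]
    (S : Finset (ℕ × ℕ)) (m : ℕ × ℕ → ℝ → ℝ) (t : ℝ) (k : ℕ) :
    LinearMap.BilinForm ℝ (MultiIndex → H) :=
  tensorForm S (gramAt (noiseKernel m) t) (innerₗ H) k

theorem noiseForm_comp_le (hm : ∀ p, MemLp (m p) 2 (leb T)) {t : ℝ} (ht : t ∈ Icc 0 T)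
    (S : Finset (ℕ × ℕ)) (k : ℕ) {L : H →L[ℝ] H} {lam : ℝ}
    (hL : ∀ x, ‖L x‖ ^ 2 ≤ lam * ‖x‖ ^ 2) (D : MultiIndex → H) :
    noiseForm H S m t k (fun α => L (D α)) (fun α => L (D α)) ≤
      lam * noiseForm H S m t k D D := by
  have h1 := tensorForm_comp S (gramAt (noiseKernel m) t) (innerₗ H) L.toLinearMap L.toLinearMap
    k D D
  rw [← tensorForm_smul_right]
  refine h1.trans_le ?_
  have hpsd := psdOn_gramAt_noiseKernel hm ht S
  refine tensorForm_mono hpsd hpsd ?_ (fun x => ?_) (fun x => ?_) k D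
  · rw [sub_self]
    exact ⟨fun _ _ => rfl, fun c => by simp⟩
  · simp
  · simpa using hL x

/-- Apply the hypothesis to `λ⁻¹ L D` and multiply by `λ`. The growth of `L` then falls on the
constant `a`, and the quadratic term keeps coefficient one, as the induction requires. -/
theorem two_mul_pairForm_comp_le (hm : ∀ p, MemLp (m p) 2 (leb T)) {t : ℝ} (ht : t ∈ Icc 0 T)
    (S : Finset (ℕ × ℕ)) (k : ℕ) {Y : MultiIndex → H} {a : ℝ}
    (hP : ∀ D, 2 * pairForm H S k D Y ≤ a + noiseForm H S m t k D D)
    {L : H →L[ℝ] H} {lam : ℝ} (hlam : 0 ≤ lam)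
    (hL : ∀ x, ‖L x‖ ^ 2 ≤ lam * ‖x‖ ^ 2) (D : MultiIndex → H) :
    2 * pairForm H S k (fun α => L (D α)) Y ≤ lam * a + noiseForm H S m t k D D := by
  have hpos : 0 ≤ noiseForm H S m t k D D :=
    tensorForm_nonneg (psdOn_gramAt_noiseKernel hm ht S) (fun x => by simp) k D
  -- For `λ = 0` the rescaling is unavailable, but then `L D = 0`.
  rcases hlam.eq_or_lt with h0 | h0
  · have : (fun α => L (D α)) = 0 := by
      ext α
      have := hL (D α)
      rw [← h0, zero_mul] at this
      have h2 : ‖L (D α)‖ = 0 := by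
        by_contra h
        have : 0 < ‖L (D α)‖ ^ 2 := by positivity
        linarith
      simpa using h2
    rw [this, ← h0]
    simpa using hpos
  · have h1 := hP (lam⁻¹ • fun α => L (D α))
    simp only [map_smul, LinearMap.smul_apply, smul_eq_mul] at h1
    have h2 := noiseForm_comp_le hm ht S k hL D
    have h3 := mul_le_mul_of_nonneg_left h2 (inv_nonneg.2 h0.le)
    rw [inv_mul_cancel_left₀ h0.ne'] at h3
    have h4 := mul_le_mul_of_nonneg_left h1 h0.le
    rw [mul_add, mul_inv_cancel_left₀ h0.ne', mul_left_comm lam 2,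
      mul_inv_cancel_left₀ h0.ne'] at h4
    linarith

/-- For fixed `ℓ` the weighted shifts add up to a single test tensor, to which the hypothesis
applies once. The resulting quadratic terms reassemble into the noise kernel. -/
theorem sum_pairForm_shift_le (S : Finset (ℕ × ℕ)) (k : ℕ) {s : ℝ} {L : H →L[ℝ] H} {lam : ℝ}
    {Z : ℕ → MultiIndex → H} {a : ℕ → ℝ}
    (hZ : ∀ ℓ D, 2 * pairForm H S k (fun α => L (D α)) (Z ℓ) ≤
      lam * a ℓ + noiseForm H S m s k D D) (C : MultiIndex → H) :
    2 * ∑ q ∈ S, pairForm H S k (shift H q fun α => L (C α)) (fun β => m q s • Z q.2 β) ≤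
      lam * ∑ ℓ ∈ S.image Prod.snd, a ℓ +
        ∑ p ∈ S, ∑ q ∈ S, noiseKernel m p q s *
          noiseForm H S m s k (shift H p C) (shift H q C) := by
  rw [sum_noiseKernel S s (noiseForm H S m s k) fun p => shift H p C,
    ← Finset.sum_fiberwise_of_maps_to (t := S.image Prod.snd) (g := Prod.snd)
    (fun p hp => Finset.mem_image_of_mem _ hp), Finset.mul_sum, Finset.mul_sum,
    ← Finset.sum_add_distrib]
  refine Finset.sum_le_sum fun ℓ _ => ?_
  refine le_trans (le_of_eq ?_) (hZ ℓ _)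
  congr 1
  have h1 : (fun α => L ((∑ p ∈ S with p.2 = ℓ, m p s • shift H p C) α)) =
      ∑ p ∈ S with p.2 = ℓ, m p s • shift H p fun α => L (C α) := by
    ext α
    simp [shift_apply]
  rw [h1, map_sum, LinearMap.sum_apply]
  refine Finset.sum_congr rfl fun p hp => ?_
  rw [(Finset.mem_filter.1 hp).2, map_smul, LinearMap.smul_apply,
    show (fun β => m p s • Z ℓ β) = m p s • Z ℓ from rfl, map_smul]

theorem intervalIntegrable_creation (hT : 0 ≤ T) (hm : ∀ p, MemLp (m p) 2 (leb T))
    {Z : ℕ → MultiIndex → ℝ → H} (hZ : ∀ ℓ β, MemLp (Z ℓ β) 2 (leb T)) (S : Finset (ℕ × ℕ))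
    (α : MultiIndex) :
    IntervalIntegrable (fun s => creation S (fun q β => m q s • Z q.2 β s) α) volume 0 T := by
  rw [intervalIntegrable_iff_integrableOn_Ioo_of_le hT]
  refine integrable_finsetSum _ fun q _ => Integrable.smul _ ?_
  have := (hZ q.2 (α - Finsupp.single q 1)).smul (hm q) (r := 1)
  exact memLp_one_iff_integrable.1 this

/-- Duality writes the pairing at time `t` as an integral of pairings with the creation term, which
drop to order `k`. The quadratic terms produced there integrate to exactly the form of order `k +
1`, so only the scalars `a` accumulate, with the growth factor of the dual evolution. -/
theorem StronglyParabolic.two_mul_pairForm_succ_le [CompleteSpace X] [CompleteSpace H]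
    (hA : StronglyParabolic ι A δ CA) (hδ : 0 < δ) (hCA : 0 ≤ CA) {C : ℝ} (hC : CA < C)
    (hN : volume N = 0) (hm : ∀ p, MemLp (m p) 2 (leb T)) (S : Finset (ℕ × ℕ)) (k : ℕ)
    {V : MultiIndex → ℝ → X} (hV : ∀ α, MemLp (V α) 2 (leb T))
    {U : MultiIndex → ℝ → StrongDual ℝ X}
    (hUV : ∀ α, ∀ r ∈ Ioo 0 T, r ∉ N → U α r = toDual ι (ι (V α r)))
    {Z : ℕ → MultiIndex → ℝ → H} (hZ : ∀ ℓ β, MemLp (Z ℓ β) 2 (leb T))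
    (hU : ∀ α ∈ S.finsuppAntidiag (k + 1), ∀ r ∈ Icc 0 T, U α r = ∫ s in (0)..r,
      (A (V α s) + toDual ι (creation S (fun q β => m q s • Z q.2 β s) α)))
    {a : ℕ → ℝ → ℝ} (ha : ∀ ℓ, IntervalIntegrable (a ℓ) volume 0 T)
    (hP : ∀ s ∈ Ioo 0 T, s ∉ N → ∀ (L : H →L[ℝ] H) (lam : ℝ), 0 ≤ lam →
      (∀ x, ‖L x‖ ^ 2 ≤ lam * ‖x‖ ^ 2) → ∀ ℓ D,
      2 * pairForm H S k (fun α => L (D α)) (fun β => Z ℓ β s) ≤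
        lam * a ℓ s + noiseForm H S m s k D D)
    {t : ℝ} (ht : t ∈ Ioo 0 T) (htN : t ∉ N) (D : MultiIndex → H) :
    2 * pairForm H S (k + 1) D (fun α => ι (V α t)) ≤
      (k + 1) * (∫ s in (0)..t, Real.exp (C * (t - s)) * ∑ ℓ ∈ S.image Prod.snd, a ℓ s) +
        noiseForm H S m t (k + 1) D D := by
  have hT : 0 ≤ T := ht.1.le.trans ht.2.le
  have htI : t ∈ Icc 0 T := ⟨ht.1.le, ht.2.le⟩
  have hsub : uIcc 0 t ⊆ uIcc 0 T := by
    rw [uIcc_of_le ht.1.le, uIcc_of_le hT]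
    exact Icc_subset_Icc_right ht.2.le
  have hleb : leb t ≤ leb T := Measure.restrict_mono (Ioo_subset_Ioo_right ht.2.le) le_rfl
  have hγ := intervalIntegrable_noiseKernel hT hm
  set g : MultiIndex → ℝ → H := fun α s => creation S (fun q β => m q s • Z q.2 β s) α with hg
  have hgi : ∀ α, IntervalIntegrable (g α) volume 0 t := fun α =>
    (intervalIntegrable_creation hT hm hZ S α).mono_set hsub
  have hfi : ∀ α, IntervalIntegrable (fun s => toDual ι (g α s)) volume 0 t := fun α =>
    ⟨(toDual ι).integrable_comp (hgi α).1, (toDual ι).integrable_comp (hgi α).2⟩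
  have hasum : IntervalIntegrable
      (fun s => Real.exp (C * (t - s)) * ∑ ℓ ∈ S.image Prod.snd, a ℓ s) volume 0 t := by
    refine ((intervalIntegrable_finset_sum _ fun ℓ _ => ha ℓ).mono_set hsub).continuousOn_mul ?_
    fun_prop
  set J := ∫ s in (0)..t, Real.exp (C * (t - s)) * ∑ ℓ ∈ S.image Prod.snd, a ℓ s with hJ
  set w : MultiIndex → ℝ := fun α => ((k + 1).factorial : ℝ) / ∏ p ∈ S, ((α p).factorial : ℝ)
    with hw
  have hw0 : ∀ α, 0 ≤ w α := fun α => by positivity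
  set E := ∑ α ∈ S.finsuppAntidiag (k + 1), w α * (1 + ‖D α‖ ^ 2) with hE
  have main : ∀ ε : ℝ, 0 < ε → 2 * pairForm H S (k + 1) D (fun α => ι (V α t)) ≤
      (k + 1) * (Real.exp ε * J) + noiseForm H S m t (k + 1) D D + 2 * (ε * E) := by
    intro ε hε
    obtain ⟨R, W, hR, -, hRW⟩ := hA.exists_dual_steps hδ hCA hC
      (κ := {α // α ∈ S.finsuppAntidiag (k + 1)}) ht.1 hN htN (v := fun α => V α)
      (fun α => (hV α).mono_measure hleb) (f := fun α s => toDual ι (g α s)) (u := fun α => U α)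
      (fun α => hfi α) (x := fun _ => 0)
      (fun α r hr => by
        rw [hU α α.2 r ⟨hr.1, hr.2.trans ht.2.le⟩, map_zero, zero_add])
      (fun α r hr hrN => hUV α r ⟨hr.1, hr.2.trans_lt ht.2⟩ hrN) hε
    have hint : ∀ α, IntervalIntegrable (fun s => inner ℝ (ι (R s (D α))) (g α s)) volume 0 t := by
      intro α
      have := intervalIntegrable_apply_simpleFunc (hfi α) R (D α)
      simpa only [toDual_apply, real_inner_comm] using this
    have h1 : pairForm H S (k + 1) D (fun α => ι (V α t)) ≤
        (∫ s in (0)..t, pairForm H S (k + 1) (fun α => ι (R s (D α))) (fun α => g α s)) +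
          ε * E := by
      simp only [pairForm, tensorForm_idMatrix_eq_sum, innerₗ_apply_apply]
      rw [intervalIntegral.integral_finsetSum fun α _ => (hint α).const_mul _, hE,
        Finset.mul_sum, ← Finset.sum_add_distrib]
      refine Finset.sum_le_sum fun α hα => ?_
      have h2 := (abs_le.1 (hRW ⟨α, hα⟩ (D α))).2
      simp only [inner_zero_left, sub_zero, toDual_apply] at h2
      rw [intervalIntegral.integral_const_mul]
      simp only [real_inner_comm (D α), real_inner_comm _ (ι (R _ (D α)))] at h2 ⊢
      have h3 := mul_le_mul_of_nonneg_left h2 (hw0 α)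
      simp only [hw] at h3 ⊢
      linarith
    have h4 : ∀ s, pairForm H S (k + 1) (fun α => ι (R s (D α))) (fun α => g α s) =
        (k + 1) * ∑ q ∈ S, pairForm H S k (shift H q fun α => ι (R s (D α)))
          (fun β => m q s • Z q.2 β s) := fun s => tensorForm_creation _ _ _ _ _
    have hI1 : IntervalIntegrable (fun s => pairForm H S (k + 1) (fun α => ι (R s (D α)))
        (fun α => g α s)) volume 0 t := by
      simp only [pairForm, tensorForm_idMatrix_eq_sum]
      exact intervalIntegrable_finset_sum _ fun α _ => (hint α).const_mul _
    have hI2 : IntervalIntegrable (fun s => ∑ p ∈ S, ∑ q ∈ S, noiseKernel m p q s *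
          noiseForm H S m s k (shift H p D) (shift H q D)) volume 0 t :=
      intervalIntegrable_finset_sum _ fun p _ => intervalIntegrable_finset_sum _ fun q _ =>
        intervalIntegrable_mul_tensorForm hγ htI _ _ _ _ _ _
    have h5 : 2 * (∫ s in (0)..t, pairForm H S (k + 1) (fun α => ι (R s (D α)))
        (fun α => g α s)) ≤ (k + 1) * (Real.exp ε * J) + noiseForm H S m t (k + 1) D D := by
      rw [noiseForm, tensorForm_gramAt_succ hγ _ _ _ _ htI, ← mul_add, hJ,
        ← intervalIntegral.integral_const_mul, ← intervalIntegral.integral_const_mul,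
        ← intervalIntegral.integral_add (hasum.const_mul _) hI2,
        ← intervalIntegral.integral_const_mul]
      refine intervalIntegral.integral_mono_ae_restrict ht.1.le (hI1.const_mul _)
        (((hasum.const_mul _).add hI2).const_mul _) ?_
      have hae : ∀ᵐ s ∂(volume.restrict (Icc 0 t)), s ∈ Ioo 0 t ∧ s ∉ N := by
        rw [← restrict_Ioo_eq_restrict_Icc]
        filter_upwards [ae_restrict_mem measurableSet_Ioo,
          ae_restrict_of_ae (measure_eq_zero_iff_ae_notMem.1 hN)] with s h1 h2 using ⟨h1, h2⟩
      filter_upwards [hae] with s hs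
      rw [h4]
      -- `L` is the dual evolution at time `s`, seen in `H`.
      have h6 := sum_pairForm_shift_le S k (L := ι ∘L R s) (lam := Real.exp (C * (t - s) + ε))
        (Z := fun ℓ β => Z ℓ β s) (a := fun ℓ => a ℓ s) (m := m) (s := s)
        (fun ℓ D' => hP s ⟨hs.1.1, hs.1.2.trans ht.2⟩ hs.2 (ι ∘L R s) _ (Real.exp_pos _).le
          (hR s ⟨hs.1.1, hs.1.2.le⟩) ℓ D') D
      rw [Real.exp_add] at h6
      have h7 := mul_le_mul_of_nonneg_left h6 (by positivity : (0 : ℝ) ≤ k + 1)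
      simp only [ContinuousLinearMap.comp_apply] at h7
      refine le_trans (le_of_eq (by ring)) (h7.trans (le_of_eq ?_))
      ring
    linarith
  have hlim : Filter.Tendsto (fun ε : ℝ => (k + 1) * (Real.exp ε * J) +
      noiseForm H S m t (k + 1) D D + 2 * (ε * E)) (nhdsWithin 0 (Ioi 0))
      (nhds ((k + 1) * (Real.exp 0 * J) + noiseForm H S m t (k + 1) D D + 2 * (0 * E))) := by
    refine tendsto_nhdsWithin_of_tendsto_nhds (Continuous.tendsto ?_ 0)
    fun_prop
  have := ge_of_tendsto hlim (by filter_upwards [self_mem_nhdsWithin] with ε hε using main ε hε)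
  simpa using this

end Step

/-! ### Energy estimate for the coefficient of order zero. -/

section Energy

variable {X H : Type*} [NormedAddCommGroup X] [InnerProductSpace ℝ X] [CompleteSpace X]
  [NormedAddCommGroup H] [InnerProductSpace ℝ H] [CompleteSpace H]
  {ι : X →L[ℝ] H} {A : X →L[ℝ] StrongDual ℝ X} {δ CA T : ℝ} {N : Set ℝ}

/-- Duality is tested with `c = y`, the solution itself. Young's inequality with weight `μ = e^{Ct}`
leaves `μ⁻¹ (‖W y‖² + δ ∫ ‖R y‖²)`, which is at most `‖y‖²` and is absorbed on the left. -/
theorem StronglyParabolic.norm_sq_le (hA : StronglyParabolic ι A δ CA) (hδ : 0 < δ)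
    (hCA : 0 ≤ CA) {C : ℝ} (hC : CA < C) {t : ℝ} (ht : 0 < t) (hN : volume N = 0) (htN : t ∉ N)
    {v : ℝ → X} (hv : MemLp v 2 (leb t)) {f u : ℝ → StrongDual ℝ X} (hf : MemLp f 2 (leb t))
    {x : H} (hu : ∀ r ∈ Icc 0 t, u r = toDual ι x + ∫ s in (0)..r, (A (v s) + f s))
    (huv : ∀ r ∈ Ioc 0 t, r ∉ N → u r = toDual ι (ι (v r))) :
    ‖ι (v t)‖ ^ 2 ≤ Real.exp (C * t) * (‖x‖ ^ 2 + δ⁻¹ * ∫ s in (0)..t, ‖f s‖ ^ 2) := by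
  have hfi : IntervalIntegrable f volume 0 t := by
    rw [intervalIntegrable_iff_integrableOn_Ioo_of_le ht.le]
    exact hf.integrable (by norm_num)
  have hf2 := MemLp.intervalIntegrable_norm_sq ht.le hf
  set y := ι (v t) with hy
  set μ := Real.exp (C * t) with hμ
  have hμ0 : 0 < μ := Real.exp_pos _
  have main : ∀ ε : ℝ, 0 < ε → 2 * ‖y‖ ^ 2 ≤
      μ * (‖x‖ ^ 2 + δ⁻¹ * ∫ s in (0)..t, ‖f s‖ ^ 2) + ‖y‖ ^ 2 + 2 * (ε * (1 + ‖y‖ ^ 2)) := by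
    intro ε hε
    obtain ⟨R, W, -, hW, hRW⟩ := hA.exists_dual_steps hδ hCA hC
      (κ := Unit) ht hN htN (v := fun _ => v) (fun _ => hv) (f := fun _ => f) (u := fun _ => u)
      (fun _ => hfi) (x := fun _ => x) (fun _ => hu) (fun _ => huv) hε
    have h1 := (abs_le.1 (hRW () y)).2
    rw [← hy, real_inner_self_eq_norm_sq] at h1
    have h2 : 2 * inner ℝ x (W y) ≤ μ * ‖x‖ ^ 2 + μ⁻¹ * ‖W y‖ ^ 2 := by
      have h3 := real_inner_le_norm x (W y)
      have h4 : 0 ≤ μ⁻¹ * (μ * ‖x‖ - ‖W y‖) ^ 2 := by positivity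
      have h5 : μ⁻¹ * (μ * ‖x‖ - ‖W y‖) ^ 2 =
          μ * ‖x‖ ^ 2 - 2 * (‖x‖ * ‖W y‖) + μ⁻¹ * ‖W y‖ ^ 2 := by
        field_simp
        ring
      linarith
    have h6 : 2 * (∫ r in (0)..t, f r (R r y)) ≤
        μ * δ⁻¹ * (∫ s in (0)..t, ‖f s‖ ^ 2) + μ⁻¹ * δ * ∫ s in (0)..t, ‖R s y‖ ^ 2 := by
      have hR2 := simpleFunc_apply_integrable R y 0 t
      rw [← intervalIntegral.integral_const_mul, ← intervalIntegral.integral_const_mul,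
        ← intervalIntegral.integral_const_mul,
        ← intervalIntegral.integral_add (hf2.const_mul _) (hR2.const_mul _)]
      refine intervalIntegral.integral_mono_on ht.le
        ((intervalIntegrable_apply_simpleFunc hfi R y).const_mul _)
        ((hf2.const_mul _).add (hR2.const_mul _)) fun s _ => ?_
      have h3 := (le_abs_self _).trans ((f s).le_opNorm (R s y))
      have h4 : 0 ≤ μ⁻¹ * δ * (μ * δ⁻¹ * ‖f s‖ - ‖R s y‖) ^ 2 := by positivity
      have h5 : μ⁻¹ * δ * (μ * δ⁻¹ * ‖f s‖ - ‖R s y‖) ^ 2 =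
          μ * δ⁻¹ * ‖f s‖ ^ 2 - 2 * (‖f s‖ * ‖R s y‖) + μ⁻¹ * δ * ‖R s y‖ ^ 2 := by
        field_simp
        ring
      linarith
    have h7 := mul_le_mul_of_nonneg_left (hW y) (inv_nonneg.2 hμ0.le)
    rw [← hμ, inv_mul_cancel_left₀ hμ0.ne'] at h7
    linarith
  have hlim : Filter.Tendsto (fun ε : ℝ => μ * (‖x‖ ^ 2 + δ⁻¹ * ∫ s in (0)..t, ‖f s‖ ^ 2) +
      ‖y‖ ^ 2 + 2 * (ε * (1 + ‖y‖ ^ 2))) (nhdsWithin 0 (Ioi 0))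
      (nhds (μ * (‖x‖ ^ 2 + δ⁻¹ * ∫ s in (0)..t, ‖f s‖ ^ 2) +
      ‖y‖ ^ 2 + 2 * (0 * (1 + ‖y‖ ^ 2)))) := by
    refine tendsto_nhdsWithin_of_tendsto_nhds (Continuous.tendsto ?_ 0)
    fun_prop
  have := ge_of_tendsto hlim (by filter_upwards [self_mem_nhdsWithin] with ε hε using main ε hε)
  linarith

end Energy

/-! ### The bound for all orders. -/

section Induction

variable {X H : Type*} [NormedAddCommGroup X] [InnerProductSpace ℝ X]
  [NormedAddCommGroup H] [InnerProductSpace ℝ H]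
  {ι : X →L[ℝ] H} {A : X →L[ℝ] StrongDual ℝ X} {δ CA T : ℝ} {m : ℕ × ℕ → ℝ → ℝ}
  {N : Set ℝ}

/-- The bound for the chaos coefficients of order `j + 1` at time `t`. -/
noncomputable def chaosBound (θ C c D Γ : ℝ) (j : ℕ) (t : ℝ) : ℝ :=
  θ * (Real.exp (C * t) * ((c * t) ^ (j + 1) / ((j + 1).factorial : ℝ) * D +
    (c * t) ^ j / (j.factorial : ℝ) * Γ))

theorem continuous_chaosBound (θ C c D Γ : ℝ) (j : ℕ) :
    Continuous (chaosBound θ C c D Γ j) := by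
  unfold chaosBound
  fun_prop

theorem chaosBound_nonneg {θ C c D Γ : ℝ} (hθ : 0 ≤ θ) (hc : 0 ≤ c) (hD : 0 ≤ D) (hΓ : 0 ≤ Γ)
    (j : ℕ) {t : ℝ} (ht : 0 ≤ t) : 0 ≤ chaosBound θ C c D Γ j t := by
  unfold chaosBound
  positivity

/-- The exponentials combine to `e^{Ct}`, and integrating the powers of `s` advances both factorials
by one. -/
theorem integral_chaosBound (θ C c D Γ : ℝ) (j : ℕ) (t : ℝ) :
    ∫ s in (0)..t, Real.exp (C * (t - s)) * (c * chaosBound θ C c D Γ j s) =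
      chaosBound θ C c D Γ (j + 1) t := by
  have h1 : ∀ s, Real.exp (C * (t - s)) * (c * chaosBound θ C c D Γ j s) =
      θ * Real.exp (C * t) * (c ^ (j + 2) * D / ((j + 1).factorial : ℝ) * s ^ (j + 1) +
        c ^ (j + 1) * Γ / (j.factorial : ℝ) * s ^ j) := by
    intro s
    have : Real.exp (C * t) = Real.exp (C * (t - s)) * Real.exp (C * s) := by
      rw [← Real.exp_add]
      ring_nf
    rw [this, chaosBound]
    ring
  simp_rw [h1]
  rw [intervalIntegral.integral_const_mul, intervalIntegral.integral_add
    (Continuous.intervalIntegrable (by fun_prop) _ _)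
    (Continuous.intervalIntegrable (by fun_prop) _ _), intervalIntegral.integral_const_mul,
    intervalIntegral.integral_const_mul, integral_pow, integral_pow, chaosBound,
    Nat.factorial_succ (j + 1), Nat.factorial_succ j, zero_pow (Nat.succ_ne_zero _),
    zero_pow (Nat.succ_ne_zero _)]
  have := Nat.factorial_ne_zero j
  push_cast
  field_simp
  ring

theorem pairForm_zero (S : Finset (ℕ × ℕ)) (C D : MultiIndex → H) :
    pairForm H S 0 C D = inner ℝ (C 0) (D 0) := by
  simp [pairForm, tensorForm_zero]

theorem noiseForm_zero (S : Finset (ℕ × ℕ)) (t : ℝ) (C D : MultiIndex → H) :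
    noiseForm H S m t 0 C D = inner ℝ (C 0) (D 0) := by
  simp [noiseForm, tensorForm_zero]

theorem two_mul_pairForm_zero_le (S : Finset (ℕ × ℕ)) (t : ℝ) {Y : MultiIndex → H} {a : ℝ}
    (ha : ‖Y 0‖ ^ 2 ≤ a) (D : MultiIndex → H) :
    2 * pairForm H S 0 D Y ≤ a + noiseForm H S m t 0 D D := by
  rw [pairForm_zero, noiseForm_zero, real_inner_self_eq_norm_sq]
  have := real_inner_le_norm (D 0) (Y 0)
  nlinarith [sq_nonneg (‖D 0‖ - ‖Y 0‖)]

theorem pairForm_comp_adjoint [CompleteSpace H] (S : Finset (ℕ × ℕ)) (k : ℕ) (b : H →L[ℝ] H)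
    (C D : MultiIndex → H) :
    pairForm H S k (fun α => b.adjoint (C α)) D = pairForm H S k C (fun α => b (D α)) := by
  simp only [pairForm, tensorForm_idMatrix_eq_sum, innerₗ_apply_apply,
    ContinuousLinearMap.adjoint_inner_left]

theorem pairForm_congr_right (S : Finset (ℕ × ℕ)) (k : ℕ) (C : MultiIndex → H)
    {D D' : MultiIndex → H} (h : ∀ α, α.degree = k → D α = D' α) :
    pairForm H S k C D = pairForm H S k C D' := by
  simp only [pairForm, tensorForm_idMatrix_eq_sum]
  refine Finset.sum_congr rfl fun α hα => ?_
  rw [h α]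
  obtain ⟨h1, h2⟩ := Finset.mem_finsuppAntidiag.1 hα
  rw [← h1, Finsupp.degree]
  exact Finset.sum_subset h2 fun p _ hp => Finsupp.notMem_support_iff.1 hp

/-- Iteration of the induction step. The first order is driven by `b V_0 + g`, whose size costs the
factor `θ`. Later orders see only `b V_β`, so `θ` enters once. -/
theorem two_mul_pairForm_le_chaosBound [CompleteSpace X] [CompleteSpace H]
    (hA : StronglyParabolic ι A δ CA) (hδ : 0 < δ)
    (hCA : 0 ≤ CA) {C : ℝ} (hC : CA < C) (hN : volume N = 0)
    (hm : ∀ p, MemLp (m p) 2 (leb T))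
    {V : MultiIndex → ℝ → X} (hV : ∀ α, MemLp (V α) 2 (leb T))
    {U : MultiIndex → ℝ → StrongDual ℝ X}
    (hUV : ∀ α, ∀ r ∈ Ioo 0 T, r ∉ N → U α r = toDual ι (ι (V α r)))
    {b : ℕ → H →L[ℝ] H} {g : ℕ → ℝ → H} (hg : ∀ ℓ, MemLp (g ℓ) 2 (leb T))
    (hU : ∀ α ≠ 0, ∀ S : Finset (ℕ × ℕ), α.support ⊆ S → ∀ r ∈ Icc 0 T,
      U α r = ∫ s in (0)..r, (A (V α s) + toDual ι (creation S (fun q β =>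
        m q s • (b q.2 (ι (V β s)) + if β = 0 then g q.2 s else 0)) α)))
    {θ c D Γ : ℝ} (hθ : 0 ≤ θ) (hD : 0 ≤ D) (hΓ0 : 0 ≤ Γ)
    (hc : ∀ L : Finset ℕ, ∑ ℓ ∈ L, ‖b ℓ‖ ^ 2 ≤ c)
    (hΓ : ∀ L : Finset ℕ, ∑ ℓ ∈ L, ∫ s in (0)..T, ‖g ℓ s‖ ^ 2 ≤ Γ)
    (hθb : ∀ s ∈ Ioo 0 T, s ∉ N → ∀ ℓ, ‖b ℓ (ι (V 0 s)) + g ℓ s‖ ^ 2 ≤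
      θ * (‖b ℓ‖ ^ 2 * (Real.exp (C * s) * D) + ‖g ℓ s‖ ^ 2))
    (S : Finset (ℕ × ℕ)) (j : ℕ) {t : ℝ} (ht : t ∈ Ioo 0 T) (htN : t ∉ N)
    (D' : MultiIndex → H) :
    2 * pairForm H S (j + 1) D' (fun α => ι (V α t)) ≤
      (j + 1).factorial * chaosBound θ C c D Γ j t + noiseForm H S m t (j + 1) D' D' := by
  have hT : 0 ≤ T := ht.1.le.trans ht.2.le
  have hC0 : 0 ≤ C := hCA.trans hC.le
  have hc0 : 0 ≤ c := (Finset.sum_nonneg fun ℓ _ => by positivity).trans (hc ∅)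
  set Z : ℕ → MultiIndex → ℝ → H := fun ℓ β s => b ℓ (ι (V β s)) + if β = 0 then g ℓ s else 0
    with hZdef
  have hZ : ∀ ℓ β, MemLp (Z ℓ β) 2 (leb T) := by
    intro ℓ β
    refine MemLp.add ((b ℓ ∘L ι).comp_memLp' (hV β)) ?_
    by_cases hβ : β = 0
    · simpa only [hβ, if_true] using hg ℓ
    · simp [hβ]
  have hU' : ∀ k, ∀ α ∈ S.finsuppAntidiag (k + 1), ∀ r ∈ Icc 0 T, U α r = ∫ s in (0)..r,
      (A (V α s) + toDual ι (creation S (fun q β => m q s • Z q.2 β s) α)) := by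
    intro k α hα
    obtain ⟨h1, h2⟩ := Finset.mem_finsuppAntidiag.1 hα
    refine hU α ?_ S h2
    rintro rfl
    simp at h1
  induction j generalizing t D' with
  | zero =>
    set a : ℕ → ℝ → ℝ := fun ℓ s => θ * (‖b ℓ‖ ^ 2 * (Real.exp (C * s) * D) + ‖g ℓ s‖ ^ 2)
      with ha
    have hg2 : ∀ ℓ, IntervalIntegrable (fun s => ‖g ℓ s‖ ^ 2) volume 0 T := fun ℓ =>
      MemLp.intervalIntegrable_norm_sq hT (hg ℓ)
    have hai : ∀ ℓ, IntervalIntegrable (a ℓ) volume 0 T := fun ℓ =>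
      ((Continuous.intervalIntegrable (by fun_prop) _ _).add (hg2 ℓ)).const_mul _
    have h1 := hA.two_mul_pairForm_succ_le hδ hCA hC hN hm S 0 hV hUV hZ (hU' 0) hai
      (fun s hs hsN L lam hlam hL ℓ D'' => two_mul_pairForm_comp_le hm ⟨hs.1.le, hs.2.le⟩ S 0
        (fun D₀ => two_mul_pairForm_zero_le S s (by simpa [hZdef, ha] using hθb s hs hsN ℓ) D₀)
        hlam hL D'') ht htN D'
    refine h1.trans (add_le_add ?_ le_rfl)
    have hsub : uIcc 0 t ⊆ uIcc 0 T := by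
      rw [uIcc_of_le ht.1.le, uIcc_of_le hT]
      exact Icc_subset_Icc_right ht.2.le
    have hle : (∫ s in (0)..t, Real.exp (C * (t - s)) * ∑ ℓ ∈ S.image Prod.snd, a ℓ s) ≤
        ∫ s in (0)..t, θ * (Real.exp (C * t) * (c * D +
          ∑ ℓ ∈ S.image Prod.snd, ‖g ℓ s‖ ^ 2)) := by
      have hsg : IntervalIntegrable (fun s => ∑ ℓ ∈ S.image Prod.snd, ‖g ℓ s‖ ^ 2) volume 0 t :=
        intervalIntegrable_finset_sum _ fun ℓ _ => (hg2 ℓ).mono_set hsub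
      refine intervalIntegral.integral_mono_on ht.1.le
        ((intervalIntegrable_finset_sum _ fun ℓ _ => (hai ℓ).mono_set hsub).continuousOn_mul
          (by fun_prop)) (((intervalIntegrable_const.add hsg).const_mul _).const_mul _)
        fun s hs => ?_
      have h2 : Real.exp (C * t) = Real.exp (C * (t - s)) * Real.exp (C * s) := by
        rw [← Real.exp_add]
        ring_nf
      -- Lets the contribution of `g` share the factor `e^{Ct}`.
      have h3 : 1 ≤ Real.exp (C * s) := Real.one_le_exp (mul_nonneg hC0 hs.1)
      have h4 : 0 ≤ ∑ ℓ ∈ S.image Prod.snd, ‖g ℓ s‖ ^ 2 :=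
        Finset.sum_nonneg fun ℓ _ => by positivity
      simp only [ha]
      rw [← Finset.mul_sum, Finset.sum_add_distrib, ← Finset.sum_mul, h2, ← mul_assoc,
        mul_comm _ θ, mul_assoc θ, mul_assoc (Real.exp (C * (t - s)))]
      refine mul_le_mul_of_nonneg_left (mul_le_mul_of_nonneg_left ?_ (Real.exp_pos _).le) hθ
      have h5 : (∑ ℓ ∈ S.image Prod.snd, ‖b ℓ‖ ^ 2) * (Real.exp (C * s) * D) ≤
          c * (Real.exp (C * s) * D) := by
        gcongr
        exact hc _
      nlinarith [mul_nonneg (sub_nonneg.2 h3) h4]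
    rw [intervalIntegral.integral_const_mul, intervalIntegral.integral_const_mul,
      intervalIntegral.integral_add intervalIntegrable_const
      (intervalIntegrable_finset_sum _ fun ℓ _ => (hg2 ℓ).mono_set hsub),
      intervalIntegral.integral_const,
      intervalIntegral.integral_finsetSum fun ℓ _ => (hg2 ℓ).mono_set hsub] at hle
    have h6 : ∑ ℓ ∈ S.image Prod.snd, ∫ s in (0)..t, ‖g ℓ s‖ ^ 2 ≤ Γ := by
      refine le_trans (Finset.sum_le_sum fun ℓ _ => ?_) (hΓ (S.image Prod.snd))
      exact intervalIntegral.integral_mono_interval le_rfl ht.1.le ht.2.le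
        (ae_of_all _ fun s => by positivity) (hg2 ℓ)
    simp only [Nat.cast_zero, zero_add, one_mul, Nat.factorial_one, Nat.cast_one, chaosBound,
      pow_one, div_one, pow_zero, Nat.factorial_zero]
    refine hle.trans ?_
    simp only [sub_zero, smul_eq_mul]
    refine mul_le_mul_of_nonneg_left (mul_le_mul_of_nonneg_left ?_ (Real.exp_pos _).le) hθ
    linarith
  | succ j ih =>
    have hM := continuous_chaosBound θ C c D Γ j
    have h1 := hA.two_mul_pairForm_succ_le hδ hCA hC hN hm S (j + 1) hV hUV hZ (hU' (j + 1))
      (a := fun ℓ s => ‖b ℓ‖ ^ 2 * ((j + 1).factorial * chaosBound θ C c D Γ j s))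
      (fun ℓ => Continuous.intervalIntegrable (by fun_prop) _ _)
      (fun s hs hsN L lam hlam hL ℓ D'' => ?_) ht htN D'
    · refine h1.trans (add_le_add ?_ le_rfl)
      have hle : (∫ s in (0)..t, Real.exp (C * (t - s)) * ∑ ℓ ∈ S.image Prod.snd,
          ‖b ℓ‖ ^ 2 * ((j + 1).factorial * chaosBound θ C c D Γ j s)) ≤
          ∫ s in (0)..t, (j + 1).factorial *
            (Real.exp (C * (t - s)) * (c * chaosBound θ C c D Γ j s)) := by
        refine intervalIntegral.integral_mono_on ht.1.le
          (Continuous.intervalIntegrable (by fun_prop) _ _)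
          (Continuous.intervalIntegrable (by fun_prop) _ _) fun s hs => ?_
        have h2 := chaosBound_nonneg (C := C) hθ hc0 hD hΓ0 j hs.1
        rw [← Finset.sum_mul, mul_left_comm _ (Real.exp _), mul_left_comm (Nat.cast _) c]
        gcongr
        exact hc _
      rw [intervalIntegral.integral_const_mul, integral_chaosBound] at hle
      have h3 := mul_le_mul_of_nonneg_left hle (by positivity : (0 : ℝ) ≤ ((j + 1 : ℕ) : ℝ) + 1)
      refine h3.trans (le_of_eq ?_)
      rw [Nat.factorial_succ (j + 1)]
      push_cast
      ring
    -- The adjoint of `b ℓ` moves onto the test tensor; the induction hypothesis then applies with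
    -- `b* L` in place of `L`, at the cost of `‖b ℓ‖²`.
    · have h2 : pairForm H S (j + 1) (fun α => L (D'' α)) (fun β => Z ℓ β s) =
          pairForm H S (j + 1) (fun α => ((b ℓ).adjoint ∘L L) (D'' α)) (fun β => ι (V β s)) := by
        simp only [ContinuousLinearMap.comp_apply]
        rw [pairForm_comp_adjoint]
        refine pairForm_congr_right _ _ _ fun α hα => ?_
        have : α ≠ 0 := by
          rintro rfl
          simp at hα
        simp [hZdef, this]
      rw [h2]
      have h3 := two_mul_pairForm_comp_le hm ⟨hs.1.le, hs.2.le⟩ S (j + 1)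
        (fun D₀ => ih hs hsN D₀) (L := (b ℓ).adjoint ∘L L) (lam := ‖b ℓ‖ ^ 2 * lam)
        (by positivity) (fun x => ?_) D''
      · refine h3.trans (le_of_eq (by ring))
      · have h4 := (b ℓ).adjoint.le_opNorm (L x)
        rw [LinearIsometryEquiv.norm_map] at h4
        calc ‖((b ℓ).adjoint ∘L L) x‖ ^ 2 ≤ (‖b ℓ‖ * ‖L x‖) ^ 2 := by
              gcongr
              exact h4
          _ = ‖b ℓ‖ ^ 2 * ‖L x‖ ^ 2 := by ring
          _ ≤ ‖b ℓ‖ ^ 2 * lam * ‖x‖ ^ 2 := by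
              rw [mul_assoc]
              gcongr
              exact hL x

end Induction

/-! ### The Gram matrix is dominated by the identity. -/

section Gram

variable {T : ℝ}

/-- The functions `K_ℓ h_k / ‖K_ℓ‖`. -/
noncomputable def noiseFun (K : ℕ → L2 T →L[ℝ] L2 T) (h : ℕ → L2 T) (p : ℕ × ℕ) (s : ℝ) : ℝ :=
  ‖K p.2‖⁻¹ * (K p.2 (h p.1) : ℝ → ℝ) s

theorem memLp_noiseFun (K : ℕ → L2 T →L[ℝ] L2 T) (h : ℕ → L2 T) (p : ℕ × ℕ) :
    MemLp (noiseFun K h p) 2 (leb T) :=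
  (Lp.memLp (K p.2 (h p.1))).const_mul _

/-- If `‖K_ℓ‖ = 0`, the convention `0⁻¹ = 0` is consistent because `K_ℓ` itself vanishes. -/
theorem coe_eq_norm_mul_noiseFun (K : ℕ → L2 T →L[ℝ] L2 T) (h : ℕ → L2 T) (p : ℕ × ℕ) :
    ∀ᵐ s ∂leb T, (K p.2 (h p.1) : ℝ → ℝ) s = ‖K p.2‖ * noiseFun K h p s := by
  by_cases h0 : ‖K p.2‖ = 0
  · have : K p.2 (h p.1) = 0 := by
      rw [norm_eq_zero.1 h0]
      rfl
    rw [this]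
    filter_upwards [Lp.coeFn_zero ℝ 2 (leb T)] with s hs
    rw [hs, h0, zero_mul]
    rfl
  · refine ae_of_all _ fun s => ?_
    rw [noiseFun, mul_inv_cancel_left₀ h0]

/-- The sum is the image of `∑ c_p h_{p.1}` under the contraction `‖K_ℓ‖⁻¹ K_ℓ`. -/
theorem integral_sum_noiseFun_sq_le (hT : 0 ≤ T) (K : ℕ → L2 T →L[ℝ] L2 T) {h : ℕ → L2 T}
    (hh : Orthonormal ℝ h) (S : Finset (ℕ × ℕ)) (ℓ : ℕ) (hS : ∀ p ∈ S, p.2 = ℓ) (c : ℕ × ℕ → ℝ) :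
    ∫ s in (0)..T, (∑ p ∈ S, noiseFun K h p s * c p) ^ 2 ≤ ∑ p ∈ S, c p * c p := by
  set x : L2 T := ∑ p ∈ S, c p • h p.1 with hx
  have hx2 : ‖x‖ ^ 2 = ∑ p ∈ S, c p * c p := by
    rw [← real_inner_self_eq_norm_sq, hx, sum_inner]
    refine Finset.sum_congr rfl fun p hp => ?_
    rw [inner_sum, Finset.sum_eq_single p]
    · rw [inner_smul_left, inner_smul_right, real_inner_self_eq_norm_sq, hh.1]
      simp
    · intro q hq hqp
      have : p.1 ≠ q.1 := fun hpq => hqp (Prod.ext hpq.symm ((hS q hq).trans (hS p hp).symm))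
      rw [inner_smul_left, inner_smul_right, hh.2 this]
      simp
    · exact fun h => absurd hp h
  have h1 : ∀ᵐ s ∂leb T, ∑ p ∈ S, noiseFun K h p s * c p = ((‖K ℓ‖⁻¹ • K ℓ x : L2 T) : ℝ → ℝ) s := by
    have h2 : (‖K ℓ‖⁻¹ • K ℓ x : L2 T) = ∑ p ∈ S, (c p * ‖K ℓ‖⁻¹) • K ℓ (h p.1) := by
      rw [hx, map_sum, Finset.smul_sum]
      refine Finset.sum_congr rfl fun p _ => ?_
      rw [map_smul, smul_smul, mul_comm]
    have h3 : ∀ᵐ s ∂leb T, ∀ p ∈ S, (((c p * ‖K ℓ‖⁻¹) • K ℓ (h p.1) : L2 T) : ℝ → ℝ) s =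
        (c p * ‖K ℓ‖⁻¹) * (K ℓ (h p.1) : ℝ → ℝ) s := by
      rw [Filter.eventually_all_finset]
      intro p _
      filter_upwards [Lp.coeFn_smul (c p * ‖K ℓ‖⁻¹) (K ℓ (h p.1))] with s hs
      rw [hs]
      rfl
    rw [h2]
    filter_upwards [h3, Lp.coeFn_finsetSum S fun p => (c p * ‖K ℓ‖⁻¹) • K ℓ (h p.1)] with s hs hs'
    rw [hs', Finset.sum_apply]
    refine Finset.sum_congr rfl fun p hp => ?_
    rw [hs p hp, noiseFun, hS p hp]
    ring
  have h4 : ∫ s in (0)..T, (∑ p ∈ S, noiseFun K h p s * c p) ^ 2 = ‖‖K ℓ‖⁻¹ • K ℓ x‖ ^ 2 := by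
    rw [← real_inner_self_eq_norm_sq, L2.inner_def, intervalIntegral.integral_of_le hT,
      integral_Ioc_eq_integral_Ioo]
    refine integral_congr_ae ?_
    filter_upwards [h1] with s hs
    rw [hs, real_inner_self_eq_norm_sq, Real.norm_eq_abs, sq_abs]
  rw [h4, ← hx2]
  gcongr
  rw [norm_smul, norm_inv, norm_norm]
  by_cases h0 : ‖K ℓ‖ = 0
  · simp [h0]
  · exact (inv_mul_le_iff₀ (by positivity)).2 ((K ℓ).le_opNorm x)

theorem psdOn_idMatrix_sub_gramAt (K : ℕ → L2 T →L[ℝ] L2 T) {h : ℕ → L2 T}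
    (hh : Orthonormal ℝ h) {t : ℝ} (ht : t ∈ Icc 0 T) (S : Finset (ℕ × ℕ)) :
    PSDOn S (idMatrix (ℕ × ℕ) - gramAt (noiseKernel (noiseFun K h)) t) := by
  have hT : 0 ≤ T := ht.1.trans ht.2
  have hm := memLp_noiseFun K h
  refine ⟨fun p q => ?_, fun c => ?_⟩
  · rw [Pi.sub_apply, Pi.sub_apply, Pi.sub_apply, Pi.sub_apply, (psdOn_idMatrix S).1 p q,
      (psdOn_gramAt_noiseKernel hm ht S).1 p q]
  · simp only [Pi.sub_apply, sub_mul, Finset.sum_sub_distrib, sub_nonneg]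
    have hi : ∀ p q, IntervalIntegrable (fun s => noiseKernel (noiseFun K h) p q s * (c p * c q))
        volume 0 t := fun p q => (intervalIntegrable_sub (fun p q =>
        intervalIntegrable_noiseKernel hT hm p q) ht p q).mul_const _
    have hsq : ∀ ℓ, IntervalIntegrable
        (fun s => (∑ p ∈ S with p.2 = ℓ, noiseFun K h p s * c p) ^ 2) volume 0 T := by
      intro ℓ
      have hf : MemLp (fun s => ∑ p ∈ S with p.2 = ℓ, noiseFun K h p s * c p) 2 (leb T) :=
        memLp_finsetSum _ fun p _ => (hm p).mul_const (c p)
      have := MemLp.intervalIntegrable_norm_sq hT hf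
      simpa only [Real.norm_eq_abs, sq_abs] using this
    have hsub : uIcc 0 t ⊆ uIcc 0 T := by
      rw [uIcc_of_le ht.1, uIcc_of_le hT]
      exact Icc_subset_Icc_right ht.2
    calc ∑ p ∈ S, ∑ q ∈ S, gramAt (noiseKernel (noiseFun K h)) t p q * (c p * c q)
        = ∫ s in (0)..t, ∑ ℓ ∈ S.image Prod.snd,
            (∑ p ∈ S with p.2 = ℓ, noiseFun K h p s * c p) ^ 2 := by
          simp only [gramAt, ← intervalIntegral.integral_mul_const]
          rw [← intervalIntegral_sum_sum S S hi]
          refine intervalIntegral.integral_congr fun s _ => ?_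
          have h1 := sum_noiseKernel (m := noiseFun K h) S s (LinearMap.mul ℝ ℝ) c
          simp only [LinearMap.mul_apply', smul_eq_mul, ← sq] at h1
          exact h1
      _ = ∑ ℓ ∈ S.image Prod.snd, ∫ s in (0)..t,
            (∑ p ∈ S with p.2 = ℓ, noiseFun K h p s * c p) ^ 2 :=
          intervalIntegral.integral_finsetSum fun ℓ _ => (hsq ℓ).mono_set hsub
      _ ≤ ∑ ℓ ∈ S.image Prod.snd, ∑ p ∈ S with p.2 = ℓ, c p * c p := by
          refine Finset.sum_le_sum fun ℓ _ => le_trans ?_ (integral_sum_noiseFun_sq_le hT K hh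
            (Finset.filter (fun p => p.2 = ℓ) S) ℓ (fun p hp => (Finset.mem_filter.1 hp).2) c)
          exact intervalIntegral.integral_mono_interval le_rfl ht.1 ht.2
            (ae_of_all _ fun s => by positivity) (hsq ℓ)
      _ = ∑ p ∈ S, c p * c p :=
          Finset.sum_fiberwise_of_maps_to (fun p hp => Finset.mem_image_of_mem _ hp) _
      _ = ∑ p ∈ S, ∑ q ∈ S, idMatrix (ℕ × ℕ) p q * (c p * c q) := by
          refine Finset.sum_congr rfl fun p hp => ?_
          rw [Finset.sum_eq_single p]
          · simp [idMatrix]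
          · intro q _ hqp
            simp [idMatrix, hqp.symm]
          · exact fun h => absurd hp h

end Gram

/-! ### From weak bounds in `X'` to vectors of `H`. -/

section Representation

variable {X H : Type*} [NormedAddCommGroup X] [InnerProductSpace ℝ X]
  [NormedAddCommGroup H] [InnerProductSpace ℝ H] {ι : X →L[ℝ] H}

/-- Normalizing `x` by `‖ι x‖` turns the quadratic bound into continuity of `φ` for the `H`-norm on
the range of `ι`. Hahn–Banach and Riesz then give `w`. -/
theorem IsNormalTriple.exists_toDual_eq [CompleteSpace H] (hι : IsNormalTriple ι)
    {φ : StrongDual ℝ X} {M : ℝ} (hφ : ∀ x, 2 * φ x ≤ M + ‖ι x‖ ^ 2) :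
    ∃ w, toDual ι w = φ := by
  have hM : ∀ x, φ x ≤ ((M + 1) / 2) * ‖ι x‖ := by
    intro x
    rcases eq_or_ne x 0 with rfl | hx
    · simp
    · have h0 : 0 < ‖ι x‖ := norm_pos_iff.2 fun h => hx (hι.injective (by simpa using h))
      have h1 := hφ (‖ι x‖⁻¹ • x)
      rw [map_smul, map_smul, norm_smul, norm_inv, norm_norm, inv_mul_cancel₀ h0.ne',
        smul_eq_mul] at h1
      have h2 : φ x = ‖ι x‖ * (‖ι x‖⁻¹ * φ x) := by rw [mul_inv_cancel_left₀ h0.ne']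
      rw [h2, mul_comm]
      gcongr
      linarith
  set e := LinearEquiv.ofInjective ι.toLinearMap hι.injective with he
  have happly : ∀ y, ι (e.symm y) = (y : H) := fun y => by
    have := LinearEquiv.ofInjective_apply (h := hι.injective) ι.toLinearMap (e.symm y)
    rw [← he, e.apply_symm_apply] at this
    exact this.symm
  let ψ : StrongDual ℝ (LinearMap.range ι.toLinearMap) :=
    (φ.toLinearMap ∘ₗ e.symm.toLinearMap).mkContinuous ((M + 1) / 2) fun y => by
      rw [Real.norm_eq_abs, abs_le]
      have h1 := hM (e.symm y)
      have h2 := hM (-e.symm y)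
      rw [map_neg, map_neg, norm_neg] at h2
      rw [happly] at h1 h2
      constructor
      · simp only [LinearMap.comp_apply, LinearEquiv.coe_coe, ContinuousLinearMap.coe_coe]
        rw [Submodule.norm_coe] at h2
        linarith
      · exact h1
  obtain ⟨g, hg, -⟩ := exists_extension_norm_eq (LinearMap.range ι.toLinearMap) ψ
  refine ⟨(InnerProductSpace.toDual ℝ H).symm g, ContinuousLinearMap.ext fun x => ?_⟩
  rw [toDual_apply, InnerProductSpace.toDual_symm_apply]
  have h1 := hg (e x)
  have h2 : ((e x : LinearMap.range ι.toLinearMap) : H) = ι x := rfl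
  rw [h2] at h1
  rw [h1]
  change φ (e.symm (e x)) = φ x
  rw [e.symm_apply_apply]

/-- By density of `X` the test vectors may be taken in `H`, in particular equal to `w`. -/
theorem IsNormalTriple.sum_norm_sq_le {κ : Type*} [Fintype κ] (hι : IsNormalTriple ι)
    {w : κ → H} {M : ℝ} (hw : ∀ x : κ → X, 2 * ∑ a, toDual ι (w a) (x a) ≤ M + ∑ a, ‖ι (x a)‖ ^ 2) :
    ∑ a, ‖w a‖ ^ 2 ≤ M := by
  have h1 : ∀ y : κ → H, 2 * ∑ a, inner ℝ (w a) (y a) ≤ M + ∑ a, ‖y a‖ ^ 2 := by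
    have hd : DenseRange (Pi.map fun (_ : κ) => (ι : X → H)) := DenseRange.piMap fun _ => hι.denseRange
    intro y
    refine hd.induction_on (p := fun y => 2 * ∑ a, inner ℝ (w a) (y a) ≤ M + ∑ a, ‖y a‖ ^ 2) y ?_ hw
    exact isClosed_le (by fun_prop) (by fun_prop)
  have h2 := h1 w
  simp only [real_inner_self_eq_norm_sq] at h2
  linarith

/-- The weak form of a bound for `∑ ‖y_a‖_H²` passes to limits in `X'`. -/
theorem two_mul_sum_apply_le_of_ae {κ : Type*} [Fintype κ]
    {T : ℝ} (hT : 0 < T) {N : Set ℝ} (hN : volume N = 0)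
    {u : κ → ℝ → StrongDual ℝ X} (hu : ∀ a, ContinuousOn (u a) (Icc 0 T)) {y : κ → ℝ → H}
    (huy : ∀ a, ∀ r ∈ Ioo 0 T, r ∉ N → u a r = toDual ι (y a r)) {M : ℝ}
    (hM : ∀ r ∈ Ioo 0 T, r ∉ N → ∑ a, ‖y a r‖ ^ 2 ≤ M) {t : ℝ} (ht : t ∈ Icc 0 T)
    (x : κ → X) : 2 * ∑ a, u a t (x a) ≤ M + ∑ a, ‖ι (x a)‖ ^ 2 := by
  have h1 : Dense {s | s ∉ N} := Measure.dense_of_ae (measure_eq_zero_iff_ae_notMem.1 hN)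
  -- The good times are dense in the closed interval, so the endpoints are covered too.
  have h2 : t ∈ closure (Ioo 0 T ∩ {s | s ∉ N}) := by
    have h3 := closure_mono (h1.open_subset_closure_inter (isOpen_Ioo (a := (0 : ℝ)) (b := T)))
    rw [closure_Ioo hT.ne, closure_closure] at h3
    exact h3 ht
  refine ContinuousWithinAt.closure_le (f := fun s => 2 * ∑ a, u a s (x a))
    (g := fun _ => M + ∑ a, ‖ι (x a)‖ ^ 2) h2 ?_ continuousWithinAt_const fun r hr => ?_
  · refine continuousWithinAt_const.mul (tendsto_finsetSum _ fun a _ => ?_)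
    exact ((hu a t ht).mono (inter_subset_left.trans Ioo_subset_Icc_self)).clm_apply
      continuousWithinAt_const
  · refine le_trans ?_ (add_le_add (hM r hr.1 hr.2) le_rfl)
    rw [Finset.mul_sum, ← Finset.sum_add_distrib]
    refine Finset.sum_le_sum fun a _ => ?_
    rw [huy a r hr.1 hr.2, toDual_apply]
    have := real_inner_le_norm (y a r) (ι (x a))
    nlinarith [sq_nonneg (‖y a r‖ - ‖ι (x a)‖)]

end Representation

/-! ### Rescaling of the coefficients by `√α!`. -/

section Scaling

/-- The factorial `α! = ∏ α_{kℓ}!` of a multi-index. -/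
noncomputable def multiFactorial (α : MultiIndex) : ℝ := ∏ p ∈ α.support, ((α p).factorial : ℝ)

theorem multiFactorial_pos (α : MultiIndex) : 0 < multiFactorial α :=
  Finset.prod_pos fun _ _ => by positivity

theorem multiFactorial_eq_prod {α : MultiIndex} {S : Finset (ℕ × ℕ)} (hS : α.support ⊆ S) :
    multiFactorial α = ∏ p ∈ S, ((α p).factorial : ℝ) :=
  Finset.prod_subset hS fun p _ hp => by simp [Finsupp.notMem_support_iff.1 hp]

theorem multiFactorial_zero : multiFactorial 0 = 1 := by
  simp [multiFactorial]

theorem sqrt_multiFactorial_mul_sqrt {α : MultiIndex} {p : ℕ × ℕ} (hp : p ∈ α.support) :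
    √(multiFactorial α) * √(α p : ℝ) =
      α p * √(multiFactorial (α - Finsupp.single p 1)) := by
  have h1 : (α - Finsupp.single p 1).support ⊆ α.support := Finsupp.support_mono tsub_le_self
  have h2 : multiFactorial α = α p * multiFactorial (α - Finsupp.single p 1) := by
    rw [multiFactorial_eq_prod h1, multiFactorial, ← Finset.mul_prod_erase _ _ hp,
      ← Finset.mul_prod_erase _ _ hp, ← mul_assoc]
    congr 1
    · rw [Finsupp.tsub_apply, Finsupp.single_eq_same, ← Nat.cast_mul,
        Nat.mul_factorial_pred (Finsupp.mem_support_iff.1 hp)]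
    · refine Finset.prod_congr rfl fun q hq => ?_
      rw [Finsupp.tsub_apply, Finsupp.single_eq_of_ne (Finset.ne_of_mem_erase hq), tsub_zero]
  rw [h2, Real.sqrt_mul (by positivity), mul_right_comm, Real.mul_self_sqrt (by positivity)]

variable {X H : Type*} [NormedAddCommGroup X] [InnerProductSpace ℝ X]
  [NormedAddCommGroup H] [InnerProductSpace ℝ H]
  {ι : X →L[ℝ] H} {A : X →L[ℝ] StrongDual ℝ X} {T : ℝ}

/-- The system for `√α! u_α`, with normalized noise functions. -/
theorem sqrt_multiFactorial_smul_eq [CompleteSpace H] (hT : 0 ≤ T) (K : ℕ → L2 T →L[ℝ] L2 T)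
    (h : ℕ → L2 T) {v : MultiIndex → ℝ → X} (hv : ∀ α, MemLp (v α) 2 (leb T)) {B : ℕ → H →L[ℝ] H}
    {G : ℕ → ℝ → H} (hG : ∀ ℓ, MemLp (G ℓ) 2 (leb T)) {α : MultiIndex} {r : ℝ}
    (hr : r ∈ Icc 0 T) {S : Finset (ℕ × ℕ)} (hS : α.support ⊆ S) :
    √(multiFactorial α) • ((∫ s in (0)..r, A (v α s)) + ∑ p ∈ α.support, √(α p : ℝ) •
      ∫ s in (0)..r, (K p.2 (h p.1) : ℝ → ℝ) s •
        (toDual ι (B p.2 (ι (v (α - Finsupp.single p 1) s))) +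
          if α - Finsupp.single p 1 = 0 then toDual ι (G p.2 s) else 0)) =
    ∫ s in (0)..r, (A (√(multiFactorial α) • v α s) + toDual ι (creation S (fun q β =>
      noiseFun K h q s • ((‖K q.2‖ • B q.2) (ι (√(multiFactorial β) • v β s)) +
        if β = 0 then ‖K q.2‖ • G q.2 s else 0)) α)) := by
  have hii : ∀ {E : Type _} [NormedAddCommGroup E] {f : ℝ → E}, Integrable f (leb T) →
      IntervalIntegrable f volume 0 r := by
    intro E _ f hf
    have h1 : IntervalIntegrable f volume 0 T :=
      (intervalIntegrable_iff_integrableOn_Ioo_of_le hT).2 hf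
    refine h1.mono_set ?_
    rw [uIcc_of_le hr.1, uIcc_of_le hT]
    exact Icc_subset_Icc_right hr.2
  have hAi : IntervalIntegrable (fun s => A (√(multiFactorial α) • v α s)) volume 0 r :=
    hii (A.integrable_comp (((hv α).integrable (by norm_num)).smul _))
  set φ : ℕ × ℕ → ℝ → H := fun q s => noiseFun K h q s •
    ((‖K q.2‖ • B q.2) (ι (√(multiFactorial (α - Finsupp.single q 1)) •
      v (α - Finsupp.single q 1) s)) +
        if α - Finsupp.single q 1 = 0 then ‖K q.2‖ • G q.2 s else 0) with hφ
  have hφi : ∀ q, Integrable (φ q) (leb T) := by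
    intro q
    have h1 : MemLp (fun s => (‖K q.2‖ • B q.2) (ι (√(multiFactorial (α - Finsupp.single q 1)) •
      v (α - Finsupp.single q 1) s)) +
        if α - Finsupp.single q 1 = 0 then ‖K q.2‖ • G q.2 s else 0) 2 (leb T) := by
      refine MemLp.add (((‖K q.2‖ • B q.2) ∘L ι).comp_memLp' ((hv _).const_smul _)) ?_
      by_cases hβ : α - Finsupp.single q 1 = 0
      · simp only [hβ, if_true]
        exact (hG q.2).const_smul ‖K q.2‖
      · simp [hβ]
    exact memLp_one_iff_integrable.1 (h1.smul (memLp_noiseFun K h q) (r := 1))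
  have hψi : ∀ q, IntervalIntegrable (fun s => (α q : ℝ) • toDual ι (φ q s)) volume 0 r :=
    fun q => hii (((toDual ι).integrable_comp (hφi q)).smul (α q : ℝ))
  have h2 : ∀ s, A (√(multiFactorial α) • v α s) + toDual ι (creation S (fun q β =>
      noiseFun K h q s • ((‖K q.2‖ • B q.2) (ι (√(multiFactorial β) • v β s)) +
        if β = 0 then ‖K q.2‖ • G q.2 s else 0)) α) =
      A (√(multiFactorial α) • v α s) + ∑ q ∈ S, (α q : ℝ) • toDual ι (φ q s) := by
    intro s
    simp only [creation, map_sum, map_smul, hφ]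
  simp_rw [h2]
  rw [intervalIntegral.integral_add hAi (intervalIntegrable_finset_sum S fun q _ => hψi q),
    intervalIntegral.integral_finsetSum fun q _ => hψi q, smul_add, Finset.smul_sum]
  congr 1
  · rw [← intervalIntegral.integral_smul]
    simp only [map_smul]
  · rw [← Finset.sum_subset hS fun q _ hq => by simp [Finsupp.notMem_support_iff.1 hq]]
    refine Finset.sum_congr rfl fun q hq => ?_
    rw [intervalIntegral.integral_smul, smul_smul, sqrt_multiFactorial_mul_sqrt hq, mul_smul,
      ← intervalIntegral.integral_smul]
    congr 1
    have h3 : ∀ᵐ s ∂volume, s ∈ Ioo 0 T →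
        (K q.2 (h q.1) : ℝ → ℝ) s = ‖K q.2‖ * noiseFun K h q s :=
      (ae_restrict_iff' measurableSet_Ioo).1 (coe_eq_norm_mul_noiseFun K h q)
    refine intervalIntegral.integral_congr_ae ?_
    filter_upwards [h3, measure_eq_zero_iff_ae_notMem.1 (measure_singleton T)] with s hs hsT hsr
    rw [uIoc_of_le hr.1] at hsr
    rw [hs ⟨hsr.1, lt_of_le_of_ne (hsr.2.trans hr.2) hsT⟩]
    simp only [hφ, map_smul, map_add, smul_apply]
    by_cases hβ : α - Finsupp.single q 1 = 0
    · simp only [hβ, if_true, multiFactorial_zero, Real.sqrt_one, one_smul, map_smul]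
      module
    · simp only [hβ, if_false, add_zero, map_zero]
      module

end Scaling

/-! ### The estimate for finitely many noise modes at almost every time. -/

section Estimate

variable {X H : Type*} [NormedAddCommGroup X] [InnerProductSpace ℝ X] [CompleteSpace X]
  [NormedAddCommGroup H] [InnerProductSpace ℝ H] [CompleteSpace H]
  {ι : X →L[ℝ] H} {A : X →L[ℝ] StrongDual ℝ X} {δ CA T : ℝ} {N : Set ℝ}

/-- The test tensor is the rescaled solution itself. Domination of the Gram matrix allows half of `2
pairForm` to absorb the quadratic term, and the weights `(j+1)!/α!` cancel the rescaling. -/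
theorem sum_norm_sq_le_chaosBound (hA : StronglyParabolic ι A δ CA) (hδ : 0 < δ)
    (hCA : 0 ≤ CA) {C : ℝ} (hC : CA < C) (hN : volume N = 0)
    (K : ℕ → L2 T →L[ℝ] L2 T) {h : ℕ → L2 T} (hh : Orthonormal ℝ h)
    {v : MultiIndex → ℝ → X} (hv : ∀ α, MemLp (v α) 2 (leb T))
    {u : MultiIndex → ℝ → StrongDual ℝ X}
    (huv : ∀ α, ∀ r ∈ Ioo 0 T, r ∉ N → u α r = toDual ι (ι (v α r)))
    {B : ℕ → H →L[ℝ] H} {u₀ : H} {F : ℝ → StrongDual ℝ X} {G : ℕ → ℝ → H}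
    (hF : MemLp F 2 (leb T)) (hG : ∀ ℓ, MemLp (G ℓ) 2 (leb T))
    (hu₀ : ∀ r ∈ Icc 0 T, u 0 r = toDual ι u₀ + ∫ s in (0)..r, (A (v 0 s) + F s))
    (hu : ∀ α ≠ 0, ∀ r ∈ Icc 0 T, u α r = (∫ s in (0)..r, A (v α s)) +
      ∑ p ∈ α.support, √(α p : ℝ) • ∫ s in (0)..r, (K p.2 (h p.1) : ℝ → ℝ) s •
        (toDual ι (B p.2 (ι (v (α - Finsupp.single p 1) s))) +
          if α - Finsupp.single p 1 = 0 then toDual ι (G p.2 s) else 0))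
    {θ c Γ : ℝ} (hθ : 0 ≤ θ) (hΓ0 : 0 ≤ Γ)
    (hc : ∀ L : Finset ℕ, ∑ ℓ ∈ L, ‖K ℓ‖ ^ 2 * ‖B ℓ‖ ^ 2 ≤ c)
    (hΓ : ∀ L : Finset ℕ, ∑ ℓ ∈ L, ‖K ℓ‖ ^ 2 * ∫ s in (0)..T, ‖G ℓ s‖ ^ 2 ≤ Γ)
    (hθG : ∀ s ∈ Ioo 0 T, s ∉ N → ∀ ℓ (x : H) (a : ℝ),
      ‖x + a • G ℓ s‖ ^ 2 ≤ θ * (‖x‖ ^ 2 + ‖a • G ℓ s‖ ^ 2))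
    (S : Finset (ℕ × ℕ)) (j : ℕ) {t : ℝ} (ht : t ∈ Ioo 0 T) (htN : t ∉ N) :
    ∑ α ∈ S.finsuppAntidiag (j + 1), ‖ι (v α t)‖ ^ 2 ≤
      chaosBound θ C c (‖u₀‖ ^ 2 + 2 / δ * ∫ s in (0)..T, ‖F s‖ ^ 2) Γ j t := by
  have hT : 0 ≤ T := ht.1.le.trans ht.2.le
  have hm := memLp_noiseFun K h
  have hF2 := MemLp.intervalIntegrable_norm_sq hT hF
  have hFT : 0 ≤ ∫ s in (0)..T, ‖F s‖ ^ 2 :=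
    intervalIntegral.integral_nonneg hT fun s _ => by positivity
  set D := ‖u₀‖ ^ 2 + 2 / δ * ∫ s in (0)..T, ‖F s‖ ^ 2 with hD
  have hD0 : 0 ≤ D := by positivity
  have hv0 : ∀ s ∈ Ioo 0 T, s ∉ N → ‖ι (v 0 s)‖ ^ 2 ≤ Real.exp (C * s) * D := by
    intro s hs hsN
    have hleb : leb s ≤ leb T := Measure.restrict_mono (Ioo_subset_Ioo_right hs.2.le) le_rfl
    refine (hA.norm_sq_le hδ hCA hC hs.1 hN hsN ((hv 0).mono_measure hleb)
      (hF.mono_measure hleb) (fun r hr => hu₀ r ⟨hr.1, hr.2.trans hs.2.le⟩)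
      fun r hr hrN => huv 0 r ⟨hr.1, hr.2.trans_lt hs.2⟩ hrN).trans ?_
    have h1 : ∫ r in (0)..s, ‖F r‖ ^ 2 ≤ ∫ r in (0)..T, ‖F r‖ ^ 2 :=
      intervalIntegral.integral_mono_interval le_rfl hs.1.le hs.2.le
        (ae_of_all _ fun r => by positivity) hF2
    -- The energy estimate gives the better constant `1/δ`; the required bound has `2/δ`.
    have h2 : δ⁻¹ ≤ 2 / δ := by
      rw [inv_eq_one_div]
      gcongr
      norm_num
    refine mul_le_mul_of_nonneg_left (add_le_add le_rfl (mul_le_mul h2 h1 ?_ (by positivity)))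
      (Real.exp_pos _).le
    exact intervalIntegral.integral_nonneg hs.1.le fun r _ => by positivity
  have hbound := two_mul_pairForm_le_chaosBound (m := noiseFun K h) hA hδ hCA hC hN hm
    (V := fun α s => √(multiFactorial α) • v α s) (fun α => (hv α).const_smul _)
    (U := fun α s => √(multiFactorial α) • u α s)
    (fun α r hr hrN => by rw [huv α r hr hrN, map_smul, map_smul])
    (b := fun ℓ => ‖K ℓ‖ • B ℓ) (g := fun ℓ s => ‖K ℓ‖ • G ℓ s) (fun ℓ => (hG ℓ).const_smul _)
    (fun α hα S hS r hr => by
      rw [hu α hα r hr]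
      exact sqrt_multiFactorial_smul_eq hT K h hv hG hr hS)
    (θ := θ) (c := c) (D := D) (Γ := Γ) hθ hD0 hΓ0
    (fun L => by simpa only [norm_smul, norm_norm, mul_pow] using hc L)
    (fun L => by
      simpa only [norm_smul, norm_norm, mul_pow, intervalIntegral.integral_const_mul] using hΓ L)
    (fun s hs hsN ℓ => by
      refine (hθG s hs hsN ℓ _ _).trans (mul_le_mul_of_nonneg_left (add_le_add ?_ le_rfl) hθ)
      have h1 := (‖K ℓ‖ • B ℓ).le_opNorm (ι (v 0 s))
      simp only [multiFactorial_zero, Real.sqrt_one, one_smul]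
      calc ‖(‖K ℓ‖ • B ℓ) (ι (v 0 s))‖ ^ 2 ≤ (‖‖K ℓ‖ • B ℓ‖ * ‖ι (v 0 s)‖) ^ 2 := by gcongr
        _ = ‖‖K ℓ‖ • B ℓ‖ ^ 2 * ‖ι (v 0 s)‖ ^ 2 := mul_pow _ _ _
        _ ≤ _ := by
          gcongr
          exact hv0 s hs hsN)
    S j ht htN (fun α => ι (√(multiFactorial α) • v α t))
  have htI : t ∈ Icc 0 T := ⟨ht.1.le, ht.2.le⟩
  have hmono := tensorForm_mono (psdOn_gramAt_noiseKernel hm htI S) (psdOn_idMatrix S)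
    (psdOn_idMatrix_sub_gramAt K hh htI S) (b := innerₗ H) (b' := innerₗ H) (fun x => by simp)
    (fun x => le_rfl) (j + 1) (fun α => ι (√(multiFactorial α) • v α t))
  have hle : pairForm H S (j + 1) (fun α => ι (√(multiFactorial α) • v α t))
      (fun α => ι (√(multiFactorial α) • v α t)) ≤
      (j + 1).factorial * chaosBound θ C c D Γ j t := by
    have h1 : noiseForm H S (noiseFun K h) t (j + 1) (fun α => ι (√(multiFactorial α) • v α t))
      (fun α => ι (√(multiFactorial α) • v α t)) ≤ pairForm H S (j + 1)
        (fun α => ι (√(multiFactorial α) • v α t)) (fun α => ι (√(multiFactorial α) • v α t)) :=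
      hmono
    linarith
  have hsum : pairForm H S (j + 1) (fun α => ι (√(multiFactorial α) • v α t))
      (fun α => ι (√(multiFactorial α) • v α t)) =
      (j + 1).factorial * ∑ α ∈ S.finsuppAntidiag (j + 1), ‖ι (v α t)‖ ^ 2 := by
    simp only [pairForm, tensorForm_idMatrix_eq_sum]
    rw [Finset.mul_sum]
    refine Finset.sum_congr rfl fun α hα => ?_
    have h0 := multiFactorial_pos α
    rw [← multiFactorial_eq_prod (Finset.mem_finsuppAntidiag.1 hα).2, innerₗ_apply_apply,
      real_inner_self_eq_norm_sq, map_smul, norm_smul, mul_pow, Real.norm_eq_abs, sq_abs,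
      Real.sq_sqrt h0.le]
    field_simp
  rw [hsum] at hle
  exact le_of_mul_le_mul_left hle (by positivity)

theorem chaosBound_mono {θ C c D Γ : ℝ} (hθ : 0 ≤ θ) (hC : 0 ≤ C) (hc : 0 ≤ c) (hD : 0 ≤ D)
    (hΓ : 0 ≤ Γ) (j : ℕ) {s t : ℝ} (hs : 0 ≤ s) (hst : s ≤ t) :
    chaosBound θ C c D Γ j s ≤ chaosBound θ C c D Γ j t := by
  unfold chaosBound
  have ht := hs.trans hst
  gcongr

end Estimate

/-! ### Continuity of the coefficients in `X'`. -/

section Continuity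

variable {X H : Type*} [NormedAddCommGroup X] [InnerProductSpace ℝ X]
  [NormedAddCommGroup H] [InnerProductSpace ℝ H]
  {ι : X →L[ℝ] H} {A : X →L[ℝ] StrongDual ℝ X} {T : ℝ}

theorem continuousOn_of_eq (hT : 0 ≤ T) (K : ℕ → L2 T →L[ℝ] L2 T)
    (h : ℕ → L2 T) {v : MultiIndex → ℝ → X} (hv : ∀ α, MemLp (v α) 2 (leb T)) {B : ℕ → H →L[ℝ] H}
    {G : ℕ → ℝ → H} (hG : ∀ ℓ, MemLp (G ℓ) 2 (leb T)) {α : MultiIndex}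
    {u : ℝ → StrongDual ℝ X}
    (hu : ∀ r ∈ Icc 0 T, u r = (∫ s in (0)..r, A (v α s)) +
      ∑ p ∈ α.support, √(α p : ℝ) • ∫ s in (0)..r, (K p.2 (h p.1) : ℝ → ℝ) s •
        (toDual ι (B p.2 (ι (v (α - Finsupp.single p 1) s))) +
          if α - Finsupp.single p 1 = 0 then toDual ι (G p.2 s) else 0)) :
    ContinuousOn u (Icc 0 T) := by
  have hprim : ∀ {f : ℝ → StrongDual ℝ X}, Integrable f (leb T) →
      ContinuousOn (fun r => ∫ s in (0)..r, f s) (Icc 0 T) := by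
    intro f hf
    have := intervalIntegral.continuousOn_primitive_interval'
      ((intervalIntegrable_iff_integrableOn_Ioo_of_le hT).2 hf) left_mem_uIcc
    rwa [uIcc_of_le hT] at this
  refine ContinuousOn.congr ?_ hu
  refine (hprim (A.integrable_comp ((hv α).integrable (by norm_num)))).add
    (continuousOn_finsetSum _ fun p _ => ContinuousOn.const_smul (hprim ?_) (√(α p : ℝ)))
  have h1 : MemLp (fun s => toDual ι (B p.2 (ι (v (α - Finsupp.single p 1) s))) +
      if α - Finsupp.single p 1 = 0 then toDual ι (G p.2 s) else 0) 2 (leb T) := by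
    refine MemLp.add ((toDual ι ∘L B p.2 ∘L ι).comp_memLp' (hv _)) ?_
    by_cases hβ : α - Finsupp.single p 1 = 0
    · simp only [hβ, if_true]
      exact (toDual ι).comp_memLp' (hG _)
    · simp [hβ]
  exact memLp_one_iff_integrable.1 (h1.smul (Lp.memLp (K p.2 (h p.1))) (r := 1))

end Continuity

end ChaosEq

/-! ### Choice of the constant, passage to every time, and the limit in the growth rate. -/

theorem mainTheorem2
    -- probability space and time horizon
    {Ω : Type*} [MeasurableSpace Ω] (P : Measure Ω) [IsProbabilityMeasure P]
    (T : ℝ) (hT : 0 < T)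
    -- normal triple
    {X H : Type*} [NormedAddCommGroup X] [InnerProductSpace ℝ X] [CompleteSpace X]
    [NormedAddCommGroup H] [InnerProductSpace ℝ H] [CompleteSpace H]
    (ι : X →L[ℝ] H) (hι : ChaosEq.IsNormalTriple ι)
    -- strongly parabolic operator
    (A : X →L[ℝ] StrongDual ℝ X) (δA CA : ℝ) (hδA : 0 < δA) (hCA : 0 ≤ CA)
    (hA : ChaosEq.StronglyParabolic ι A δA CA)
    -- independent colored noises, their representations, and the variables `ξ_{kℓ}`
    (N : (ℓ : ℕ) → ChaosEq.L2 T → Ω → ℝ) (R K : ℕ → ChaosEq.L2 T →L[ℝ] ChaosEq.L2 T)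
    (W : ℕ → ℝ≥0 → Ω → ℝ)
    (hN : ∀ ℓ, ChaosEq.IsColoredNoise P T (R ℓ) (N ℓ))
    (hK : ∀ ℓ, ChaosEq.IsRepresentationOperator (R ℓ) (K ℓ))
    (hW : ∀ ℓ, ChaosEq.IsRepresentation P T (K ℓ) (W ℓ) (N ℓ))
    (hNind : iIndepFun (fun ℓ ω f => N ℓ f ω) P)
    (hWind : iIndepFun (fun ℓ ω t => W ℓ t ω) P)
    (h : HilbertBasis ℕ ℝ (ChaosEq.L2 T)) (ξ : ℕ → ℕ → Ω → ℝ)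
    (hξ : ∀ k ℓ, ChaosEq.IsWienerIntegral P T (W ℓ) (h k) (ξ k ℓ))
    -- bounded operators on `H` and non-random data
    (B : ℕ → H →L[ℝ] H)
    (u₀ : H) (F : ℝ → StrongDual ℝ X) (G : ℕ → ℝ → H)
    (hF : MemLp F 2 (ChaosEq.leb T)) (hG : ∀ ℓ, MemLp (G ℓ) 2 (ChaosEq.leb T))
    (hGsum : Summable fun ℓ => ‖K ℓ‖ ^ 2 * ∫ s in (0)..T, ‖G ℓ s‖ ^ 2)
    (CB : ℝ) (hCB : HasSum (fun ℓ => ‖K ℓ‖ ^ 2 * ‖B ℓ‖ ^ 2) CB)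
    -- the chaos solution
    (u : ChaosEq.MultiIndex → ℝ → StrongDual ℝ X)
    (hu : ChaosEq.IsChaosSolution P ι T K h ξ A
      (fun ℓ => ChaosEq.toDual ι ∘L B ℓ ∘L ι) (fun _ => ChaosEq.toDual ι u₀)
      (fun _ => F) (fun ℓ _ s => ChaosEq.toDual ι (G ℓ s)) u) :
    ∃ Co : ℝ, 1 ≤ Co ∧ Co ≤ 3 ∧
      ((∀ᵐ s ∂ChaosEq.leb T, F s = 0) → (∀ ℓ, ∀ᵐ s ∂ChaosEq.leb T, G ℓ s = 0) → Co = 1) ∧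
      ∀ t ∈ Icc 0 T, ∀ k : ℕ, 1 ≤ k →
        -- each `u_α(t)` with `|α| = k` belongs to `H`, where it is the vector `w α`
        ∃ w : {α : ChaosEq.MultiIndex // α.degree = k} → H,
          (∀ α, ChaosEq.toDual ι (w α) = u α t) ∧
          (Summable fun α => ‖w α‖ ^ 2) ∧
          ∑' α, ‖w α‖ ^ 2 ≤
            Co * Real.exp (CA * T) *
              ((CB * T) ^ k / (k.factorial : ℝ) *
                  (‖u₀‖ ^ 2 + 2 / δA * ∫ s in (0)..T, ‖F s‖ ^ 2) +
                (CB * T) ^ (k - 1) / ((k - 1).factorial : ℝ) *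
                  ∑' ℓ, ‖K ℓ‖ ^ 2 * ∫ s in (0)..T, ‖G ℓ s‖ ^ 2) := by
  classical
  have hB : ∀ ℓ, IsPreBrownianReal (W ℓ) P := fun ℓ => (hW ℓ).brownian.toIsPreBrownianReal
  obtain ⟨v, hv, huv, hu⟩ := hu
  simp only [ChaosEq.coeff_const hB hWind hξ] at hu
  -- The only loss is `‖x + y‖² ≤ 2(‖x‖² + ‖y‖²)` at order one, and it is avoided when every `G_ℓ`
  -- vanishes. So the value 1 or 2 suffices.
  set θ : ℝ := if ∀ ℓ, ∀ᵐ s ∂ChaosEq.leb T, G ℓ s = 0 then 1 else 2 with hθdef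
  have hθ1 : 1 ≤ θ := by
    rw [hθdef]
    split_ifs <;> norm_num
  have hθ3 : θ ≤ 3 := by
    rw [hθdef]
    split_ifs <;> norm_num
  have hθ0 : 0 ≤ θ := zero_le_one.trans hθ1
  -- There are countably many multi-indices and noises, so one null set serves all of them.
  obtain ⟨S₀, hS₀, huvS, hGS⟩ : ∃ S₀ : Set ℝ, volume S₀ = 0 ∧
      (∀ α, ∀ r ∈ Ioo 0 T, r ∉ S₀ → u α r = ChaosEq.toDual ι (ι (v α r))) ∧
      ∀ r ∈ Ioo 0 T, r ∉ S₀ → ∀ ℓ (x : H) (a : ℝ),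
        ‖x + a • G ℓ r‖ ^ 2 ≤ θ * (‖x‖ ^ 2 + ‖a • G ℓ r‖ ^ 2) := by
    have h1 : ∀ᵐ r ∂volume, r ∈ Ioo 0 T → (∀ α, u α r = ChaosEq.toDual ι (ι (v α r))) ∧
        ∀ ℓ (x : H) (a : ℝ), ‖x + a • G ℓ r‖ ^ 2 ≤ θ * (‖x‖ ^ 2 + ‖a • G ℓ r‖ ^ 2) := by
      rw [← ae_restrict_iff' measurableSet_Ioo]
      refine (ae_all_iff.2 huv).and ?_
      by_cases h : ∀ ℓ, ∀ᵐ s ∂ChaosEq.leb T, G ℓ s = 0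
      · filter_upwards [ae_all_iff.2 h] with r hr ℓ x a
        rw [hθdef, if_pos h, hr ℓ]
        simp
      · refine Filter.Eventually.of_forall fun r ℓ x a => ?_
        rw [hθdef, if_neg h]
        have h2 := parallelogram_law_with_norm ℝ x (a • G ℓ r)
        nlinarith [sq_nonneg ‖x - a • G ℓ r‖]
    refine ⟨_, ae_iff.1 h1, fun α r hr hrS => ?_, fun r hr hrS => ?_⟩
    · exact (not_not.1 hrS hr).1 α
    · exact (not_not.1 hrS hr).2
  set D := ‖u₀‖ ^ 2 + 2 / δA * ∫ s in (0)..T, ‖F s‖ ^ 2 with hD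
  set Γ := ∑' ℓ, ‖K ℓ‖ ^ 2 * ∫ s in (0)..T, ‖G ℓ s‖ ^ 2 with hΓ
  have hFT : 0 ≤ ∫ s in (0)..T, ‖F s‖ ^ 2 :=
    intervalIntegral.integral_nonneg hT.le fun s _ => by positivity
  have hD0 : 0 ≤ D := by positivity
  have hg0 : ∀ ℓ, 0 ≤ ‖K ℓ‖ ^ 2 * ∫ s in (0)..T, ‖G ℓ s‖ ^ 2 := fun ℓ =>
    mul_nonneg (by positivity) (intervalIntegral.integral_nonneg hT.le fun s _ => by positivity)
  have hΓ0 : 0 ≤ Γ := tsum_nonneg hg0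
  have hCB0 : 0 ≤ CB := hCB.nonneg fun ℓ => by positivity
  have hu₀ : ∀ r ∈ Icc 0 T,
      u 0 r = ChaosEq.toDual ι u₀ + ∫ s in (0)..r, (A (v 0 s) + F s) := by
    intro r hr
    simpa using hu 0 r hr
  have hu' : ∀ α ≠ 0, ∀ r ∈ Icc 0 T, u α r = (∫ s in (0)..r, A (v α s)) +
      ∑ p ∈ α.support, √(α p : ℝ) • ∫ s in (0)..r, (K p.2 (h p.1) : ℝ → ℝ) s •
        (ChaosEq.toDual ι (B p.2 (ι (v (α - Finsupp.single p 1) s))) +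
          if α - Finsupp.single p 1 = 0 then ChaosEq.toDual ι (G p.2 s) else 0) := by
    intro α hα r hr
    rw [hu α r hr]
    simp only [if_neg hα, zero_add, add_zero, ContinuousLinearMap.comp_apply]
  have hcont : ∀ α ≠ 0, ContinuousOn (u α) (Icc 0 T) :=
    fun α hα => ChaosEq.continuousOn_of_eq hT.le K h hv hG (hu' α hα)
  refine ⟨θ, hθ1, hθ3, fun _ h => by rw [hθdef, if_pos h], fun t ht k hk => ?_⟩
  obtain ⟨j, rfl⟩ := Nat.exists_eq_add_of_le' hk
  set M := θ * Real.exp (CA * T) * ((CB * T) ^ (j + 1) / ((j + 1).factorial : ℝ) * D +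
    (CB * T) ^ (j + 1 - 1) / ((j + 1 - 1).factorial : ℝ) * Γ) with hM
  have hgood : ∀ S : Finset (ℕ × ℕ), ∀ r ∈ Ioo 0 T, r ∉ S₀ →
      ∑ α ∈ S.finsuppAntidiag (j + 1), ‖ι (v α r)‖ ^ 2 ≤ M := by
    intro S r hr hrS
    -- The Euler scheme needs `C > C_A`; the bound is continuous in `C`, so `C` may decrease to
    -- `C_A`.
    have h1 : ∀ C, CA < C → ∑ α ∈ S.finsuppAntidiag (j + 1), ‖ι (v α r)‖ ^ 2 ≤
        ChaosEq.chaosBound θ C CB D Γ j T := fun C hC =>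
      (ChaosEq.sum_norm_sq_le_chaosBound hA hδA hCA hC hS₀ K h.orthonormal hv huvS hF hG hu₀ hu'
        hθ0 hΓ0 (fun L => sum_le_hasSum L (fun ℓ _ => by positivity) hCB)
        (fun L => hGsum.sum_le_tsum L fun ℓ _ => hg0 ℓ) hGS S j hr hrS).trans
        (ChaosEq.chaosBound_mono hθ0 (hCA.trans hC.le) hCB0 hD0 hΓ0 j hr.1.le hr.2.le)
    have h2 : Filter.Tendsto (fun C => ChaosEq.chaosBound θ C CB D Γ j T) (nhdsWithin CA (Ioi CA))
        (nhds (ChaosEq.chaosBound θ CA CB D Γ j T)) := by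
      refine tendsto_nhdsWithin_of_tendsto_nhds (Continuous.tendsto ?_ CA)
      unfold ChaosEq.chaosBound
      fun_prop
    have h3 := ge_of_tendsto h2 (by filter_upwards [self_mem_nhdsWithin] with C hC using h1 C hC)
    rwa [ChaosEq.chaosBound, ← mul_assoc] at h3
  have hsub : ∀ s : Finset {α : ChaosEq.MultiIndex // α.degree = j + 1}, ∀ x : s → X,
      2 * ∑ a : s, u a.1.1 t (x a) ≤ M + ∑ a : s, ‖ι (x a)‖ ^ 2 := by
    intro s x
    refine ChaosEq.two_mul_sum_apply_le_of_ae hT hS₀ (u := fun a : s => u a.1.1)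
      (y := fun a r => ι (v a.1.1 r)) (fun a => hcont _ fun h0 => ?_)
      (fun a r hr hrS => huvS _ r hr hrS) (fun r hr hrS => ?_) ht x
    · have := a.1.2
      rw [h0] at this
      simp at this
    -- A finite family of multi-indices is supported in the union of its supports, and the bound
    -- does not depend on that set.
    · refine le_trans ?_ (hgood (s.biUnion fun α => α.1.support) r hr hrS)
      rw [Finset.sum_coe_sort s fun a => ‖ι (v a.1 r)‖ ^ 2]
      refine (Finset.sum_map s (Function.Embedding.subtype _)
        fun α => ‖ι (v α r)‖ ^ 2).symm.trans_le ?_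
      refine Finset.sum_le_sum_of_subset_of_nonneg (fun α hα => ?_) fun _ _ _ => by positivity
      obtain ⟨a, ha, rfl⟩ := Finset.mem_map.1 hα
      refine Finset.mem_finsuppAntidiag.2 ⟨?_, Finset.subset_biUnion_of_mem
        (fun α : {α : ChaosEq.MultiIndex // α.degree = j + 1} => α.1.support) ha⟩
      refine Eq.trans (Eq.symm ?_) a.2
      exact (Finset.sum_subset (Finset.subset_biUnion_of_mem
        (fun α : {α : ChaosEq.MultiIndex // α.degree = j + 1} => α.1.support) ha)
        fun p _ hp => Finsupp.notMem_support_iff.1 hp)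
  have hex : ∀ α : {α : ChaosEq.MultiIndex // α.degree = j + 1},
      ∃ w, ChaosEq.toDual ι w = u α t := by
    intro α
    refine hι.exists_toDual_eq (M := M) fun x => ?_
    simpa using hsub {α} fun _ => x
  choose w hw using hex
  have hfin : ∀ s : Finset {α : ChaosEq.MultiIndex // α.degree = j + 1},
      ∑ α ∈ s, ‖w α‖ ^ 2 ≤ M := by
    intro s
    rw [← Finset.sum_coe_sort]
    refine hι.sum_norm_sq_le fun x => ?_
    simpa only [hw] using hsub s x
  have hsummable := summable_of_sum_le (fun α => by positivity) hfin
  exact ⟨w, hw, hsummable, hsummable.tsum_le_of_sum_le hfin⟩
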